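/- Write $e(x)=e^{2\pi i x}$. For $n\ge 1$ let $\mathbb H_n$ be the Siegel upper half space of complex symmetric $n\times n$ matrices with positive definite imaginary part. Let $g\ge 2$ and $k\in\tfrac12\mathbb Z$. A *Jacobi form* of genus $g-1$, weight $k$ and index $m\in\mathbb Z_{\ge 0}$ (of trivial type) is a holomorphic function $\phi:\mathbb H_{g-1}\times\mathbb C^{g-1}\to\mathbb C$ such that 1. for all $\gamma=\begin{pmatrix}a&b\\c&d\end{pmatrix}\in \mathrm{Sp}_{2(g-1)}(\mathbb Z)$ and every holomorphic square root $\omega$ of $\det(c\tau_1+d)$ on $\mathbb H_{g-1}$, $$\phi\big((a\tau_1+b)(c\tau_1+d)^{-1},\,{}^{t}(c\tau_1+d)^{-1}z\big)=\omega(\tau_1)^{2k}\,e\big(m\,{}^{t}z(c\tau_1+d)^{-1}c\,z\big)\,\phi(\tau_1,z);$$ 2. $\phi(\tau_1,z+\tau_1 l+\mu)=e\big(-m({}^{t}l\tau_1l+2\,{}^{t}l z)\big)\phi(\tau_1,z)$ for all $l,\mu\in\mathbb Z^{g-1}$; 3. $\phi$ has an absolutely convergent Fourier expansion $\phi(\tau_1,z)=\sum_{s,r}c(\phi;s,r)\,e(\mathrm{tr}(s\tau_1)+{}^{t}rz)$,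 where $s$ runs through half-integral symmetric matrices and $r$ through $\mathbb Z^{g-1}$; if $g-1=1$, then in addition $c(\phi;s,r)\neq0$ only if $\begin{pmatrix}s&r/2\\{}^{t}r/2&m\end{pmatrix}$ is positive semidefinite. A *symmetric formal Fourier–Jacobi series* of genus $g$, cogenus $1$ and weight $k$ is a formal series $f=\sum_{m\ge0}\phi_m(\tau_1,z)\,q_2^m$, where $\phi_m$ is a Jacobi form of genus $g-1$, weight $k$ and index $m$, whose coefficients $c(f;t)=c(\phi_m;s,r)$ for $t=\begin{pmatrix}s&r/2\\{}^{t}r/2&m\end{pmatrix}$ (with $c(f;t)=0$ if $m<0$) satisfy $c(f;t)=w^{2k}\,c(f;{}^{t}u\,t\,u)$ for all half-integral symmetric $g\times g$ matrices $t$, all $u\in\mathrm{GL}_g(\mathbb Z)$ and all $w\in\mathbb C$ with $w^2=\det u$ (so $w^{2k}=\det(u)^k$ for integral $k$). It is *cuspidal* if $\phi_0=0$. For $N\in\mathbb Z_{>0}$, a point $(\tau_1,z)\in\mathbb H_{g-1}\times\mathbb C^{g-1}$ is an *$N$-torsion point* if $z=\tau_1\lambda+\mu$ with $\lambda,\mu\in\frac1N\mathbb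 Z^{g-1}$; it is a *torsion point* if it is an $N$-torsion point for some $N\in\mathbb Z_{>0}$. **Corollary.** Let $f=\sum_m\phi_m q_2^m$ be a cuspidal symmetric formal Fourier–Jacobi series of genus $g\ge2$, cogenus $1$ and weight $k$. Let $(\tau_1,z)\in\mathbb H_{g-1}\times\mathbb C^{g-1}$ be an $N$-torsion point, and put $C={}^{t}(\operatorname{Im}z)(\operatorname{Im}\tau_1)^{-1}(\operatorname{Im}z)$. Then the power series $\sum_m\phi_m(\tau_1,z)\,q_2^m$ converges absolutely on the disc $|q_2|<e^{-2\pi C}$ and defines a holomorphic function of $q_2$ there. In particular, for every $\tau=\begin{pmatrix}\tau_1&z\\{}^{t}z&\tau_2\end{pmatrix}\in\mathbb H_g$ for which $(\tau_1,z)$ is a torsion point, the series $\sum_m\phi_m(\tau_1,z)\,e(\tau_2)^m$ converges absolutely. -/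

import Mathlib

namespace FJ

open Matrix

/-- `e(x) = exp(2 π i x)`. -/
noncomputable def e (x : ℂ) : ℂ := Complex.exp (2 * Real.pi * Complex.I * x)

/-- Entrywise imaginary part of a complex matrix. -/
def imMat {ι : Type*} (τ : Matrix ι ι ℂ) : Matrix ι ι ℝ := τ.map Complex.im

/-- The Siegel upper half space: complex symmetric matrices with positive definite
imaginary part, with rows and columns indexed by `ι` (the genus is the cardinality of `ι`). -/
def siegelUpperHalf (ι : Type*) [Fintype ι] : Set (Matrix ι ι ℂ) :=
  {τ | τ.IsSymm ∧ (imMat τ).PosDef}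

/-- Half-integral symmetric matrices: integral diagonal, off-diagonal entries in `½ ℤ`. -/
def IsHalfIntegral {ι : Type*} (t : Matrix ι ι ℚ) : Prop :=
  t.IsSymm ∧ (∀ i, ∃ a : ℤ, t i i = a) ∧ ∀ i j, ∃ a : ℤ, 2 * t i j = a

/-- The matrix `t = (s, r/2; rᵀ/2, m)` of size `n + 1`. -/
def blockIndex {n : ℕ} (s : Matrix (Fin n) (Fin n) ℚ) (r : Fin n → ℤ) (m : ℚ) :
    Matrix (Fin n ⊕ Unit) (Fin n ⊕ Unit) ℚ :=
  fromBlocks s (of fun i _ => (r i : ℚ) / 2) (of fun _ j => (r j : ℚ) / 2) (of fun _ _ => m)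

/-- `φ(τ, z) = ∑ c(s, r) e(tr(s τ) + rᵀ z)`, absolutely convergent on `ℍ_n × ℂⁿ`, where `s` runs
over half-integral matrices and `r` over integral vectors. The coefficients are uniquely
determined by `φ`. -/
def HasFourierExpansion {n : ℕ} (φ : Matrix (Fin n) (Fin n) ℂ → (Fin n → ℂ) → ℂ)
    (c : Matrix (Fin n) (Fin n) ℚ → (Fin n → ℤ) → ℂ) : Prop :=
  ∀ τ ∈ siegelUpperHalf (Fin n), ∀ z : Fin n → ℂ,
    HasSum
      (fun p : {s : Matrix (Fin n) (Fin n) ℚ // IsHalfIntegral s} × (Fin n → ℤ) =>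
        c p.1.1 p.2 *
          e ((p.1.1.map (fun x : ℚ => (x : ℂ)) * τ).trace + (fun i => (p.2 i : ℂ)) ⬝ᵥ z))
      (φ τ z)

/-- `a τ + b` for `γ = (a, b; c, d)`. -/
def num {n : ℕ} (γ : Matrix (Fin n ⊕ Fin n) (Fin n ⊕ Fin n) ℤ) (τ : Matrix (Fin n) (Fin n) ℂ) :
    Matrix (Fin n) (Fin n) ℂ :=
  γ.toBlocks₁₁.map (fun x : ℤ => (x : ℂ)) * τ + γ.toBlocks₁₂.map (fun x : ℤ => (x : ℂ))

/-- `c τ + d` for `γ = (a, b; c, d)`. -/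
def denom {n : ℕ} (γ : Matrix (Fin n ⊕ Fin n) (Fin n ⊕ Fin n) ℤ) (τ : Matrix (Fin n) (Fin n) ℂ) :
    Matrix (Fin n) (Fin n) ℂ :=
  γ.toBlocks₂₁.map (fun x : ℤ => (x : ℂ)) * τ + γ.toBlocks₂₂.map (fun x : ℤ => (x : ℂ))

/-- Jacobi forms of genus `n`, weight `k = κ / 2 ∈ ½ ℤ`, index `m` and trivial type.

An element of the metaplectic group over `γ = (a, b; c, d)` is a pair `(γ, ω)` with `ω`
a holomorphic square root of `det (c τ + d)` on `ℍ_n`, and its factor of automorphy of weight `k`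
is `ω(τ)^(2k)`. For each `γ` and `τ` the values `ω(τ)` are exactly the two square roots `w` of
`det (c τ + d)`, so invariance under the metaplectic group is invariance for all such `w`.
For even `κ` the factor `w ^ κ` is `det (c τ + d) ^ k`. -/
structure IsJacobiForm (n : ℕ) (κ : ℤ) (m : ℕ)
    (φ : Matrix (Fin n) (Fin n) ℂ → (Fin n → ℂ) → ℂ) : Prop where
  /-- Holomorphic on `ℍ_n × ℂⁿ` (an open subset of `Sym_n(ℂ) × ℂⁿ`). -/
  holomorphic : DifferentiableOn ℂ
    (fun p : Matrix (Fin n) (Fin n) ℂ × (Fin n → ℂ) => φ p.1 p.2)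
    (siegelUpperHalf (Fin n) ×ˢ Set.univ)
  /-- `φ((aτ+b)(cτ+d)⁻¹, (cτ+d)⁻ᵀ z) = det(cτ+d)^k e(m zᵀ(cτ+d)⁻¹c z) φ(τ, z)`. -/
  symplectic : ∀ γ ∈ symplecticGroup (Fin n) ℤ, ∀ τ ∈ siegelUpperHalf (Fin n),
    ∀ (z : Fin n → ℂ) (w : ℂ), w ^ 2 = (denom γ τ).det →
      φ (num γ τ * (denom γ τ)⁻¹) ((denom γ τ)⁻¹ᵀ *ᵥ z) =
        w ^ κ *
          e (m * (z ⬝ᵥ (((denom γ τ)⁻¹ * γ.toBlocks₂₁.map (fun x : ℤ => (x : ℂ))) *ᵥ z))) *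
          φ τ z
  /-- `φ(τ, z + τ l + μ) = e(-m (lᵀ τ l + 2 lᵀ z)) φ(τ, z)` for integral `l`, `μ`. -/
  heisenberg : ∀ (l μ : Fin n → ℤ), ∀ τ ∈ siegelUpperHalf (Fin n), ∀ z : Fin n → ℂ,
      φ τ (z + τ *ᵥ (fun i => (l i : ℂ)) + fun i => (μ i : ℂ)) =
        e (-(m * ((fun i => (l i : ℂ)) ⬝ᵥ (τ *ᵥ fun i => (l i : ℂ)) +
          2 * ((fun i => (l i : ℂ)) ⬝ᵥ z)))) * φ τ z
  /-- Fourier expansion; in genus `1`, holomorphy at the cusp is imposed: only coefficients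
  with `(s, r/2; rᵀ/2, m)` positive semidefinite may be nonzero. -/
  fourier : ∃ c : Matrix (Fin n) (Fin n) ℚ → (Fin n → ℤ) → ℂ, HasFourierExpansion φ c ∧
    (n = 1 → ∀ s r, IsHalfIntegral s → c s r ≠ 0 → (blockIndex s r m).PosSemidef)

/-- `a` is the family of Fourier coefficients `a(t) = c(f; t)` of the formal series
`f = ∑_{m ≥ 0} φ_m q₂^m`: `c(f; (s, r/2; rᵀ/2, m))` is the `(s, r)`-th Fourier coefficient of `φ_m`,
and `c(f; t) = 0` if the lower right entry of `t` is negative. -/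
def IsCoeffFamily {n : ℕ} (φ : ℕ → Matrix (Fin n) (Fin n) ℂ → (Fin n → ℂ) → ℂ)
    (a : Matrix (Fin n ⊕ Unit) (Fin n ⊕ Unit) ℚ → ℂ) : Prop :=
  (∀ m : ℕ, HasFourierExpansion (φ m) (fun s r => a (blockIndex s r m))) ∧
    ∀ t, IsHalfIntegral t → t (Sum.inr ()) (Sum.inr ()) < 0 → a t = 0

/-- `f = ∑_{m ≥ 0} φ_m q₂^m` is a symmetric formal Fourier-Jacobi series of genus `g = n + 1`,
cogenus `1`, weight `k = κ / 2` and trivial type: each `φ_m` is a Jacobi form of weight `k` and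
index `m`, and `c(f; t) = det(u)^k c(f; uᵀ t u)` for all `u ∈ GL_g(ℤ)`. As above,
`det(u)^k` stands for `w^(2k)`, with `w` any square root of `det u`. -/
structure IsSymmetricFJ (n : ℕ) (κ : ℤ)
    (φ : ℕ → Matrix (Fin n) (Fin n) ℂ → (Fin n → ℂ) → ℂ) : Prop where
  jacobi : ∀ m, IsJacobiForm n κ m (φ m)
  symmetric : ∃ a : Matrix (Fin n ⊕ Unit) (Fin n ⊕ Unit) ℚ → ℂ, IsCoeffFamily φ a ∧
    ∀ (u : GL (Fin n ⊕ Unit) ℤ) (w : ℂ),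
      w ^ 2 = ((u : Matrix (Fin n ⊕ Unit) (Fin n ⊕ Unit) ℤ).det : ℂ) →
      ∀ t, IsHalfIntegral t →
        a t = w ^ κ *
          a ((u.1.map (fun x : ℤ => (x : ℚ)))ᵀ * t * u.1.map (fun x : ℤ => (x : ℚ)))

/-- `f` is cuspidal if `φ_0 = 0` on `ℍ_n × ℂⁿ`. -/
def IsCuspidal {n : ℕ} (φ : ℕ → Matrix (Fin n) (Fin n) ℂ → (Fin n → ℂ) → ℂ) : Prop :=
  ∀ τ ∈ siegelUpperHalf (Fin n), ∀ z : Fin n → ℂ, φ 0 τ z = 0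

/-- `(τ, z) ∈ ℍ_n × ℂⁿ` is an `N`-torsion point: `z = τ l + μ` with `l, μ ∈ (1/N) ℤⁿ`. -/
def IsTorsionPoint {n : ℕ} (N : ℕ) (τ : Matrix (Fin n) (Fin n) ℂ) (z : Fin n → ℂ) : Prop :=
  τ ∈ siegelUpperHalf (Fin n) ∧ ∃ l μ : Fin n → ℤ,
    z = τ *ᵥ (fun i => (l i : ℂ) / N) + fun i => (μ i : ℂ) / N

/-- `C = (Im z)ᵀ (Im τ)⁻¹ (Im z)`. -/
noncomputable def torsionC {n : ℕ} (τ : Matrix (Fin n) (Fin n) ℂ) (z : Fin n → ℂ) : ℝ :=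
  (fun i => (z i).im) ⬝ᵥ ((imMat τ)⁻¹ *ᵥ fun i => (z i).im)

end FJ

/-!
For real `x`, `y` the quantity
`‖φ(τ, τ x + y)‖ exp (-2π m xᵀ (Im τ) x) det (Im τ) ^ (k / 2)`
is unchanged by the symplectic action and by integral shifts of `x` and `y`. By reduction theory,
each of its values at an `N`-torsion point is therefore attained over `Im τ ≥ 2 c`, where `c > 0`
depends only on the genus, at one of finitely many pairs `(x, y)`.

At `z = τ x + y` the Fourier expansion of `φ_m` is a series in `τ` indexed by
`T = (1, x) t (1, x)ᵀ`, which is positive definite: by cuspidality and symmetry under `GL_g(ℤ)`, the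
coefficients are supported on positive definite `t`. Let `M_m` be the supremum of the torsion
values of `φ_m`. Evaluating at `τ - i c` shows that the terms with `tr T > B` contribute at most
`M_m / 2` once `B` is large, uniformly in `m`. The terms with `tr T ≤ B` are moved by a single
`u ∈ GL_g(ℤ)`, whose last column is proportional to `(N e_i, l_i)` for a coordinate
`x_i = l_i / N`, to coefficients of the finitely many `φ_k` with `k` bounded independently of `m`,
and sum up to at most `A exp (ε m)`. Hence `M_m ≤ 2 A exp (ε m)` for every `ε > 0`, which gives the
radius of convergence; a point of `ℍ_g` satisfies `Im τ₂ > C` because its imaginary part is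
positive definite.
-/

namespace FJ

open Matrix

section PosSemidef

variable {ι : Type*}

lemma isSymm_of_posDef {A : Matrix ι ι ℝ} (hA : A.PosDef) : A.IsSymm :=
  isHermitian_iff_isSymm.mp hA.isHermitian

variable [Fintype ι]

open scoped MatrixOrder in
lemma exists_eq_transpose_mul_self {A : Matrix ι ι ℝ} (hA : A.PosSemidef) :
    ∃ B : Matrix ι ι ℝ, A = Bᵀ * B := by
  classical
  obtain ⟨B, hB⟩ := CStarAlgebra.nonneg_iff_eq_star_mul_self.mp hA.nonneg
  exact ⟨B, by simpa [star_eq_conjTranspose] using hB⟩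

lemma dotProduct_transpose_mul_self_mulVec (B : Matrix ι ι ℝ) (x y : ι → ℝ) :
    x ⬝ᵥ ((Bᵀ * B) *ᵥ y) = (B *ᵥ x) ⬝ᵥ (B *ᵥ y) := by
  rw [← mulVec_mulVec, dotProduct_mulVec, vecMul_transpose]

lemma trace_mul_nonneg {A B : Matrix ι ι ℝ} (hA : A.PosSemidef) (hB : B.PosSemidef) :
    0 ≤ (A * B).trace := by
  obtain ⟨C, rfl⟩ := exists_eq_transpose_mul_self hB
  rw [← Matrix.mul_assoc, trace_mul_comm, ← Matrix.mul_assoc]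
  simpa using (hA.mul_mul_conjTranspose_same C).trace_nonneg

lemma quadForm_nonneg {A : Matrix ι ι ℝ} (hA : A.PosSemidef) (x : ι → ℝ) :
    0 ≤ x ⬝ᵥ (A *ᵥ x) := by
  simpa using hA.dotProduct_mulVec_nonneg x

lemma quadForm_pos {A : Matrix ι ι ℝ} (hA : A.PosDef) {x : ι → ℝ} (hx : x ≠ 0) :
    0 < x ⬝ᵥ (A *ᵥ x) := by
  simpa using hA.dotProduct_mulVec_pos hx

lemma posDef_of_quadForm_pos {A : Matrix ι ι ℝ} (hA : A.IsSymm)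
    (hpos : ∀ x : ι → ℝ, x ≠ 0 → 0 < x ⬝ᵥ (A *ᵥ x)) : A.PosDef :=
  .of_dotProduct_mulVec_pos (isHermitian_iff_isSymm.mpr hA) fun x hx => by simpa using hpos x hx

lemma quadForm_le_trace_mul {A : Matrix ι ι ℝ} (hA : A.PosSemidef) (x : ι → ℝ) :
    x ⬝ᵥ (A *ᵥ x) ≤ A.trace * (x ⬝ᵥ x) := by
  obtain ⟨B, rfl⟩ := exists_eq_transpose_mul_self hA
  have htrace : (Bᵀ * B).trace = ∑ i, ∑ j, B i j ^ 2 := by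
    rw [trace_mul_comm]
    simp [trace, mul_apply, sq]
  rw [dotProduct_transpose_mul_self_mulVec, htrace, Finset.sum_mul]
  refine Finset.sum_le_sum fun i _ => ?_
  simpa [dotProduct, mulVec, sq] using Finset.sum_mul_sq_le_sq_mul_sq Finset.univ (B i) x

lemma bilinForm_sq_le {A : Matrix ι ι ℝ} (hA : A.PosSemidef) (x y : ι → ℝ) :
    (x ⬝ᵥ (A *ᵥ y)) ^ 2 ≤ (x ⬝ᵥ (A *ᵥ x)) * (y ⬝ᵥ (A *ᵥ y)) := by
  obtain ⟨B, rfl⟩ := exists_eq_transpose_mul_self hA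
  simp only [dotProduct_transpose_mul_self_mulVec]
  simpa [dotProduct, sq] using Finset.sum_mul_sq_le_sq_mul_sq Finset.univ (B *ᵥ x) (B *ᵥ y)

lemma dotProduct_self_le_trace_inv_mul_quadForm [DecidableEq ι] {A : Matrix ι ι ℝ}
    (hA : A.PosDef) (x : ι → ℝ) : x ⬝ᵥ x ≤ A⁻¹.trace * (x ⬝ᵥ (A *ᵥ x)) := by
  have hdet : IsUnit A.det := (isUnit_iff_isUnit_det A).mp hA.isUnit
  have hcs := bilinForm_sq_le hA.posSemidef x (A⁻¹ *ᵥ x)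
  rw [mulVec_mulVec, mul_nonsing_inv A hdet, one_mulVec, dotProduct_comm (A⁻¹ *ᵥ x)] at hcs
  have hinv := quadForm_le_trace_mul hA.inv.posSemidef x
  have hquad := quadForm_nonneg hA.posSemidef x
  have hself : 0 ≤ x ⬝ᵥ x := by simpa using dotProduct_star_self_nonneg x
  rcases hself.eq_or_lt with hzero | hpos
  · rw [← hzero]
    exact mul_nonneg hA.inv.posSemidef.trace_nonneg hquad
  · nlinarith [mul_le_mul_of_nonneg_left hinv hquad]

lemma posSemidef_sub_smul_one [DecidableEq ι] {A : Matrix ι ι ℝ} (hA : A.IsSymm) {c : ℝ}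
    (h : ∀ x : ι → ℝ, c * (x ⬝ᵥ x) ≤ x ⬝ᵥ (A *ᵥ x)) : (A - c • 1).PosSemidef := by
  refine .of_dotProduct_mulVec_nonneg (isHermitian_iff_isSymm.mpr ?_) fun x => ?_
  · exact hA.sub (isSymm_one.smul c)
  · simpa [sub_mulVec, smul_mulVec, dotProduct_sub] using h x

lemma pow_card_mul_det_mul_det_le_exp_trace [DecidableEq ι] {s Y : Matrix ι ι ℝ}
    (hs : s.PosSemidef) (hY : Y.PosSemidef) {η : ℝ} (hη : 0 < η) :
    η ^ Fintype.card ι * (s.det * Y.det) ≤ Real.exp (η * (s * Y).trace) := by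
  obtain ⟨B, rfl⟩ := exists_eq_transpose_mul_self hY
  have hconj : (B * s * Bᵀ).PosSemidef := by simpa using hs.mul_mul_conjTranspose_same B
  have htr : (s * (Bᵀ * B)).trace = (B * s * Bᵀ).trace := by
    rw [← Matrix.mul_assoc, trace_mul_comm, ← Matrix.mul_assoc]
  have hdet : s.det * (Bᵀ * B).det = (B * s * Bᵀ).det := by
    simp only [det_mul, det_transpose]
    ring
  rw [htr, hdet, hconj.isHermitian.det_eq_prod_eigenvalues,
    hconj.isHermitian.trace_eq_sum_eigenvalues, Finset.mul_sum, Real.exp_sum,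
    ← Finset.card_univ, ← Finset.prod_const, ← Finset.prod_mul_distrib]
  simp only [RCLike.ofReal_real_eq_id, id]
  refine Finset.prod_le_prod (fun i _ => mul_nonneg hη.le (hconj.eigenvalues_nonneg i))
    fun i _ => ?_
  linarith [Real.add_one_le_exp (η * hconj.isHermitian.eigenvalues i)]

lemma le_eigenvalues_of_posSemidef_sub [DecidableEq ι] {Y : Matrix ι ι ℝ} (hY : Y.IsHermitian)
    {a : ℝ} (h : (Y - a • 1).PosSemidef) (i : ι) : a ≤ hY.eigenvalues i := by
  have hunit : (hY.eigenvectorBasis i).ofLp ⬝ᵥ (hY.eigenvectorBasis i).ofLp = 1 := by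
    have hnorm := hY.eigenvectorBasis.orthonormal.1 i
    rw [EuclideanSpace.norm_eq, Real.sqrt_eq_one] at hnorm
    simpa [dotProduct, sq] using hnorm
  have hquad := quadForm_nonneg h (hY.eigenvectorBasis i).ofLp
  simpa [sub_mulVec, smul_mulVec, hY.mulVec_eigenvectorBasis i, dotProduct_sub, hunit] using hquad

lemma det_sub_smul_one_eq_prod [DecidableEq ι] {Y : Matrix ι ι ℝ} (hY : Y.IsHermitian) (a : ℝ) :
    (Y - a • 1).det = ∏ i, (hY.eigenvalues i - a) := by
  have hchar : (scalar ι a - Y).det = ∏ i, (a - hY.eigenvalues i) := by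
    rw [← eval_charpoly, hY.charpoly_eq, Polynomial.eval_prod]
    simp
  rw [← neg_sub (a • 1) Y, det_neg, smul_one_eq_diagonal, ← scalar_apply, hchar,
    ← Finset.card_univ, ← Finset.prod_const, ← Finset.prod_mul_distrib]
  exact Finset.prod_congr rfl fun i _ => by ring

lemma det_sub_smul_one_bounds [DecidableEq ι] {Y : Matrix ι ι ℝ} {ε : ℝ}
    (hε : 0 < ε) (hY : (Y - (2 * ε) • 1).PosSemidef) :
    ε ^ Fintype.card ι ≤ (Y - ε • 1).det ∧ (Y - ε • 1).det ≤ Y.det ∧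
      Y.det ≤ 2 ^ Fintype.card ι * (Y - ε • 1).det := by
  have hherm : Y.IsHermitian := by
    simpa using hY.isHermitian.add (isHermitian_one.smul (.all (2 * ε)))
  have hdetY : Y.det = ∏ i, hherm.eigenvalues i := by
    simpa using hherm.det_eq_prod_eigenvalues
  have hev := le_eigenvalues_of_posSemidef_sub hherm hY
  rw [det_sub_smul_one_eq_prod hherm, hdetY, ← Finset.card_univ, ← Finset.prod_const,
    ← Finset.prod_const, ← Finset.prod_mul_distrib]
  refine ⟨Finset.prod_le_prod (fun i _ => hε.le) fun i _ => ?_,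
    Finset.prod_le_prod (fun i _ => ?_) fun i _ => ?_,
    Finset.prod_le_prod (fun i _ => ?_) fun i _ => ?_⟩ <;> linarith [hev i]

end PosSemidef

lemma exists_forall_le_two_mul {α : Type*} [Nonempty α] (f : α → ℝ) {c : ℝ} (hc : 0 < c)
    (hf : ∀ a, c ≤ f a) : ∃ a, ∀ b, f a ≤ 2 * f b := by
  have hbdd : BddBelow (Set.range f) := ⟨c, Set.forall_mem_range.mpr hf⟩
  have hpos : 0 < ⨅ a, f a := hc.trans_le (le_ciInf hf)
  obtain ⟨a, ha⟩ := exists_lt_of_ciInf_lt (f := f) (show ⨅ a, f a < 2 * ⨅ a, f a by linarith)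
  exact ⟨a, fun b => by linarith [ciInf_le hbdd b]⟩

lemma exists_int_add_mul_sq_div_le (x : ℝ) {h : ℝ} (hh : 0 < h) :
    ∃ k : ℤ, (x + k * h) ^ 2 / h ≤ h / 4 := by
  refine ⟨-round (x / h), ?_⟩
  have hround := abs_le.mp (abs_sub_round (x / h))
  have hfactor : x + ((-round (x / h) : ℤ) : ℝ) * h = (x / h - round (x / h)) * h := by
    push_cast
    field_simp
    ring
  have hsq : (x / h - round (x / h)) ^ 2 ≤ (1 / 2) ^ 2 := sq_le_sq' hround.1 hround.2
  rw [hfactor, mul_pow, div_le_iff₀ hh]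
  nlinarith [sq_nonneg h]

/-! ### Symplectic reduction -/

/-- An integral matrix, regarded as a real one. -/
abbrev intR {ι κ : Type*} (A : Matrix ι κ ℤ) : Matrix ι κ ℝ := A.map (fun x : ℤ => (x : ℝ))

/-- The value at an integral vector of the quadratic form with Gram matrix `Q`. -/
def intQuad {κ : Type*} [Fintype κ] (Q : Matrix κ κ ℝ) (v : κ → ℤ) : ℝ :=
  (fun j => (v j : ℝ)) ⬝ᵥ (Q *ᵥ fun j => (v j : ℝ))

section IntQuad

variable {κ : Type*} [Fintype κ]

lemma intQuad_mul (Q : Matrix κ κ ℝ) (A B : Matrix κ κ ℤ) (i : κ) :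
    intQuad Q ((A * B) i) = intQuad (intR B * Q * (intR B)ᵀ) (A i) := by
  have hrow : (fun j => (((A * B) i j : ℤ) : ℝ)) = (fun j => (A i j : ℝ)) ᵥ* intR B := by
    ext j
    simp [mul_apply, vecMul, dotProduct]
  rw [intQuad, intQuad, hrow, ← mulVec_mulVec, ← mulVec_mulVec, mulVec_transpose,
    dotProduct_mulVec _ (intR B), ← dotProduct_mulVec]

lemma intQuad_one [DecidableEq κ] (Q : Matrix κ κ ℝ) (i : κ) :
    intQuad Q ((1 : Matrix κ κ ℤ) i) = Q i i := by
  have hrow : (fun j => (((1 : Matrix κ κ ℤ) i j : ℤ) : ℝ)) = Pi.single i 1 := by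
    ext j
    simp [one_apply, Pi.single_apply, eq_comm]
  simp [intQuad, hrow]

lemma intQuad_submatrix_equiv {ι : Type*} [Fintype ι] (Q : Matrix κ κ ℝ) (e : ι ≃ κ)
    (v : ι → ℤ) : intQuad (Q.submatrix e e) v = intQuad Q (v ∘ e.symm) := by
  rw [intQuad, submatrix_mulVec_equiv, intQuad, ← comp_equiv_symm_dotProduct]
  rfl

lemma one_le_dotProduct_self_of_ne_zero {v : κ → ℤ} (hv : v ≠ 0) :
    (1 : ℝ) ≤ (fun j => (v j : ℝ)) ⬝ᵥ fun j => (v j : ℝ) := by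
  obtain ⟨j, hj⟩ := Function.ne_iff.mp hv
  have hpos : 0 < v ⬝ᵥ v :=
    Finset.sum_pos' (fun i _ => mul_self_nonneg _) ⟨j, Finset.mem_univ j, mul_self_pos.mpr hj⟩
  calc (1 : ℝ) ≤ ((v ⬝ᵥ v : ℤ) : ℝ) := by exact_mod_cast hpos
    _ = _ := by simp [dotProduct]

lemma exists_pos_forall_le_intQuad [Nonempty κ] {Q : Matrix κ κ ℝ} (hQ : Q.PosDef) :
    ∃ c > 0, ∀ v : κ → ℤ, v ≠ 0 → c ≤ intQuad Q v := by
  classical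
  have htr : 0 < Q⁻¹.trace := hQ.inv.trace_pos
  refine ⟨(Q⁻¹.trace)⁻¹, inv_pos.mpr htr, fun v hv => ?_⟩
  rw [inv_le_iff_one_le_mul₀' htr]
  exact (one_le_dotProduct_self_of_ne_zero hv).trans
    (dotProduct_self_le_trace_inv_mul_quadForm hQ _)

end IntQuad

section SymplecticGroup

variable {ι : Type*} [Fintype ι] [DecidableEq ι] {R : Type*} [CommRing R]

lemma row_ne_zero_of_mem_symplecticGroup {γ : Matrix (ι ⊕ ι) (ι ⊕ ι) ℤ}
    (hγ : γ ∈ symplecticGroup ι ℤ) (i : ι ⊕ ι) : γ i ≠ 0 := fun hzero =>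
  not_isUnit_zero <| det_eq_zero_of_row_eq_zero i (congrFun hzero) ▸
    SymplecticGroup.symplectic_det hγ

/-- The standard symplectic form. -/
def symp (u v : ι ⊕ ι → R) : R := u ⬝ᵥ (J ι R *ᵥ v)

lemma symp_eq_sum (u v : ι ⊕ ι → R) :
    symp u v = ∑ i, (u (.inr i) * v (.inl i) - u (.inl i) * v (.inr i)) := by
  simp only [symp, J, fromBlocks_mulVec, dotProduct, Fintype.sum_sum_type, zero_mulVec, neg_mulVec,
    one_mulVec, zero_add, add_zero, Sum.elim_inl, Sum.elim_inr, Pi.neg_apply, Function.comp_apply,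
    Finset.sum_sub_distrib, mul_neg, Finset.sum_neg_distrib]
  ring

lemma symp_skew (u v : ι ⊕ ι → R) : symp u v = -symp v u := by
  rw [symp_eq_sum, symp_eq_sum, ← Finset.sum_neg_distrib]
  exact Finset.sum_congr rfl fun i _ => by ring

lemma symp_self (u : ι ⊕ ι → R) : symp u u = 0 := by
  rw [symp_eq_sum]
  exact Finset.sum_eq_zero fun i _ => by ring

lemma symp_sub_smul (u v w : ι ⊕ ι → R) (a b : R) :
    symp (u - a • w) (v - b • w) = symp u v - b * symp u w + a * symp v w := by
  have hself := symp_self w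
  have hskew := symp_skew w v
  simp only [symp, sub_dotProduct, mulVec_sub, mulVec_smul, dotProduct_sub, dotProduct_smul,
    smul_dotProduct, smul_eq_mul] at hself hskew ⊢
  rw [hself, hskew]
  ring

lemma mem_symplecticGroup_iff_symp {A : Matrix (ι ⊕ ι) (ι ⊕ ι) R} :
    A ∈ symplecticGroup ι R ↔ ∀ x y, symp (A x) (A y) = J ι R x y := by
  have hentry (x y : ι ⊕ ι) : (A * J ι R * Aᵀ) x y = symp (A x) (A y) := by
    rw [Matrix.mul_assoc, mul_apply]
    rfl
  simp only [SymplecticGroup.mem_iff, ← Matrix.ext_iff, hentry]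

lemma levi_mem {a d : Matrix ι ι R} (h : aᵀ * d = 1) :
    fromBlocks a 0 0 d ∈ symplecticGroup ι R := by
  simp [SymplecticGroup.fromBlocks_mem_iff, h]

lemma translation_mem {b : Matrix ι ι R} (hb : b.IsSymm) :
    fromBlocks 1 b 0 1 ∈ symplecticGroup ι R := by
  simp [SymplecticGroup.fromBlocks_mem_iff, hb.eq]

lemma intR_mem_symplecticGroup {γ : Matrix (ι ⊕ ι) (ι ⊕ ι) ℤ} (hγ : γ ∈ symplecticGroup ι ℤ) :
    intR γ ∈ symplecticGroup ι ℝ :=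
  SymplecticGroup.map_mem hγ (Int.castRingHom ℝ)

lemma posDef_symplectic_conj {Q γ : Matrix (ι ⊕ ι) (ι ⊕ ι) ℝ} (hQ : Q.PosDef)
    (hγ : γ ∈ symplecticGroup ι ℝ) : (γ * Q * γᵀ).PosDef := by
  have hunit : IsUnit γ := (isUnit_iff_isUnit_det γ).mpr (SymplecticGroup.symplectic_det hγ)
  simpa [star_eq_conjTranspose] using
    (IsUnit.posDef_star_right_conjugate_iff (x := Q) hunit).mpr hQ

lemma submatrix_sumCongr_mem_symplecticGroup {κ : Type*} [Fintype κ] [DecidableEq κ] (e : ι ≃ κ)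
    {A : Matrix (κ ⊕ κ) (κ ⊕ κ) R} (hA : A ∈ symplecticGroup κ R) :
    A.submatrix (e.sumCongr e) (e.sumCongr e) ∈ symplecticGroup ι R := by
  have hJ : J ι R = (J κ R).submatrix (e.sumCongr e) (e.sumCongr e) := by
    ext (i | i) (j | j) <;> simp [J, one_apply]
  rw [SymplecticGroup.mem_iff] at hA ⊢
  rw [hJ, transpose_submatrix, submatrix_mul_equiv, submatrix_mul_equiv, hA]

lemma exists_mem_symplecticGroup_row_eq {γ : Matrix (ι ⊕ ι) (ι ⊕ ι) R}
    (hγ : γ ∈ symplecticGroup ι R) (i j : ι) :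
    ∃ γ' ∈ symplecticGroup ι R, γ' (.inr i) = γ (.inr j) := by
  let p : Matrix ι ι R := (1 : Matrix ι ι R).submatrix (Equiv.swap i j) id
  have hp : pᵀ * p = 1 := by
    simp only [p, transpose_submatrix, transpose_one, submatrix_mul_equiv, mul_one,
      submatrix_id_id]
  refine ⟨_, mul_mem (levi_mem hp) hγ, ?_⟩
  ext k
  simp [mul_apply, Fintype.sum_sum_type, p, one_apply]

lemma exists_near_minimal {Q : Matrix (ι ⊕ ι) (ι ⊕ ι) ℝ} (hQ : Q.PosDef) (i : ι ⊕ ι) :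
    ∃ γ ∈ symplecticGroup ι ℤ, ∀ γ' ∈ symplecticGroup ι ℤ,
      intQuad Q (γ i) ≤ 2 * intQuad Q (γ' i) := by
  have : Nonempty (ι ⊕ ι) := ⟨i⟩
  obtain ⟨c, hc, hlower⟩ := exists_pos_forall_le_intQuad hQ
  obtain ⟨γ, hγ⟩ := exists_forall_le_two_mul
    (fun γ : symplecticGroup ι ℤ => intQuad Q (γ.1 i)) hc
    fun γ => hlower _ (row_ne_zero_of_mem_symplecticGroup γ.2 i)
  exact ⟨γ.1, γ.2, fun γ' hγ' => hγ ⟨γ', hγ'⟩⟩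

lemma exists_near_minimal_conj {Q : Matrix (ι ⊕ ι) (ι ⊕ ι) ℝ} (hQ : Q.PosDef)
    (hQs : Q ∈ symplecticGroup ι ℝ) (i : ι ⊕ ι) :
    ∃ γ₀ ∈ symplecticGroup ι ℤ, ∃ R ∈ symplecticGroup ι ℝ, R.PosDef ∧
      (∀ (γ : Matrix (ι ⊕ ι) (ι ⊕ ι) ℤ) j, intQuad Q ((γ * γ₀) j) = intQuad R (γ j)) ∧
      ∀ γ ∈ symplecticGroup ι ℤ, R i i ≤ 2 * intQuad R (γ i) := by
  obtain ⟨γ₀, hγ₀, hmin⟩ := exists_near_minimal hQ i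
  have hγ₀R := intR_mem_symplecticGroup hγ₀
  refine ⟨γ₀, hγ₀, _, mul_mem (mul_mem hγ₀R hQs) (SymplecticGroup.transpose_mem hγ₀R),
    posDef_symplectic_conj hQ hγ₀R, fun γ j => intQuad_mul Q γ γ₀ j, fun γ hγ => ?_⟩
  rw [← intQuad_one (_ * _ * _), ← intQuad_mul, ← intQuad_mul, one_mul]
  exact hmin _ (mul_mem hγ hγ₀)

end SymplecticGroup

section Extension

variable {ι : Type*}

/-- The embedding of the index set of a symplectic basis into one of genus one higher. -/
def sympIncl : ι ⊕ ι → (ι ⊕ Unit) ⊕ (ι ⊕ Unit) := Sum.map .inl .inl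

/-- The index of the last vector in the half of the symplectic basis that is to be made short. -/
abbrev lastE : (ι ⊕ Unit) ⊕ (ι ⊕ Unit) := .inr (.inr ())

/-- The index of the basis vector dual to the one of index `lastE`. -/
abbrev lastF : (ι ⊕ Unit) ⊕ (ι ⊕ Unit) := .inl (.inr ())

/-- The Gram matrix induced by `Q` on the symplectic subquotient `e⊥ / e`, where `e` is the basis
vector of index `lastE`: the projection orthogonal to `e` with respect to `Q`. -/
noncomputable def schurForm (Q : Matrix ((ι ⊕ Unit) ⊕ (ι ⊕ Unit)) ((ι ⊕ Unit) ⊕ (ι ⊕ Unit)) ℝ) :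
    Matrix (ι ⊕ ι) (ι ⊕ ι) ℝ :=
  of fun x => Q (sympIncl x) ∘ sympIncl -
    (Q (sympIncl x) lastE / Q lastE lastE) • (Q lastE ∘ sympIncl)

lemma schurForm_row (Q : Matrix ((ι ⊕ Unit) ⊕ (ι ⊕ Unit)) ((ι ⊕ Unit) ⊕ (ι ⊕ Unit)) ℝ)
    (x : ι ⊕ ι) : schurForm Q x = Q (sympIncl x) ∘ sympIncl -
      (Q (sympIncl x) lastE / Q lastE lastE) • (Q lastE ∘ sympIncl) := rfl

variable {Q : Matrix ((ι ⊕ Unit) ⊕ (ι ⊕ Unit)) ((ι ⊕ Unit) ⊕ (ι ⊕ Unit)) ℝ}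

lemma schurForm_isSymm (hQ : Q.IsSymm) : (schurForm Q).IsSymm := by
  ext x y
  simp only [schurForm, transpose_apply, of_apply, Pi.sub_apply, Function.comp_apply, Pi.smul_apply,
    smul_eq_mul, hQ.apply (sympIncl y) (sympIncl x), hQ.apply (sympIncl y) lastE,
    hQ.apply (sympIncl x) lastE]
  ring

lemma quadForm_eq_schurForm_add [Fintype ι] (hQ : Q.IsSymm) (hlast : Q lastE lastE ≠ 0)
    {X : (ι ⊕ Unit) ⊕ (ι ⊕ Unit) → ℝ} (hX : X lastF = 0) :
    X ⬝ᵥ (Q *ᵥ X) = (X ∘ sympIncl) ⬝ᵥ (schurForm Q *ᵥ (X ∘ sympIncl)) +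
      ((Q lastE ∘ sympIncl) ⬝ᵥ (X ∘ sympIncl) + X lastE * Q lastE lastE) ^ 2 /
        Q lastE lastE := by
  set x := X ∘ sympIncl with hx
  have hsplit (w : (ι ⊕ Unit) ⊕ (ι ⊕ Unit) → ℝ) :
      w ⬝ᵥ X = (w ∘ sympIncl) ⬝ᵥ x + X lastE * w lastE := by
    simp only [hx, dotProduct, Fintype.sum_sum_type, sympIncl, hX, Function.comp_apply,
      Sum.map_inl, Sum.map_inr, Finset.univ_unique, Finset.sum_singleton, PUnit.default_eq_unit]
    ring
  have hlastE : (Q *ᵥ X) lastE = (Q lastE ∘ sympIncl) ⬝ᵥ x + X lastE * Q lastE lastE :=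
    hsplit _
  have hincl : (Q *ᵥ X) ∘ sympIncl = schurForm Q *ᵥ x +
      (((Q lastE ∘ sympIncl) ⬝ᵥ x) / Q lastE lastE + X lastE) • (Q lastE ∘ sympIncl) := by
    ext y
    have hrow : (Q *ᵥ X) (sympIncl y) =
        (Q (sympIncl y) ∘ sympIncl) ⬝ᵥ x + X lastE * Q (sympIncl y) lastE := hsplit _
    have hschur : (schurForm Q *ᵥ x) y = (Q (sympIncl y) ∘ sympIncl) ⬝ᵥ x -
        (Q (sympIncl y) lastE / Q lastE lastE) * ((Q lastE ∘ sympIncl) ⬝ᵥ x) := by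
      rw [mulVec, schurForm_row, sub_dotProduct, smul_dotProduct, smul_eq_mul]
    simp only [Function.comp_apply, Pi.add_apply, Pi.smul_apply, smul_eq_mul, hrow, hschur,
      ← hQ.apply (sympIncl y) lastE]
    ring
  rw [dotProduct_comm, hsplit, dotProduct_comm, hlastE, hincl, dotProduct_add, dotProduct_smul,
    dotProduct_comm x (Q lastE ∘ sympIncl), smul_eq_mul]
  field_simp
  ring

lemma schurForm_posDef [Finite ι] (hQ : Q.PosDef) : (schurForm Q).PosDef := by
  cases nonempty_fintype ι
  have hsymm := isSymm_of_posDef hQ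
  have hlast : Q lastE lastE ≠ 0 := hQ.diag_pos.ne'
  refine posDef_of_quadForm_pos (schurForm_isSymm hsymm) fun x hx => ?_
  let X : (ι ⊕ Unit) ⊕ (ι ⊕ Unit) → ℝ :=
    Sum.elim (Sum.elim (x ∘ .inl) 0) (Sum.elim (x ∘ .inr)
      fun _ => -((Q lastE ∘ sympIncl) ⬝ᵥ x) / Q lastE lastE)
  have hXx : X ∘ sympIncl = x := by ext (i | i) <;> rfl
  have hX : X ≠ 0 := fun hzero => hx <| by rw [← hXx, hzero]; rfl
  have hXlast : (Q lastE ∘ sympIncl) ⬝ᵥ x + X lastE * Q lastE lastE = 0 := by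
    simp [X, div_mul_cancel₀ _ hlast]
  have hpos := quadForm_pos hQ hX
  rwa [quadForm_eq_schurForm_add hsymm hlast rfl, hXx, hXlast, zero_pow two_ne_zero, zero_div,
    add_zero] at hpos

variable [Fintype ι] [DecidableEq ι] {R : Type*} [CommRing R]

lemma symp_sum_unit (u v : (ι ⊕ Unit) ⊕ (ι ⊕ Unit) → R) :
    symp u v = symp (u ∘ sympIncl) (v ∘ sympIncl) +
      (u lastE * v lastF - u lastF * v lastE) := by
  simp only [symp_eq_sum, Fintype.sum_sum_type, sympIncl, Function.comp_apply, Sum.map_inl,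
    Sum.map_inr, Finset.univ_unique, Finset.sum_singleton]

lemma schurForm_mem (hQ : Q ∈ symplecticGroup (ι ⊕ Unit) ℝ)
    (hlast : Q lastE lastE ≠ 0) : schurForm Q ∈ symplecticGroup ι ℝ := by
  rw [mem_symplecticGroup_iff_symp] at hQ ⊢
  intro x y
  have hJincl : J (ι ⊕ Unit) ℝ (sympIncl x) (sympIncl y) = J ι ℝ x y := by
    rcases x with i | i <;> rcases y with j | j <;> simp [J, sympIncl, one_apply]
  have hJlast (z : ι ⊕ ι) : J (ι ⊕ Unit) ℝ (sympIncl z) lastE = 0 := by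
    cases z <;> simp [J, sympIncl, one_apply]
  have hincl := hQ (sympIncl x) (sympIncl y)
  have hxlast := hQ (sympIncl x) lastE
  have hylast := hQ (sympIncl y) lastE
  rw [symp_sum_unit, hJincl] at hincl
  rw [symp_sum_unit, hJlast] at hxlast hylast
  rw [schurForm_row, schurForm_row, symp_sub_smul]
  field_simp
  linear_combination Q lastE lastE * hincl - Q (sympIncl y) lastE * hxlast +
    Q (sympIncl x) lastE * hylast

/-- The embedding `Sp(2n) → Sp(2n + 2)` that fixes the two new basis vectors. -/
def sympExtend (γ : Matrix (ι ⊕ ι) (ι ⊕ ι) R) :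
    Matrix ((ι ⊕ Unit) ⊕ (ι ⊕ Unit)) ((ι ⊕ Unit) ⊕ (ι ⊕ Unit)) R :=
  fromBlocks (fromBlocks γ.toBlocks₁₁ 0 0 1) (fromBlocks γ.toBlocks₁₂ 0 0 0)
    (fromBlocks γ.toBlocks₂₁ 0 0 0) (fromBlocks γ.toBlocks₂₂ 0 0 1)

lemma sympExtend_mem {γ : Matrix (ι ⊕ ι) (ι ⊕ ι) R} (hγ : γ ∈ symplecticGroup ι R) :
    sympExtend γ ∈ symplecticGroup (ι ⊕ Unit) R := by
  rw [← fromBlocks_toBlocks γ, SymplecticGroup.fromBlocks_mem_iff] at hγ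
  obtain ⟨hac, hbd, had⟩ := hγ
  rw [sympExtend, SymplecticGroup.fromBlocks_mem_iff]
  refine ⟨by simp [fromBlocks_transpose, fromBlocks_multiply, hac],
    by simp [fromBlocks_transpose, fromBlocks_multiply, hbd], ?_⟩
  rw [← fromBlocks_one, ← had]
  simp [fromBlocks_transpose, fromBlocks_multiply, sub_eq_add_neg, fromBlocks_neg, fromBlocks_add]

/-- The symplectic shear that adds `k i` times the basis vector of index `lastE` to the `i`-th
vector in the same half of the basis. -/
def sympShear (k : ι → R) : Matrix ((ι ⊕ Unit) ⊕ (ι ⊕ Unit)) ((ι ⊕ Unit) ⊕ (ι ⊕ Unit)) R :=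
  fromBlocks (fromBlocks 1 0 (of fun _ i => -k i) 1) 0 0 (fromBlocks 1 (of fun i _ => k i) 0 1)

lemma sympShear_mem (k : ι → R) : sympShear k ∈ symplecticGroup (ι ⊕ Unit) R := by
  refine levi_mem ?_
  rw [fromBlocks_transpose, fromBlocks_multiply, ← fromBlocks_one]
  congr 1 <;> ext i j <;> simp [one_apply]

lemma exists_extension_le (hQ : Q.PosDef) {C : ℝ} {γ : Matrix (ι ⊕ ι) (ι ⊕ ι) ℤ}
    (hγ : γ ∈ symplecticGroup ι ℤ) (hC : ∀ i, intQuad (schurForm Q) (γ (.inr i)) ≤ C) :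
    ∃ G ∈ symplecticGroup (ι ⊕ Unit) ℤ, intQuad Q (G lastE) = Q lastE lastE ∧
      ∀ i : ι, intQuad Q (G (.inr (.inl i))) ≤ C + Q lastE lastE / 4 := by
  have hlast : 0 < Q lastE lastE := hQ.diag_pos
  choose k hk using fun i : ι => exists_int_add_mul_sq_div_le
    ((Q lastE ∘ sympIncl) ⬝ᵥ fun j => (γ (.inr i) j : ℝ)) hlast
  refine ⟨sympShear k * sympExtend γ, mul_mem (sympShear_mem k) (sympExtend_mem hγ), ?_,
    fun i => ?_⟩
  · rw [← intQuad_one Q lastE]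
    congr 1
    ext ((j | j) | (j | j)) <;> simp [sympShear, sympExtend, fromBlocks_multiply, one_apply]
  · have hincl : (fun j => (((sympShear k * sympExtend γ) (.inr (.inl i)) j : ℤ) : ℝ)) ∘ sympIncl =
        fun j => (γ (.inr i) j : ℝ) := by
      ext (j | j) <;> simp [sympShear, sympExtend, fromBlocks_multiply, sympIncl, toBlocks₂₁,
        toBlocks₂₂]
    have hE : (sympShear k * sympExtend γ) (.inr (.inl i)) lastE = k i := by
      simp [sympShear, sympExtend, fromBlocks_multiply]
    have hF : (sympShear k * sympExtend γ) (.inr (.inl i)) lastF = 0 := by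
      simp [sympShear, sympExtend, fromBlocks_multiply]
    rw [intQuad, quadForm_eq_schurForm_add (isSymm_of_posDef hQ) hlast.ne' (by simp [hF]), hincl,
      hE]
    exact add_le_add (hC i) (hk i)

end Extension

section HasSymplecticReduction

variable {ι : Type*} [Fintype ι] [DecidableEq ι]

/-- Reduction theory for the integral symplectic group: every positive definite real symplectic
Gram matrix has an integral symplectic basis half of which is bounded by a uniform constant. -/
def HasSymplecticReduction (ι : Type*) [Fintype ι] [DecidableEq ι] : Prop :=
  ∃ C : ℝ, 0 < C ∧ ∀ Q ∈ symplecticGroup ι ℝ, Q.PosDef →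
    ∃ γ ∈ symplecticGroup ι ℤ, ∀ i, intQuad Q (γ (.inr i)) ≤ C

lemma exists_mem_symplecticGroup_row_inr_default [Unique ι] (k : ℤ) :
    ∃ γ ∈ symplecticGroup ι ℤ, γ (.inr default) = Sum.elim (fun _ => 1) fun _ => k := by
  refine ⟨J ι ℤ * fromBlocks 1 (diagonal fun _ => k) 0 1,
    mul_mem (SymplecticGroup.J_mem ι ℤ) (translation_mem (isSymm_diagonal _)), ?_⟩
  ext (j | j) <;> rw [Unique.eq_default j] <;> simp [J, fromBlocks_multiply]

lemma intQuad_eq_of_unique [Unique ι] {Q : Matrix (ι ⊕ ι) (ι ⊕ ι) ℝ}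
    (hQs : Q ∈ symplecticGroup ι ℝ) (hQ : Q.PosDef) (k : ℤ) :
    intQuad Q (Sum.elim (fun _ => 1) fun _ => k) =
      1 / Q (.inr default) (.inr default) +
        (Q (.inl default) (.inr default) + k * Q (.inr default) (.inr default)) ^ 2 /
          Q (.inr default) (.inr default) := by
  have hdet := (mem_symplecticGroup_iff_symp.mp hQs) (.inr default) (.inl default)
  have hsymm := (isSymm_of_posDef hQ).apply (.inl default) (.inr default)
  have hpos : 0 < Q (.inr default) (.inr default) := hQ.diag_pos
  simp only [symp_eq_sum, J, Finset.univ_unique, Finset.sum_singleton, fromBlocks_apply₂₁,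
    one_apply_eq] at hdet
  simp only [intQuad, dotProduct, mulVec, Fintype.sum_sum_type, Finset.univ_unique,
    Finset.sum_singleton, Sum.elim_inl, Sum.elim_inr, Int.cast_one]
  rw [hsymm] at hdet ⊢
  field_simp
  linear_combination hdet

lemma hasSymplecticReduction_of_unique [Unique ι] : HasSymplecticReduction ι := by
  refine ⟨2, two_pos, fun Q hQs hQ => ?_⟩
  obtain ⟨γ₀, hγ₀, R, hRs, hR, hmul, hmin⟩ :=
    exists_near_minimal_conj hQ hQs (.inr default)
  refine ⟨γ₀, hγ₀, fun i => ?_⟩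
  rw [Unique.eq_default i, ← one_mul γ₀, hmul, intQuad_one]
  have hpos : 0 < R (.inr default) (.inr default) := hR.diag_pos
  obtain ⟨k, hk⟩ := exists_int_add_mul_sq_div_le (R (.inl default) (.inr default)) hpos
  obtain ⟨γ, hγ, hrow⟩ := exists_mem_symplecticGroup_row_inr_default (ι := ι) k
  have hle := hmin γ hγ
  rw [hrow, intQuad_eq_of_unique hRs hR] at hle
  set h := R (.inr default) (.inr default)
  have hbound : h ≤ 2 * (1 / h + h / 4) := hle.trans (by linarith)
  field_simp at hbound
  nlinarith

lemma HasSymplecticReduction.sum_unit [Nonempty ι] (hι : HasSymplecticReduction ι) :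
    HasSymplecticReduction (ι ⊕ Unit) := by
  obtain ⟨C, hC, hred⟩ := hι
  refine ⟨4 * C, by positivity, fun Q hQs hQ => ?_⟩
  obtain ⟨γ₀, hγ₀, R, hRs, hR, hmul, hmin⟩ := exists_near_minimal_conj hQ hQs lastE
  have hlast : R lastE lastE ≠ 0 := hR.diag_pos.ne'
  obtain ⟨γ, hγ, hγC⟩ :=
    hred _ (schurForm_mem hRs hlast) (schurForm_posDef hR)
  obtain ⟨G, hG, hGlast, hGle⟩ := exists_extension_le hR hγ hγC
  -- Near minimality forces `h ≤ 2 (C + h / 4)` for the last diagonal entry `h`.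
  have hlast_le : R lastE lastE ≤ 4 * C := by
    obtain ⟨i⟩ := ‹Nonempty ι›
    obtain ⟨G', hG', hrow⟩ := exists_mem_symplecticGroup_row_eq hG (.inr ()) (.inl i)
    have hle := hmin G' hG'
    rw [hrow] at hle
    linarith [hGle i]
  refine ⟨G * γ₀, mul_mem hG hγ₀, ?_⟩
  rintro (i | i) <;> rw [hmul]
  · linarith [hGle i]
  · exact hGlast.trans_le hlast_le

lemma HasSymplecticReduction.of_equiv {κ : Type*} [Fintype κ] [DecidableEq κ] (e : ι ≃ κ)
    (hι : HasSymplecticReduction ι) : HasSymplecticReduction κ := by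
  obtain ⟨C, hC, hred⟩ := hι
  refine ⟨C, hC, fun Q hQs hQ => ?_⟩
  obtain ⟨γ, hγ, hγC⟩ := hred _ (submatrix_sumCongr_mem_symplecticGroup e hQs)
    (hQ.submatrix (e.sumCongr e).injective)
  refine ⟨_, submatrix_sumCongr_mem_symplecticGroup e.symm hγ, fun i => ?_⟩
  have hle := hγC (e.symm i)
  rwa [intQuad_submatrix_equiv] at hle

theorem hasSymplecticReduction_fin {n : ℕ} (hn : 1 ≤ n) : HasSymplecticReduction (Fin n) := by
  induction n, hn using Nat.le_induction with
  | base => exact hasSymplecticReduction_of_unique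
  | succ n hn ih =>
    have : Nonempty (Fin n) := ⟨⟨0, hn⟩⟩
    exact ih.sum_unit.of_equiv ((Equiv.sumCongr (.refl _) finOneEquiv.symm).trans finSumFinEquiv)

end HasSymplecticReduction

/-! ### The action on the Siegel upper half space -/

section ToComplex

/-- A real matrix, regarded as a complex one. -/
def toComplex {ι κ : Type*} (A : Matrix ι κ ℝ) : Matrix ι κ ℂ := A.map Complex.ofRealHom

/-- An integral matrix, regarded as a complex one. -/
abbrev intC {ι κ : Type*} (A : Matrix ι κ ℤ) : Matrix ι κ ℂ := A.map (fun x : ℤ => (x : ℂ))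

variable {ι κ ν : Type*}

lemma toComplex_apply (A : Matrix ι κ ℝ) (i : ι) (j : κ) : toComplex A i j = (A i j : ℂ) := rfl

lemma toComplex_add (A B : Matrix ι κ ℝ) : toComplex (A + B) = toComplex A + toComplex B := by
  ext; simp [toComplex]

lemma toComplex_one [DecidableEq ι] : toComplex (1 : Matrix ι ι ℝ) = 1 := by
  simp [toComplex]

lemma toComplex_injective : Function.Injective (toComplex : Matrix ι κ ℝ → Matrix ι κ ℂ) :=
  Matrix.map_injective Complex.ofReal_injective

lemma toComplex_conjTranspose (A : Matrix ι κ ℝ) : (toComplex A)ᴴ = toComplex Aᵀ := by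
  ext; simp [toComplex_apply]

lemma intC_conjTranspose (A : Matrix ι κ ℤ) : (intC A)ᴴ = (intC A)ᵀ := by
  ext; simp

lemma isSymm_imMat {τ : Matrix ι ι ℂ} (hτ : τ.IsSymm) : (imMat τ).IsSymm := by
  ext; simp [imMat, hτ.apply]

lemma sub_conjTranspose_eq {τ : Matrix ι ι ℂ} (hτ : τ.IsSymm) :
    τ - τᴴ = (2 * Complex.I) • toComplex (imMat τ) := by
  ext i j
  simp only [Matrix.sub_apply, conjTranspose_apply, Matrix.smul_apply, smul_eq_mul,
    toComplex_apply, imMat, map_apply, hτ.apply, Complex.star_def]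
  rw [Complex.sub_conj]
  push_cast
  ring

lemma toComplex_mul [Fintype ι] (A : Matrix ν ι ℝ) (B : Matrix ι κ ℝ) :
    toComplex (A * B) = toComplex A * toComplex B := Matrix.map_mul

open scoped ComplexOrder in
lemma posDef_toComplex [Finite ι] {A : Matrix ι ι ℝ} (hA : A.PosDef) : (toComplex A).PosDef := by
  classical
  cases nonempty_fintype ι
  obtain ⟨B, rfl⟩ := exists_eq_transpose_mul_self hA.posSemidef
  have hB : IsUnit B := isUnit_of_mul_isUnit_right hA.isUnit
  rw [toComplex_mul, ← toComplex_conjTranspose]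
  exact PosDef.conjTranspose_mul_self _
    (mulVec_injective_iff_isUnit.mpr (hB.map Complex.ofRealHom.mapMatrix))

open scoped ComplexOrder in
lemma posDef_of_toComplex [Finite ι] {A : Matrix ι ι ℝ} (hA : (toComplex A).PosDef) :
    A.PosDef := by
  cases nonempty_fintype ι
  have hsymm : A.IsSymm := toComplex_injective <| by
    rw [← toComplex_conjTranspose]
    exact hA.isHermitian
  refine posDef_of_quadForm_pos hsymm fun x hx => ?_
  have hx' : (fun i => (x i : ℂ)) ≠ 0 := fun hzero => hx <| by
    ext i
    simpa using congrFun hzero i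
  have hcast : star (fun i => (x i : ℂ)) ⬝ᵥ (toComplex A *ᵥ fun i => (x i : ℂ)) =
      ((x ⬝ᵥ (A *ᵥ x) : ℝ) : ℂ) := by
    simp [dotProduct, mulVec, toComplex_apply]
  have hpos := hA.dotProduct_mulVec_pos hx'
  rw [hcast] at hpos
  exact_mod_cast hpos

variable [Fintype ι]

lemma trace_toComplex_mul_im (S : Matrix ι ι ℝ) (τ : Matrix ι ι ℂ) :
    (toComplex S * τ).trace.im = (S * imMat τ).trace := by
  simp [trace, mul_apply, toComplex_apply, imMat, Complex.im_sum]

variable [DecidableEq ι]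

lemma toComplex_inv {A : Matrix ι ι ℝ} (hA : IsUnit A.det) :
    toComplex A⁻¹ = (toComplex A)⁻¹ := by
  refine (inv_eq_right_inv ?_).symm
  rw [← toComplex_mul, mul_nonsing_inv A hA, toComplex_one]

lemma toComplex_det (A : Matrix ι ι ℝ) : (toComplex A).det = (A.det : ℂ) :=
  (RingHom.map_det Complex.ofRealHom A).symm

end ToComplex

section SiegelAction

open scoped ComplexOrder

variable {n : ℕ} {γ : Matrix (Fin n ⊕ Fin n) (Fin n ⊕ Fin n) ℤ} {τ : Matrix (Fin n) (Fin n) ℂ}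

/-- The action `τ ↦ (a τ + b) (c τ + d)⁻¹` on the Siegel upper half space. -/
noncomputable def smulSiegel (γ : Matrix (Fin n ⊕ Fin n) (Fin n ⊕ Fin n) ℤ)
    (τ : Matrix (Fin n) (Fin n) ℂ) : Matrix (Fin n) (Fin n) ℂ :=
  num γ τ * (denom γ τ)⁻¹

lemma symplectic_transpose_mul (hγ : γ ∈ symplecticGroup (Fin n) ℤ) :
    (intC γ.toBlocks₁₁)ᵀ * intC γ.toBlocks₂₁ = (intC γ.toBlocks₂₁)ᵀ * intC γ.toBlocks₁₁ ∧
    (intC γ.toBlocks₁₂)ᵀ * intC γ.toBlocks₂₂ = (intC γ.toBlocks₂₂)ᵀ * intC γ.toBlocks₁₂ ∧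
    (intC γ.toBlocks₁₁)ᵀ * intC γ.toBlocks₂₂ - (intC γ.toBlocks₂₁)ᵀ * intC γ.toBlocks₁₂ = 1 ∧
    (intC γ.toBlocks₂₂)ᵀ * intC γ.toBlocks₁₁ - (intC γ.toBlocks₁₂)ᵀ * intC γ.toBlocks₂₁ = 1 := by
  have hγC : γ.map (Int.castRingHom ℂ) ∈ symplecticGroup (Fin n) ℂ :=
    SymplecticGroup.map_mem hγ (Int.castRingHom ℂ)
  rw [← fromBlocks_toBlocks (γ.map (Int.castRingHom ℂ)),
    SymplecticGroup.fromBlocks_mem_iff] at hγC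
  have had := congrArg transpose hγC.2.2
  rw [transpose_sub, transpose_mul, transpose_mul, transpose_transpose, transpose_transpose,
    transpose_one] at had
  exact ⟨hγC.1, hγC.2.1, hγC.2.2, had⟩

lemma symplectic_mul_transpose (hγ : γ ∈ symplecticGroup (Fin n) ℤ) :
    intC γ.toBlocks₂₁ * (intC γ.toBlocks₂₂)ᵀ = intC γ.toBlocks₂₂ * (intC γ.toBlocks₂₁)ᵀ ∧
    intC γ.toBlocks₁₁ * (intC γ.toBlocks₂₂)ᵀ - intC γ.toBlocks₁₂ * (intC γ.toBlocks₂₁)ᵀ = 1 := by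
  have hrel := symplectic_transpose_mul (SymplecticGroup.transpose_mem hγ)
  exact ⟨hrel.2.1, hrel.2.2.1⟩

lemma num_transpose_mul_denom (hγ : γ ∈ symplecticGroup (Fin n) ℤ) (hτ : τ.IsSymm) :
    (num γ τ)ᵀ * denom γ τ = (denom γ τ)ᵀ * num γ τ := by
  obtain ⟨hac, hbd, had, hda⟩ := symplectic_transpose_mul hγ
  simp only [num, denom, transpose_add, transpose_mul, hτ.eq]
  linear_combination (norm := noncomm_ring) τ * hac * τ + hbd + τ * had - hda * τ

lemma denom_conjTranspose_mul_num_sub (hγ : γ ∈ symplecticGroup (Fin n) ℤ)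
    (τ : Matrix (Fin n) (Fin n) ℂ) :
    (denom γ τ)ᴴ * num γ τ - (num γ τ)ᴴ * denom γ τ = τ - τᴴ := by
  obtain ⟨hac, hbd, had, hda⟩ := symplectic_transpose_mul hγ
  simp only [num, denom, conjTranspose_add, conjTranspose_mul, intC_conjTranspose]
  linear_combination (norm := noncomm_ring) - τᴴ * hac * τ - hbd - τᴴ * had + hda * τ

lemma isUnit_det_denom (hγ : γ ∈ symplecticGroup (Fin n) ℤ) (hτ : τ ∈ siegelUpperHalf (Fin n)) :
    IsUnit (denom γ τ).det := by
  rw [isUnit_iff_ne_zero]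
  intro hdet
  obtain ⟨x, hx, hDx⟩ := exists_mulVec_eq_zero_iff.mpr hdet
  have hDx' : star x ᵥ* (denom γ τ)ᴴ = 0 := by rw [vecMul_conjTranspose, star_star, hDx, star_zero]
  have hzero : star x ⬝ᵥ ((τ - τᴴ) *ᵥ x) = 0 := by
    rw [← denom_conjTranspose_mul_num_sub hγ τ, sub_mulVec, ← mulVec_mulVec, ← mulVec_mulVec, hDx,
      mulVec_zero, sub_zero, dotProduct_mulVec, hDx', zero_dotProduct]
  rw [sub_conjTranspose_eq hτ.1, smul_mulVec, dotProduct_smul, smul_eq_mul] at hzero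
  exact mul_ne_zero (by simp) ((posDef_toComplex hτ.2).dotProduct_mulVec_pos hx).ne' hzero

lemma smulSiegel_isSymm (hγ : γ ∈ symplecticGroup (Fin n) ℤ)
    (hτ : τ ∈ siegelUpperHalf (Fin n)) : (smulSiegel γ τ).IsSymm := by
  have hD := isUnit_det_denom hγ hτ
  have hDt : IsUnit (denom γ τ)ᵀ.det := by rwa [det_transpose]
  rw [IsSymm, smulSiegel, transpose_mul, transpose_nonsing_inv]
  calc (denom γ τ)ᵀ⁻¹ * (num γ τ)ᵀ
      = (denom γ τ)ᵀ⁻¹ * ((num γ τ)ᵀ * denom γ τ) * (denom γ τ)⁻¹ := by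
        rw [Matrix.mul_assoc, Matrix.mul_assoc, mul_nonsing_inv _ hD, mul_one]
    _ = num γ τ * (denom γ τ)⁻¹ := by
        rw [num_transpose_mul_denom hγ hτ.1, ← Matrix.mul_assoc, nonsing_inv_mul _ hDt, one_mul]

lemma imMat_smulSiegel (hγ : γ ∈ symplecticGroup (Fin n) ℤ) (hτ : τ ∈ siegelUpperHalf (Fin n)) :
    toComplex (imMat (smulSiegel γ τ)) =
      ((denom γ τ)⁻¹)ᴴ * toComplex (imMat τ) * (denom γ τ)⁻¹ := by
  have hD := isUnit_det_denom hγ hτ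
  have hDc : IsUnit (denom γ τ)ᴴ.det := by
    rw [det_conjTranspose]
    exact hD.star
  have hsub : smulSiegel γ τ - (smulSiegel γ τ)ᴴ =
      ((denom γ τ)⁻¹)ᴴ * (τ - τᴴ) * (denom γ τ)⁻¹ := by
    rw [← denom_conjTranspose_mul_num_sub hγ τ, smulSiegel, conjTranspose_mul,
      conjTranspose_nonsing_inv, Matrix.mul_sub, Matrix.sub_mul, ← Matrix.mul_assoc,
      nonsing_inv_mul _ hDc, one_mul, Matrix.mul_assoc, Matrix.mul_assoc, mul_nonsing_inv _ hD]
    noncomm_ring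
  rw [sub_conjTranspose_eq (smulSiegel_isSymm hγ hτ), sub_conjTranspose_eq hτ.1, Matrix.mul_smul,
    Matrix.smul_mul] at hsub
  exact smul_right_injective _ (by simp : (2 * Complex.I : ℂ) ≠ 0) hsub

lemma smulSiegel_mem (hγ : γ ∈ symplecticGroup (Fin n) ℤ) (hτ : τ ∈ siegelUpperHalf (Fin n)) :
    smulSiegel γ τ ∈ siegelUpperHalf (Fin n) := by
  refine ⟨smulSiegel_isSymm hγ hτ, posDef_of_toComplex ?_⟩
  rw [imMat_smulSiegel hγ hτ]
  refine (posDef_toComplex hτ.2).conjTranspose_mul_mul_same (mulVec_injective_iff_isUnit.mpr ?_)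
  rw [isUnit_iff_isUnit_det]
  exact isUnit_nonsing_inv_det _ (isUnit_det_denom hγ hτ)

lemma det_imMat_smulSiegel (hγ : γ ∈ symplecticGroup (Fin n) ℤ)
    (hτ : τ ∈ siegelUpperHalf (Fin n)) :
    (imMat (smulSiegel γ τ)).det = (imMat τ).det / ‖(denom γ τ).det‖ ^ 2 := by
  have hnorm := congrArg (fun A => ‖A.det‖) (imMat_smulSiegel hγ hτ)
  simp only [toComplex_det, det_mul, det_conjTranspose, det_nonsing_inv, Ring.inverse_eq_inv',
    norm_mul, norm_star, norm_inv, Complex.norm_real, Real.norm_eq_abs,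
    abs_of_pos (smulSiegel_mem hγ hτ).2.det_pos, abs_of_pos hτ.2.det_pos] at hnorm
  rw [hnorm]
  ring

lemma imMat_smulSiegel_inv (hγ : γ ∈ symplecticGroup (Fin n) ℤ)
    (hτ : τ ∈ siegelUpperHalf (Fin n)) :
    toComplex (imMat (smulSiegel γ τ))⁻¹ =
      denom γ τ * toComplex (imMat τ)⁻¹ * (denom γ τ)ᴴ := by
  have hD := isUnit_det_denom hγ hτ
  have hDc : IsUnit (denom γ τ)ᴴ.det := by
    rw [det_conjTranspose]
    exact hD.star
  rw [toComplex_inv (smulSiegel_mem hγ hτ).2.det_pos.ne'.isUnit, imMat_smulSiegel hγ hτ,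
    Matrix.mul_inv_rev, Matrix.mul_inv_rev, nonsing_inv_nonsing_inv _ hD, conjTranspose_nonsing_inv,
    nonsing_inv_nonsing_inv _ hDc, toComplex_inv hτ.2.det_pos.ne'.isUnit, Matrix.mul_assoc]

end SiegelAction

/-! ### Reduction in the Siegel upper half space -/

section SiegelForm

variable {ι : Type*}

/-- Entrywise real part of a complex matrix. -/
def reMat (τ : Matrix ι ι ℂ) : Matrix ι ι ℝ := τ.map Complex.re

variable {τ : Matrix ι ι ℂ}

lemma isSymm_reMat (hτ : τ.IsSymm) : (reMat τ).IsSymm := by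
  ext; simp [reMat, hτ.apply]

lemma eq_reMat_add_imMat (τ : Matrix ι ι ℂ) :
    τ = toComplex (reMat τ) + Complex.I • toComplex (imMat τ) := by
  ext
  simp [toComplex_apply, reMat, imMat, mul_comm Complex.I, Complex.re_add_im]

variable [Fintype ι]

lemma mul_toComplex_mul_conjTranspose {A B P : Matrix ι ι ℝ} (h : A * P * Bᵀ = B * P * Aᵀ) :
    (toComplex A + Complex.I • toComplex B) * toComplex P *
        (toComplex A + Complex.I • toComplex B)ᴴ =
      toComplex (A * P * Aᵀ + B * P * Bᵀ) := by
  have hC := congrArg toComplex h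
  simp only [toComplex_mul, toComplex_add, conjTranspose_add, conjTranspose_smul,
    toComplex_conjTranspose, Complex.star_def, Complex.conj_I, neg_smul, Matrix.mul_add,
    Matrix.mul_neg, Matrix.add_mul, Matrix.smul_mul, Matrix.mul_smul, smul_add, smul_smul,
    Complex.I_mul_I] at hC ⊢
  linear_combination (norm := module) -Complex.I • hC

variable [DecidableEq ι]

/-- The Gram matrix on `ℝ^(2n)` attached to `τ ∈ ℍ_n`: the translate by `Re τ` of
`diag(Im τ, (Im τ)⁻¹)`. It is symplectic, and its values on the bottom rows `(c, d)` of a symplectic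
matrix are the diagonal entries of the inverse imaginary part of the transform of `τ`. -/
noncomputable def siegelForm (τ : Matrix ι ι ℂ) : Matrix (ι ⊕ ι) (ι ⊕ ι) ℝ :=
  fromBlocks 1 (reMat τ) 0 1 * fromBlocks (imMat τ) 0 0 (imMat τ)⁻¹ *
    (fromBlocks 1 (reMat τ) 0 1)ᵀ

lemma siegelForm_mem (hτ : τ ∈ siegelUpperHalf ι) : siegelForm τ ∈ symplecticGroup ι ℝ := by
  have htrans := translation_mem (isSymm_reMat hτ.1)
  refine mul_mem (mul_mem htrans (levi_mem ?_)) (SymplecticGroup.transpose_mem htrans)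
  rw [(isSymm_imMat hτ.1).eq, mul_nonsing_inv _ hτ.2.det_pos.ne'.isUnit]

lemma siegelForm_posDef (hτ : τ ∈ siegelUpperHalf ι) : (siegelForm τ).PosDef := by
  have : Invertible (imMat τ) := hτ.2.isUnit.invertible
  refine posDef_symplectic_conj ?_ (translation_mem (isSymm_reMat hτ.1))
  have hsemi : (fromBlocks (imMat τ) 0 0 (imMat τ)⁻¹).PosSemidef := by
    simpa [hτ.2.inv.posSemidef] using PosDef.fromBlocks₁₁ 0 (imMat τ)⁻¹ hτ.2
  rw [hsemi.posDef_iff_isUnit, isUnit_iff_isUnit_det, det_fromBlocks_zero₁₂, ← det_mul,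
    mul_inv_of_invertible, det_one]
  exact isUnit_one

end SiegelForm

section SiegelReduction

variable {n : ℕ} {γ : Matrix (Fin n ⊕ Fin n) (Fin n ⊕ Fin n) ℤ} {τ : Matrix (Fin n) (Fin n) ℂ}

lemma denom_eq_add_smul (γ : Matrix (Fin n ⊕ Fin n) (Fin n ⊕ Fin n) ℤ)
    (τ : Matrix (Fin n) (Fin n) ℂ) :
    denom γ τ = toComplex (intR γ.toBlocks₂₁ * reMat τ + intR γ.toBlocks₂₂) +
      Complex.I • toComplex (intR γ.toBlocks₂₁ * imMat τ) := by
  have hint (A : Matrix (Fin n) (Fin n) ℤ) : A.map (fun x : ℤ => (x : ℂ)) = toComplex (intR A) := by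
    ext; simp [toComplex_apply]
  rw [denom, hint, hint]
  nth_rewrite 1 [eq_reMat_add_imMat τ]
  rw [toComplex_add, toComplex_mul, toComplex_mul, Matrix.mul_add, Matrix.mul_smul]
  abel

lemma imMat_smulSiegel_inv_eq (hγ : γ ∈ symplecticGroup (Fin n) ℤ)
    (hτ : τ ∈ siegelUpperHalf (Fin n)) :
    (imMat (smulSiegel γ τ))⁻¹ =
      (intR γ.toBlocks₂₁ * reMat τ + intR γ.toBlocks₂₂) * (imMat τ)⁻¹ *
        (intR γ.toBlocks₂₁ * reMat τ + intR γ.toBlocks₂₂)ᵀ +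
      intR γ.toBlocks₂₁ * imMat τ * (intR γ.toBlocks₂₁)ᵀ := by
  set c := intR γ.toBlocks₂₁
  set d := intR γ.toBlocks₂₂
  have hY : IsUnit (imMat τ).det := hτ.2.det_pos.ne'.isUnit
  have hcd : d * cᵀ = c * dᵀ := by
    have hγR := SymplecticGroup.transpose_mem (intR_mem_symplecticGroup hγ)
    rw [← fromBlocks_toBlocks (intR γ)ᵀ, SymplecticGroup.fromBlocks_mem_iff] at hγR
    exact hγR.2.1.symm
  have hleft (A : Matrix (Fin n) (Fin n) ℝ) : A * (imMat τ)⁻¹ * (c * imMat τ)ᵀ = A * cᵀ := by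
    rw [transpose_mul, (isSymm_imMat hτ.1).eq, Matrix.mul_assoc, ← Matrix.mul_assoc _ (imMat τ),
      nonsing_inv_mul _ hY, one_mul]
  have hright (A : Matrix (Fin n) (Fin n) ℝ) : c * imMat τ * (imMat τ)⁻¹ * A = c * A := by
    rw [Matrix.mul_assoc c, mul_nonsing_inv _ hY, mul_one]
  apply toComplex_injective
  rw [imMat_smulSiegel_inv hγ hτ, denom_eq_add_smul, mul_toComplex_mul_conjTranspose, hright,
    transpose_mul, (isSymm_imMat hτ.1).eq, Matrix.mul_assoc c]
  rw [hleft, hright, Matrix.add_mul, hcd, transpose_add, transpose_mul, (isSymm_reMat hτ.1).eq,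
    Matrix.mul_add, Matrix.mul_assoc]

lemma imMat_smulSiegel_inv_apply (hγ : γ ∈ symplecticGroup (Fin n) ℤ)
    (hτ : τ ∈ siegelUpperHalf (Fin n)) (i : Fin n) :
    (imMat (smulSiegel γ τ))⁻¹ i i = intQuad (siegelForm τ) (γ (.inr i)) := by
  have hblock : intR γ = fromBlocks (intR γ.toBlocks₁₁) (intR γ.toBlocks₁₂) (intR γ.toBlocks₂₁)
      (intR γ.toBlocks₂₂) := by
    rw [← fromBlocks_map, fromBlocks_toBlocks]
  rw [← one_mul γ, intQuad_mul, intQuad_one, one_mul, imMat_smulSiegel_inv_eq hγ hτ, hblock,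
    siegelForm]
  simp only [fromBlocks_multiply, fromBlocks_transpose, fromBlocks_apply₂₂]
  refine congrFun (congrFun ?_ i) i
  simp only [transpose_one, transpose_zero, transpose_add, transpose_mul,
    (isSymm_reMat hτ.1).eq, Matrix.mul_one, Matrix.mul_zero, add_zero, zero_add, Matrix.zero_mul,
    Matrix.one_mul]
  noncomm_ring

theorem exists_smulSiegel_imMat_ge (hn : 1 ≤ n) : ∃ c : ℝ, 0 < c ∧
    ∀ τ ∈ siegelUpperHalf (Fin n), ∃ γ ∈ symplecticGroup (Fin n) ℤ,
      (imMat (smulSiegel γ τ) - c • 1).PosSemidef := by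
  obtain ⟨C, hC, hred⟩ := hasSymplecticReduction_fin hn
  refine ⟨(n * C)⁻¹, inv_pos.mpr (mul_pos (Nat.cast_pos.mpr hn) hC), fun τ hτ => ?_⟩
  obtain ⟨γ, hγ, hle⟩ := hred _ (siegelForm_mem hτ) (siegelForm_posDef hτ)
  have hmem := smulSiegel_mem hγ hτ
  have htrace : (imMat (smulSiegel γ τ))⁻¹.trace ≤ n * C := by
    calc (imMat (smulSiegel γ τ))⁻¹.trace ≤ ∑ _i : Fin n, C :=
          Finset.sum_le_sum fun i _ => (imMat_smulSiegel_inv_apply hγ hτ i).trans_le (hle i)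
      _ = n * C := by simp
  refine ⟨γ, hγ, posSemidef_sub_smul_one (isSymm_imMat hmem.1) fun x => ?_⟩
  rw [inv_mul_le_iff₀ (mul_pos (Nat.cast_pos.mpr hn) hC)]
  exact (dotProduct_self_le_trace_inv_mul_quadForm hmem.2 x).trans
    (mul_le_mul_of_nonneg_right htrace (quadForm_nonneg hmem.2.posSemidef x))

end SiegelReduction

/-! ### The invariant norm of a Jacobi form -/

lemma norm_e (x : ℂ) : ‖e x‖ = Real.exp (-(2 * Real.pi * x.im)) := by
  rw [e, Complex.norm_exp]
  congr 1
  simp [Complex.mul_re, Complex.mul_im]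

lemma e_add (x y : ℂ) : e (x + y) = e x * e y := by
  rw [e, e, e, ← Complex.exp_add, mul_add]

section LatticePoint

variable {ι : Type*} {τ : Matrix ι ι ℂ}

/-- A real vector, regarded as a complex one. -/
def realC (v : ι → ℝ) : ι → ℂ := fun i => (v i : ℂ)

lemma realC_add (u v : ι → ℝ) : realC (u + v) = realC u + realC v := by
  ext; simp [realC]

variable [Fintype ι]

/-- The point of `ℂⁿ` with real coordinates `(x, y)` with respect to the lattice `τ ℤⁿ + ℤⁿ`. -/
def latticePoint (τ : Matrix ι ι ℂ) (x y : ι → ℝ) : ι → ℂ := τ *ᵥ realC x + realC y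

lemma realC_intR_transpose_mulVec (A : Matrix ι ι ℤ) (x : ι → ℝ) :
    realC ((intR A)ᵀ *ᵥ x) = (intC A)ᵀ *ᵥ realC x := by
  ext; simp [realC, mulVec, dotProduct]

lemma im_dotProduct_mulVec (τ : Matrix ι ι ℂ) (u v : ι → ℝ) :
    (realC u ⬝ᵥ (τ *ᵥ realC v)).im = u ⬝ᵥ (imMat τ *ᵥ v) := by
  simp [dotProduct, mulVec, realC, imMat, Complex.im_sum]

lemma im_dotProduct_latticePoint (τ : Matrix ι ι ℂ) (u x y : ι → ℝ) :
    (realC u ⬝ᵥ latticePoint τ x y).im = u ⬝ᵥ (imMat τ *ᵥ x) := by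
  rw [latticePoint, dotProduct_add, Complex.add_im, im_dotProduct_mulVec]
  simp [dotProduct, realC, Complex.im_sum]

lemma quadForm_add {Y : Matrix ι ι ℝ} (hY : Y.IsSymm) (x l : ι → ℝ) :
    (x + l) ⬝ᵥ (Y *ᵥ (x + l)) = x ⬝ᵥ (Y *ᵥ x) + (l ⬝ᵥ (Y *ᵥ l) + 2 * (l ⬝ᵥ (Y *ᵥ x))) := by
  have hcross : x ⬝ᵥ (Y *ᵥ l) = l ⬝ᵥ (Y *ᵥ x) := by
    rw [dotProduct_mulVec, ← mulVec_transpose, hY.eq, dotProduct_comm]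
  simp only [mulVec_add, dotProduct_add, add_dotProduct, hcross]
  ring

end LatticePoint

section JacNorm

variable {n : ℕ} {κ : ℤ} {m : ℕ} {φ : Matrix (Fin n) (Fin n) ℂ → (Fin n → ℂ) → ℂ}
  {γ : Matrix (Fin n ⊕ Fin n) (Fin n ⊕ Fin n) ℤ} {τ : Matrix (Fin n) (Fin n) ℂ}

/-- The invariant norm `|φ(τ, τ x + y)| e^{-2πm xᵀ (Im τ) x} det(Im τ)^{k/2}`, `k = κ / 2`,
of a Jacobi form of weight `k` and index `m`. -/
noncomputable def jacNorm (κ : ℤ) (m : ℕ) (φ : Matrix (Fin n) (Fin n) ℂ → (Fin n → ℂ) → ℂ)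
    (τ : Matrix (Fin n) (Fin n) ℂ) (x y : Fin n → ℝ) : ℝ :=
  ‖φ τ (latticePoint τ x y)‖ * Real.exp (-(2 * Real.pi * (m * (x ⬝ᵥ (imMat τ *ᵥ x))))) *
    (imMat τ).det ^ ((κ : ℝ) / 4)

lemma jacNorm_add_int (hφ : IsJacobiForm n κ m φ) (hτ : τ ∈ siegelUpperHalf (Fin n))
    (x y : Fin n → ℝ) (l μ : Fin n → ℤ) :
    jacNorm κ m φ τ (x + fun i => (l i : ℝ)) (y + fun i => (μ i : ℝ)) = jacNorm κ m φ τ x y := by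
  have hcast (v : Fin n → ℤ) : (fun i => (v i : ℂ)) = realC fun i => (v i : ℝ) := by
    ext; simp [realC]
  have hheis := hφ.heisenberg l μ τ hτ (latticePoint τ x y)
  rw [hcast, hcast] at hheis
  set L : Fin n → ℝ := fun i => (l i : ℝ)
  set M : Fin n → ℝ := fun i => (μ i : ℝ)
  have hpoint : latticePoint τ (x + L) (y + M) =
      latticePoint τ x y + τ *ᵥ realC L + realC M := by
    simp only [latticePoint, realC_add, mulVec_add]
    abel
  have him : (-((m : ℂ) * (realC L ⬝ᵥ (τ *ᵥ realC L) +
      2 * (realC L ⬝ᵥ latticePoint τ x y)))).im =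
      -(m * (L ⬝ᵥ (imMat τ *ᵥ L) + 2 * (L ⬝ᵥ (imMat τ *ᵥ x)))) := by
    simp [im_dotProduct_mulVec, im_dotProduct_latticePoint]
  rw [jacNorm, jacNorm, hpoint, hheis, norm_mul, norm_e, him, quadForm_add (isSymm_imMat hτ.1),
    mul_right_comm (Real.exp _), ← Real.exp_add, mul_comm (Real.exp _)]
  congr 3
  ring

lemma denom_transpose_mulVec_latticePoint (hγ : γ ∈ symplecticGroup (Fin n) ℤ)
    (hτ : τ ∈ siegelUpperHalf (Fin n)) (x y : Fin n → ℝ) :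
    (denom γ τ)ᵀ *ᵥ latticePoint (smulSiegel γ τ) x y =
      latticePoint τ ((intR γ.toBlocks₁₁)ᵀ *ᵥ x + (intR γ.toBlocks₂₁)ᵀ *ᵥ y)
        ((intR γ.toBlocks₁₂)ᵀ *ᵥ x + (intR γ.toBlocks₂₂)ᵀ *ᵥ y) := by
  have hnum : (denom γ τ)ᵀ * smulSiegel γ τ = (num γ τ)ᵀ := by
    rw [smulSiegel, ← Matrix.mul_assoc, ← num_transpose_mul_denom hγ hτ.1, Matrix.mul_assoc,
      mul_nonsing_inv _ (isUnit_det_denom hγ hτ), Matrix.mul_one]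
  rw [latticePoint, latticePoint, mulVec_add, mulVec_mulVec, hnum, realC_add, realC_add]
  simp only [realC_intR_transpose_mulVec, num, denom, transpose_add, transpose_mul, hτ.1.eq,
    mulVec_add, add_mulVec, ← mulVec_mulVec]
  abel

lemma one_add_smulSiegel_mul (hγ : γ ∈ symplecticGroup (Fin n) ℤ)
    (hτ : τ ∈ siegelUpperHalf (Fin n)) :
    1 + smulSiegel γ τ * (intC γ.toBlocks₂₁ * (denom γ τ)ᵀ) =
      intC γ.toBlocks₁₁ * (denom γ τ)ᵀ := by
  obtain ⟨hcd, had⟩ := symplectic_mul_transpose hγ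
  have hcD : intC γ.toBlocks₂₁ * (denom γ τ)ᵀ = denom γ τ * (intC γ.toBlocks₂₁)ᵀ := by
    simp only [denom, transpose_add, transpose_mul, hτ.1.eq, Matrix.mul_add, Matrix.add_mul,
      Matrix.mul_assoc]
    rw [hcd]
  rw [hcD, smulSiegel, Matrix.mul_assoc, ← Matrix.mul_assoc _ (denom γ τ),
    nonsing_inv_mul _ (isUnit_det_denom hγ hτ), Matrix.one_mul, ← had]
  simp only [num, denom, transpose_add, transpose_mul, hτ.1.eq, Matrix.mul_add, Matrix.add_mul,
    Matrix.mul_assoc]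
  abel

lemma dotProduct_latticePoint_smulSiegel (hγ : γ ∈ symplecticGroup (Fin n) ℤ)
    (hτ : τ ∈ siegelUpperHalf (Fin n)) (x y : Fin n → ℝ) {z : Fin n → ℂ}
    (hz : (denom γ τ)ᵀ *ᵥ latticePoint (smulSiegel γ τ) x y = z) :
    realC x ⬝ᵥ latticePoint (smulSiegel γ τ) x y +
        z ⬝ᵥ (((denom γ τ)⁻¹ * intC γ.toBlocks₂₁) *ᵥ z) =
      realC ((intR γ.toBlocks₁₁)ᵀ *ᵥ x + (intR γ.toBlocks₂₁)ᵀ *ᵥ y) ⬝ᵥ z := by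
  set z' := latticePoint (smulSiegel γ τ) x y with hz'
  have hcancel : z ⬝ᵥ (((denom γ τ)⁻¹ * intC γ.toBlocks₂₁) *ᵥ z) =
      z' ⬝ᵥ (intC γ.toBlocks₂₁ *ᵥ z) := by
    nth_rewrite 1 [← hz]
    rw [mulVec_transpose, ← dotProduct_mulVec, mulVec_mulVec, ← Matrix.mul_assoc,
      mul_nonsing_inv _ (isUnit_det_denom hγ hτ), Matrix.one_mul]
  have hexpand : z' ⬝ᵥ (intC γ.toBlocks₂₁ *ᵥ z) =
      realC x ⬝ᵥ ((smulSiegel γ τ * (intC γ.toBlocks₂₁ * (denom γ τ)ᵀ)) *ᵥ z') +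
        realC y ⬝ᵥ (intC γ.toBlocks₂₁ *ᵥ z) := by
    nth_rewrite 1 [hz']
    rw [latticePoint, add_dotProduct, ← vecMul_transpose, (smulSiegel_isSymm hγ hτ).eq,
      ← dotProduct_mulVec, ← mulVec_mulVec, ← mulVec_mulVec, hz]
  have hright : realC ((intR γ.toBlocks₁₁)ᵀ *ᵥ x + (intR γ.toBlocks₂₁)ᵀ *ᵥ y) ⬝ᵥ z =
      realC x ⬝ᵥ ((intC γ.toBlocks₁₁ * (denom γ τ)ᵀ) *ᵥ z') +
        realC y ⬝ᵥ (intC γ.toBlocks₂₁ *ᵥ z) := by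
    rw [realC_add, realC_intR_transpose_mulVec, realC_intR_transpose_mulVec, add_dotProduct,
      mulVec_transpose, mulVec_transpose, ← dotProduct_mulVec, ← dotProduct_mulVec,
      ← mulVec_mulVec, hz]
  rw [hcancel, hexpand, hright, ← one_add_smulSiegel_mul hγ hτ, add_mulVec, one_mulVec,
    dotProduct_add, add_assoc]

lemma det_imMat_smulSiegel_rpow (hγ : γ ∈ symplecticGroup (Fin n) ℤ)
    (hτ : τ ∈ siegelUpperHalf (Fin n)) {w : ℂ} (hw : w ^ 2 = (denom γ τ).det) (κ : ℤ) :
    (imMat (smulSiegel γ τ)).det ^ ((κ : ℝ) / 4) * ‖w‖ ^ κ = (imMat τ).det ^ ((κ : ℝ) / 4) := by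
  have hwpos : 0 < ‖w‖ := norm_pos_iff.mpr fun hzero =>
    (isUnit_det_denom hγ hτ).ne_zero <| by rw [← hw, hzero, zero_pow two_ne_zero]
  have hexponent : ((2 * 2 : ℕ) : ℝ) * ((κ : ℝ) / 4) = κ := by
    push_cast
    ring
  rw [det_imMat_smulSiegel hγ hτ, ← hw, norm_pow, ← pow_mul,
    Real.div_rpow hτ.2.det_pos.le (by positivity), ← Real.rpow_natCast,
    ← Real.rpow_mul hwpos.le, ← Real.rpow_intCast, hexponent,
    div_mul_cancel₀ _ (Real.rpow_pos_of_pos hwpos _).ne']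

lemma jacNorm_smulSiegel (hφ : IsJacobiForm n κ m φ) (hγ : γ ∈ symplecticGroup (Fin n) ℤ)
    (hτ : τ ∈ siegelUpperHalf (Fin n)) (x y : Fin n → ℝ) :
    jacNorm κ m φ (smulSiegel γ τ) x y = jacNorm κ m φ τ
      ((intR γ.toBlocks₁₁)ᵀ *ᵥ x + (intR γ.toBlocks₂₁)ᵀ *ᵥ y)
      ((intR γ.toBlocks₁₂)ᵀ *ᵥ x + (intR γ.toBlocks₂₂)ᵀ *ᵥ y) := by
  have hz := denom_transpose_mulVec_latticePoint hγ hτ x y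
  set x' := (intR γ.toBlocks₁₁)ᵀ *ᵥ x + (intR γ.toBlocks₂₁)ᵀ *ᵥ y
  set z := latticePoint τ x' ((intR γ.toBlocks₁₂)ᵀ *ᵥ x + (intR γ.toBlocks₂₂)ᵀ *ᵥ y) with hz_def
  have hDt : IsUnit (denom γ τ)ᵀ.det := by
    rw [det_transpose]
    exact isUnit_det_denom hγ hτ
  have hz' : (denom γ τ)⁻¹ᵀ *ᵥ z = latticePoint (smulSiegel γ τ) x y := by
    rw [← hz, mulVec_mulVec, transpose_nonsing_inv, nonsing_inv_mul _ hDt, one_mulVec]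
  obtain ⟨w, hw⟩ := IsAlgClosed.exists_pow_nat_eq (denom γ τ).det two_pos
  have htrans := hφ.symplectic γ hγ τ hτ z w hw
  rw [hz', ← smulSiegel] at htrans
  have him := congrArg Complex.im (dotProduct_latticePoint_smulSiegel hγ hτ x y hz)
  rw [Complex.add_im, im_dotProduct_latticePoint, hz_def, im_dotProduct_latticePoint,
    ← hz_def] at him
  rw [jacNorm, jacNorm, htrans, norm_mul, norm_mul, norm_zpow, norm_e,
    ← Complex.ofReal_natCast, Complex.im_ofReal_mul, ← det_imMat_smulSiegel_rpow hγ hτ hw, ← him,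
    mul_add, mul_add, neg_add, Real.exp_add]
  ring

end JacNorm

/-! ### Fourier coefficients of trigonometric series -/

section FourierCoefficients

open MeasureTheory

lemma e_sum {ι : Type*} (s : Finset ι) (f : ι → ℂ) : e (∑ i ∈ s, f i) = ∏ i ∈ s, e (f i) := by
  simp only [e, Finset.mul_sum, Complex.exp_sum]

lemma norm_e_ofReal (x : ℝ) : ‖e (x : ℂ)‖ = 1 := by simp [norm_e]

lemma continuous_e : Continuous e := by unfold e; fun_prop

lemma integral_e_int_mul (k : ℤ) :
    ∫ x : ℝ in Set.Ioc 0 1, e ((k : ℂ) * x) = if k = 0 then 1 else 0 := by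
  rw [← intervalIntegral.integral_of_le zero_le_one]
  split_ifs with hk
  · simp [hk, e]
  · have hc : 2 * Real.pi * Complex.I * (k : ℂ) ≠ 0 := by
      simp [hk, Real.pi_ne_zero]
    have hperiod : Complex.exp (2 * Real.pi * Complex.I * k) = 1 :=
      Complex.exp_eq_one_iff.mpr ⟨k, by ring⟩
    simp only [e, ← mul_assoc (2 * Real.pi * Complex.I)]
    rw [integral_exp_mul_complex hc]
    simp [hperiod]

variable {P D : Type*} [Fintype D]

lemma integral_e_sum_int_mul (k : D → ℤ) :
    ∫ x : D → ℝ in Set.univ.pi fun _ => Set.Ioc 0 1, e (∑ d, (k d : ℂ) * x d) =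
      if k = 0 then 1 else 0 := by
  simp only [e_sum]
  rw [volume_pi, Measure.restrict_pi_pi,
    integral_fintype_prod_eq_prod fun d (y : ℝ) => e ((k d : ℂ) * y)]
  simp only [integral_e_int_mul, funext_iff, Pi.zero_apply]
  exact Finset.prod_ite_zero.trans (by simp)

lemma tsum_fiber_eq_integral [Countable P] {c : P → ℂ} (hc : Summable fun p => ‖c p‖)
    (ν : P → D → ℤ) (ν₀ : D → ℤ) :
    ∑' p : {p // ν p = ν₀}, c p =
      ∫ x : D → ℝ in Set.univ.pi fun _ => Set.Ioc 0 1,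
        ∑' p, c p * e (∑ d, ((ν p - ν₀) d : ℂ) * x d) := by
  classical
  have hnorm (p : P) (x : D → ℝ) : ‖c p * e (∑ d, ((ν p - ν₀) d : ℂ) * x d)‖ = ‖c p‖ := by
    have := norm_e_ofReal (∑ d, ((ν p - ν₀) d : ℝ) * x d)
    push_cast at this
    rw [norm_mul, this, mul_one]
  have hcube : volume (Set.univ.pi fun _ : D => Set.Ioc (0 : ℝ) 1) = 1 := by
    simp [volume_pi_pi]
  have hprob : IsProbabilityMeasure
      (volume.restrict (Set.univ.pi fun _ : D => Set.Ioc (0 : ℝ) 1)) := ⟨by simp [hcube]⟩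
  have hcont (p : P) : Continuous fun x : D → ℝ => c p * e (∑ d, ((ν p - ν₀) d : ℂ) * x d) :=
    continuous_const.mul (continuous_e.comp (by fun_prop))
  rw [← integral_tsum_of_summable_integral_norm (fun p => .of_bound
    (hcont p).aestronglyMeasurable ‖c p‖ (ae_of_all _ fun x => (hnorm p x).le))
    (by simpa only [hnorm, integral_const, probReal_univ, one_smul] using hc)]
  simp only [integral_const_mul, integral_e_sum_int_mul, sub_eq_zero, mul_ite, mul_one, mul_zero]
  exact (tsum_subtype {p | ν p = ν₀} c).trans (tsum_congr fun p => by simp [Set.indicator_apply])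

lemma norm_tsum_fiber_le [Countable P] {c : P → ℂ} (hc : Summable fun p => ‖c p‖)
    (ν : P → D → ℤ) {F : ℝ}
    (hF : ∀ x : D → ℝ, ‖∑' p, c p * e (∑ d, (ν p d : ℂ) * x d)‖ ≤ F) (ν₀ : D → ℤ) :
    ‖∑' p : {p // ν p = ν₀}, c p‖ ≤ F := by
  have hcube : volume (Set.univ.pi fun _ : D => Set.Ioc (0 : ℝ) 1) = 1 := by
    simp [volume_pi_pi]
  have hshift (x : D → ℝ) (p : P) : c p * e (∑ d, ((ν p - ν₀) d : ℂ) * x d) =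
      e ((-∑ d, (ν₀ d : ℝ) * x d : ℝ) : ℂ) * (c p * e (∑ d, (ν p d : ℂ) * x d)) := by
    rw [mul_left_comm, ← e_add]
    congr 2
    push_cast [Pi.sub_apply]
    simp only [sub_mul, Finset.sum_sub_distrib]
    ring
  rw [tsum_fiber_eq_integral hc]
  refine (norm_setIntegral_le_of_norm_le_const (by simp [hcube]) fun x _ => ?_).trans_eq
    (by rw [measureReal_def, hcube, ENNReal.toReal_one, mul_one])
  simp only [hshift, tsum_mul_left, norm_mul, norm_e_ofReal, one_mul]
  exact hF x

lemma eq_zero_of_trigonometric_series_eq_zero [Countable P] {c : P → ℂ}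
    (hc : Summable fun p => ‖c p‖) {ν : P → D → ℤ} (hν : Function.Injective ν)
    (hzero : ∀ x : D → ℝ, ∑' p, c p * e (∑ d, (ν p d : ℂ) * x d) = 0) (p : P) : c p = 0 := by
  have hle := norm_tsum_fiber_le hc ν (F := 0) (fun x => by rw [hzero x, norm_zero]) (ν p)
  have : Unique {q // ν q = ν p} := ⟨⟨⟨p, rfl⟩⟩, fun q => Subtype.ext (hν q.2)⟩
  rwa [tsum_eq_single ⟨p, rfl⟩ fun q hq => (hq (Subsingleton.elim _ _)).elim,
    norm_le_zero_iff] at hle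

end FourierCoefficients

section UnimodularColumn

variable {R ι : Type*} [CommRing R] [IsDomain R] [IsPrincipalIdealRing R]

lemma exists_basis_smul_eq [Finite ι] {v : ι → R} (hv : v ≠ 0) :
    ∃ (b : Module.Basis ι R (ι → R)) (i : ι) (d : R), v = d • b i := by
  obtain ⟨k, S⟩ := Submodule.smithNormalForm (Pi.basisFun R ι) (Submodule.span R {v})
  have hcard : k = 1 := by
    have := Module.finrank_eq_card_basis S.bN
    rwa [← (LinearEquiv.toSpanNonzeroSingleton R _ v hv).finrank_eq, Module.finrank_self,
      Fintype.card_fin, eq_comm] at this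
  subst hcard
  have hrepr := congrArg Subtype.val
    (S.bN.sum_repr ⟨v, Submodule.mem_span_singleton_self v⟩)
  rw [Fintype.sum_unique, Submodule.coe_smul, S.snf, smul_smul] at hrepr
  exact ⟨S.bM, _, _, hrepr.symm⟩

lemma exists_GL_col [Fintype ι] [DecidableEq ι] (v : ι → R) (j : ι) :
    ∃ (u : GL ι R) (d : R), ∀ i, v i = d * u.1 i j := by
  by_cases hv : v = 0
  · exact ⟨1, 0, by simp [hv]⟩
  obtain ⟨b, i₀, d, rfl⟩ := exists_basis_smul_eq hv
  let b' := b.reindex (Equiv.swap i₀ j)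
  refine ⟨⟨(Pi.basisFun R ι).toMatrix b', b'.toMatrix (Pi.basisFun R ι),
    Module.Basis.toMatrix_mul_toMatrix_flip _ _, Module.Basis.toMatrix_mul_toMatrix_flip _ _⟩,
    d, fun i => ?_⟩
  simp [Module.Basis.toMatrix_apply, b']

end UnimodularColumn

/-! ### Half-integral matrices -/

section HalfIntegral

/-- A rational matrix, regarded as a real matrix. -/
abbrev ratR {ι κ : Type*} (t : Matrix ι κ ℚ) : Matrix ι κ ℝ := t.map (fun x : ℚ => (x : ℝ))

/-- An integral matrix, regarded as a rational one. -/
abbrev intQ {ι κ : Type*} (u : Matrix ι κ ℤ) : Matrix ι κ ℚ := u.map (fun x : ℤ => (x : ℚ))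

variable {ι : Type*}

lemma IsHalfIntegral.exists_int {t : Matrix ι ι ℚ} (ht : IsHalfIntegral t) :
    ∃ T : Matrix ι ι ℤ, intQ T = (2 : ℚ) • t ∧ T.IsSymm ∧ ∀ i, Even (T i i) := by
  choose T hT using ht.2.2
  refine ⟨of T, by ext; simp [hT], ?_, fun i => ?_⟩
  · ext i j
    have : ((T j i : ℤ) : ℚ) = T i j := by rw [← hT, ← hT, ht.1.apply]
    exact_mod_cast this
  · obtain ⟨a, ha⟩ := ht.2.1 i
    refine ⟨a, ?_⟩
    have : ((T i i : ℤ) : ℚ) = a + a := by rw [← hT, ha]; ring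
    exact_mod_cast this

lemma exists_int_eq_mul [Finite ι] (q : ι → ℚ) :
    ∃ (D : ℕ) (v : ι → ℤ), 0 < D ∧ ∀ i, (v i : ℚ) = D * q i := by
  classical
  cases nonempty_fintype ι
  refine ⟨∏ i, (q i).den, fun i => (q i).num * ∏ j ∈ Finset.univ.erase i, ((q j).den : ℤ),
    Finset.prod_pos fun i _ => (q i).pos, fun i => ?_⟩
  rw [← Finset.mul_prod_erase _ _ (Finset.mem_univ i)]
  push_cast
  rw [mul_right_comm, Rat.den_mul_eq_num (q i)]

variable [Fintype ι]

-- Modulo 2 the terms indexed by `(i, j)` and `(j, i)` cancel, and the diagonal terms vanish.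
lemma even_quadForm {T : Matrix ι ι ℤ} (hT : T.IsSymm) (hdiag : ∀ i, Even (T i i)) (x : ι → ℤ) :
    Even (x ⬝ᵥ (T *ᵥ x)) := by
  have hsum : ((x ⬝ᵥ (T *ᵥ x) : ℤ) : ZMod 2) =
      ∑ p : ι × ι, ((x p.1 * (T p.1 p.2 * x p.2) : ℤ) : ZMod 2) := by
    simp [Fintype.sum_prod_type, dotProduct, mulVec, Finset.mul_sum]
  rw [← ZMod.intCast_eq_zero_iff_even, hsum]
  refine Finset.sum_involution (fun p _ => p.swap) (fun p _ => ?_) (fun p _ hp hswap => hp ?_)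
    (fun _ _ => Finset.mem_univ _) (fun p _ => Prod.swap_swap p)
  · have hterm : x p.swap.1 * (T p.swap.1 p.swap.2 * x p.swap.2) =
        x p.1 * (T p.1 p.2 * x p.2) := by
      simp only [Prod.fst_swap, Prod.snd_swap, hT.apply]
      ring
    rw [hterm]
    exact CharTwo.add_self_eq_zero _
  · have hfixed : p.2 = p.1 := congrArg Prod.fst hswap
    rw [ZMod.intCast_eq_zero_iff_even, hfixed]
    exact ((hdiag p.1).mul_right _).mul_left _

lemma intQ_mul {κ ν : Type*} (A : Matrix ν ι ℤ) (B : Matrix ι κ ℤ) :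
    intQ (A * B) = intQ A * intQ B :=
  Matrix.map_mul (L := A) (M := B) (f := Int.castRingHom ℚ)

lemma IsHalfIntegral.conj {t : Matrix ι ι ℚ} (ht : IsHalfIntegral t) (u : Matrix ι ι ℤ) :
    IsHalfIntegral ((intQ u)ᵀ * t * intQ u) := by
  obtain ⟨T, hT, hsymm, hdiag⟩ := ht.exists_int
  have htwice : (2 : ℚ) • ((intQ u)ᵀ * t * intQ u) = intQ (uᵀ * T * u) := by
    rw [intQ_mul, intQ_mul, hT, Matrix.mul_smul, Matrix.smul_mul]
    rfl
  have hentry (i j : ι) : 2 * ((intQ u)ᵀ * t * intQ u) i j = ((uᵀ * T * u) i j : ℤ) :=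
    congrFun (congrFun htwice i) j
  refine ⟨?_, fun i => ?_, fun i j => ⟨_, hentry i j⟩⟩
  · rw [IsSymm, transpose_mul, transpose_mul, transpose_transpose, ht.1.eq, Matrix.mul_assoc]
  · have hquad : (uᵀ * T * u) i i = (fun k => u k i) ⬝ᵥ (T *ᵥ fun k => u k i) := by
      rw [Matrix.mul_assoc, mul_apply]
      rfl
    obtain ⟨a, ha⟩ := even_quadForm hsymm hdiag fun k => u k i
    refine ⟨a, ?_⟩
    have hdouble := hentry i i
    rw [hquad, ha] at hdouble
    push_cast at hdouble
    linarith

lemma intQuad_ratR_of_col (t : Matrix ι ι ℚ) {u : Matrix ι ι ℤ} {v : ι → ℤ} {d : ℤ} {j : ι}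
    (hv : ∀ i, v i = d * u i j) :
    intQuad (ratR t) v = d ^ 2 * ((((intQ u)ᵀ * t * intQ u) j j : ℚ) : ℝ) := by
  have hv' (i : ι) : (v i : ℝ) = d * (u i j : ℝ) := by rw [hv i, Int.cast_mul]
  rw [Matrix.mul_assoc, mul_apply]
  simp only [intQuad, dotProduct, mulVec, mul_apply, transpose_apply, map_apply, hv']
  push_cast
  simp only [Finset.mul_sum]
  exact Finset.sum_congr rfl fun i _ => Finset.sum_congr rfl fun j _ => by ring

lemma quadForm_pos_of_intQuad_pos {t : Matrix ι ι ℚ}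
    (ht : ∀ v : ι → ℤ, v ≠ 0 → 0 < intQuad (ratR t) v) {q : ι → ℚ} (hq : q ≠ 0) :
    0 < q ⬝ᵥ (t *ᵥ q) := by
  obtain ⟨D, v, hD, hv⟩ := exists_int_eq_mul q
  have hv0 : v ≠ 0 := by
    rintro rfl
    refine hq (funext fun i => ?_)
    simpa [hD.ne'] using hv i
  have hscale : intQuad (ratR t) v = ((D ^ 2 * (q ⬝ᵥ (t *ᵥ q)) : ℚ) : ℝ) := by
    have hv' (i : ι) : (v i : ℝ) = ((D * q i : ℚ) : ℝ) := by rw [← hv, Rat.cast_intCast]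
    simp only [intQuad, dotProduct, mulVec, hv', map_apply]
    push_cast
    simp only [Finset.mul_sum]
    exact Finset.sum_congr rfl fun i _ => Finset.sum_congr rfl fun j _ => by ring
  have hpos : (0 : ℚ) < D ^ 2 * (q ⬝ᵥ (t *ᵥ q)) := by exact_mod_cast hscale ▸ ht v hv0
  exact pos_of_mul_pos_right hpos (by positivity)

lemma posSemidef_ratR {t : Matrix ι ι ℚ} (hsymm : t.IsSymm) (ht : ∀ q, 0 ≤ q ⬝ᵥ (t *ᵥ q)) :
    (ratR t).PosSemidef := by
  have hsymmR : (ratR t).IsSymm := (isSymm_map_iff Rat.cast_injective).mpr hsymm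
  refine .of_dotProduct_mulVec_nonneg (isHermitian_iff_isSymm.mpr hsymmR) fun x => ?_
  rw [star_trivial]
  have hdense : DenseRange fun (q : ι → ℚ) (i : ι) => (q i : ℝ) :=
    DenseRange.piMap fun _ => Rat.denseRange_cast
  have hclosed : IsClosed {x : ι → ℝ | 0 ≤ x ⬝ᵥ (ratR t *ᵥ x)} :=
    isClosed_le continuous_const (continuous_id.dotProduct
      (continuous_const.matrix_mulVec continuous_id))
  refine hdense.induction_on (p := fun x : ι → ℝ => 0 ≤ x ⬝ᵥ (ratR t *ᵥ x)) x hclosed fun q => ?_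
  have hcast : (fun i => (q i : ℝ)) ⬝ᵥ (ratR t *ᵥ fun i => (q i : ℝ)) =
      ((q ⬝ᵥ (t *ᵥ q) : ℚ) : ℝ) := by
    simp [dotProduct, mulVec]
  rw [hcast]
  exact_mod_cast ht q

lemma posDef_ratR {t : Matrix ι ι ℚ} (hsymm : t.IsSymm)
    (ht : ∀ v : ι → ℤ, v ≠ 0 → 0 < intQuad (ratR t) v) : (ratR t).PosDef := by
  classical
  have hsemi : (ratR t).PosSemidef := posSemidef_ratR hsymm fun q => by
    rcases eq_or_ne q 0 with rfl | hq
    · simp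
    · exact (quadForm_pos_of_intQuad_pos ht hq).le
  have hdet : (ratR t).det = ((t.det : ℚ) : ℝ) := (RingHom.map_det (Rat.castHom ℝ) t).symm
  rw [hsemi.posDef_iff_det_ne_zero, hdet, Rat.cast_ne_zero]
  intro hzero
  obtain ⟨q, hq, hker⟩ := exists_mulVec_eq_zero_iff.mpr hzero
  simpa [hker] using quadForm_pos_of_intQuad_pos ht hq

end HalfIntegral

/-! ### The support of the Fourier coefficients -/

section Support

variable {n : ℕ}

/-- The index set of the Fourier expansion of a Jacobi form. -/
abbrev FourierIndex (n : ℕ) : Type :=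
  {s : Matrix (Fin n) (Fin n) ℚ // IsHalfIntegral s} × (Fin n → ℤ)

instance : Countable (FourierIndex n) := by
  have : Countable (Matrix (Fin n) (Fin n) ℚ) := inferInstanceAs (Countable (Fin n → Fin n → ℚ))
  infer_instance

lemma isHalfIntegral_blockIndex {s : Matrix (Fin n) (Fin n) ℚ} (hs : IsHalfIntegral s)
    (r : Fin n → ℤ) (m : ℤ) : IsHalfIntegral (blockIndex s r m) := by
  refine ⟨?_, ?_, ?_⟩
  · refine IsSymm.fromBlocks hs.1 ?_ ?_ <;> ext <;> simp
  · rintro (i | i)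
    · exact hs.2.1 i
    · exact ⟨m, rfl⟩
  · rintro (i | i) (j | j)
    · exact hs.2.2 i j
    · exact ⟨r i, mul_div_cancel₀ _ two_ne_zero⟩
    · exact ⟨r j, mul_div_cancel₀ _ two_ne_zero⟩
    · exact ⟨2 * m, by simp [blockIndex]⟩

lemma IsHalfIntegral.exists_blockIndex {t : Matrix (Fin n ⊕ Unit) (Fin n ⊕ Unit) ℚ}
    (ht : IsHalfIntegral t) : ∃ p : FourierIndex n,
      t = blockIndex p.1.1 p.2 (t (.inr ()) (.inr ())) := by
  choose r hr using fun i : Fin n => ht.2.2 (.inl i) (.inr ())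
  have hrow (i : Fin n) : t (.inl i) (.inr ()) = (r i : ℚ) / 2 := by
    rw [← hr, mul_div_cancel_left₀ _ two_ne_zero]
  refine ⟨⟨⟨t.toBlocks₁₁, IsSymm.ext fun i j => ht.1.apply _ _, fun i => ht.2.1 (.inl i),
    fun i j => ht.2.2 (.inl i) (.inl j)⟩, r⟩, ?_⟩
  · ext (i | i) (j | j)
    · rfl
    · exact hrow i
    · exact (ht.1.apply _ _).trans (hrow j)
    · rfl

lemma blockIndex_injective {m m' : ℚ} {p p' : FourierIndex n}
    (h : blockIndex p.1.1 p.2 m = blockIndex p'.1.1 p'.2 m') : p = p' := by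
  obtain ⟨hs, hr, -, -⟩ := fromBlocks_inj.mp h
  refine Prod.ext (Subtype.ext hs) (funext fun i => ?_)
  simpa [div_left_inj'] using congrFun (congrFun hr i) ()

lemma imMat_toComplex_add_smul_one {ι : Type*} [DecidableEq ι] (X : Matrix ι ι ℝ) (y : ℝ) :
    imMat (toComplex X + (y * Complex.I) • (1 : Matrix ι ι ℂ)) = y • 1 := by
  ext i j
  by_cases hij : i = j <;> simp [imMat, toComplex_apply, one_apply, hij]

lemma toComplex_add_smul_one_mem {ι : Type*} [Fintype ι] [DecidableEq ι] {X : Matrix ι ι ℝ}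
    (hX : X.IsSymm) {y : ℝ} (hy : 0 < y) :
    toComplex X + (y * Complex.I) • (1 : Matrix ι ι ℂ) ∈ siegelUpperHalf ι := by
  refine ⟨.add ((isSymm_map_iff Complex.ofReal_injective).mpr hX) (isSymm_one.smul _), ?_⟩
  rw [imMat_toComplex_add_smul_one]
  exact PosDef.one.smul hy

/-- The integral frequency vector of the `(s, r)`-th term of a Fourier expansion: the entries of
`2 s`, followed by `r`. -/
def fourierFreq (p : FourierIndex n) : (Fin n × Fin n) ⊕ Fin n → ℤ :=
  Sum.elim (fun q => (2 * p.1.1 q.1 q.2).num) p.2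

lemma intCast_fourierFreq_inl (p : FourierIndex n) (q : Fin n × Fin n) :
    (fourierFreq p (.inl q) : ℚ) = 2 * p.1.1 q.1 q.2 := by
  obtain ⟨a, ha⟩ := p.1.2.2.2 q.1 q.2
  simp [fourierFreq, ha]

lemma fourierFreq_injective : Function.Injective (fourierFreq (n := n)) := by
  intro p q hpq
  refine Prod.ext (Subtype.ext ?_) (funext fun i => congrFun hpq (.inr i))
  ext i j
  have hentry := intCast_fourierFreq_inl p (i, j)
  rw [hpq, intCast_fourierFreq_inl] at hentry
  linarith

lemma sum_fourierFreq_mul (p : FourierIndex n) (x : (Fin n × Fin n) ⊕ Fin n → ℝ) :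
    ∑ d, (fourierFreq p d : ℂ) * x d =
      (p.1.1.map (fun q : ℚ => (q : ℂ)) *
        toComplex (of fun i j => x (.inl (i, j)) + x (.inl (j, i)))).trace +
      (fun i => (p.2 i : ℂ)) ⬝ᵥ fun i => (x (.inr i) : ℂ) := by
  have hfreq (i j : Fin n) : (fourierFreq p (.inl (i, j)) : ℂ) = 2 * (p.1.1 i j : ℂ) := by
    exact_mod_cast congrArg (Rat.cast : ℚ → ℂ) (intCast_fourierFreq_inl p (i, j))
  have hswap : ∑ i, ∑ j, (p.1.1 i j : ℂ) * x (.inl (j, i)) =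
      ∑ i, ∑ j, (p.1.1 i j : ℂ) * x (.inl (i, j)) := by
    rw [Finset.sum_comm]
    simp only [p.1.2.1.apply]
  have htrace : (p.1.1.map (fun q : ℚ => (q : ℂ)) *
      toComplex (of fun i j => x (.inl (i, j)) + x (.inl (j, i)))).trace =
        2 * ∑ i, ∑ j, (p.1.1 i j : ℂ) * x (.inl (i, j)) := by
    simp only [trace, diag_apply, mul_apply, map_apply, toComplex_apply, of_apply,
      Complex.ofReal_add, mul_add, Finset.sum_add_distrib, hswap, two_mul]
  rw [htrace, Fintype.sum_sum_type, Fintype.sum_prod_type]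
  simp only [hfreq, dotProduct, Finset.mul_sum, mul_assoc]
  rfl

lemma HasFourierExpansion.eq_zero {φ : Matrix (Fin n) (Fin n) ℂ → (Fin n → ℂ) → ℂ}
    {c : Matrix (Fin n) (Fin n) ℚ → (Fin n → ℤ) → ℂ} (hφ : HasFourierExpansion φ c)
    (hzero : ∀ τ ∈ siegelUpperHalf (Fin n), ∀ z, φ τ z = 0) (p : FourierIndex n) :
    c p.1.1 p.2 = 0 := by
  let c' (p : FourierIndex n) : ℂ :=
    c p.1.1 p.2 * e (((1 : ℝ) * Complex.I) * (p.1.1.map (fun x : ℚ => (x : ℂ))).trace)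
  have hseries (x : (Fin n × Fin n) ⊕ Fin n → ℝ) :
      HasSum (fun p => c' p * e (∑ d, (fourierFreq p d : ℂ) * x d)) 0 := by
    have hmem := toComplex_add_smul_one_mem
      (X := of fun i j => x (.inl (i, j)) + x (.inl (j, i))) (by ext; simp [add_comm]) one_pos
    have hsum := hφ _ hmem fun i => (x (.inr i) : ℂ)
    rw [hzero _ hmem] at hsum
    convert hsum using 2 with p
    rw [mul_assoc, ← e_add, sum_fourierFreq_mul, Matrix.mul_add, trace_add, Matrix.mul_smul,
      mul_one, trace_smul, smul_eq_mul]
    congr 2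
    ring
  have hsummable : Summable fun p => ‖c' p‖ := by
    simpa [e] using (hseries 0).summable.norm
  have hc' := eq_zero_of_trigonometric_series_eq_zero hsummable fourierFreq_injective
    (fun x => (hseries x).tsum_eq) p
  exact (mul_eq_zero.mp hc').resolve_right (Complex.exp_ne_zero _)

variable {κ : ℤ} {φ : ℕ → Matrix (Fin n) (Fin n) ℂ → (Fin n → ℂ) → ℂ}
  {a : Matrix (Fin n ⊕ Unit) (Fin n ⊕ Unit) ℚ → ℂ}

/-- The symmetry `|a(uᵀ t u)| = |a(t)|` of a coefficient family under `GL_g(ℤ)`. Absolute values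
remove the factor `det(u)^k`, which is a root of unity. -/
def IsNormSymmetric (a : Matrix (Fin n ⊕ Unit) (Fin n ⊕ Unit) ℚ → ℂ) : Prop :=
  ∀ (u : GL (Fin n ⊕ Unit) ℤ) (t : Matrix (Fin n ⊕ Unit) (Fin n ⊕ Unit) ℚ), IsHalfIntegral t →
    ‖a ((intQ u.1)ᵀ * t * intQ u.1)‖ = ‖a t‖

lemma IsSymmetricFJ.exists_coeff (hf : IsSymmetricFJ n κ φ) :
    ∃ a, IsCoeffFamily φ a ∧ IsNormSymmetric (n := n) a := by
  obtain ⟨a, ha, hsym⟩ := hf.symmetric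
  refine ⟨a, ha, fun u t ht => ?_⟩
  obtain ⟨w, hw⟩ := IsAlgClosed.exists_pow_nat_eq
    ((u : Matrix (Fin n ⊕ Unit) (Fin n ⊕ Unit) ℤ).det : ℂ) two_pos
  have hdet : IsUnit (u : Matrix (Fin n ⊕ Unit) (Fin n ⊕ Unit) ℤ).det :=
    (isUnit_iff_isUnit_det _).mp u.isUnit
  have hnorm : ‖w‖ = 1 := by
    rw [← pow_eq_one_iff_of_nonneg (norm_nonneg _) two_ne_zero, ← norm_pow, hw]
    rcases Int.isUnit_iff.mp hdet with h | h <;> simp [h]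
  rw [hsym u w hw t ht, norm_mul, norm_zpow, hnorm, _root_.one_zpow, one_mul]

lemma IsCoeffFamily.corner_pos_of_ne_zero (ha : IsCoeffFamily φ a) (hcusp : IsCuspidal φ)
    {t : Matrix (Fin n ⊕ Unit) (Fin n ⊕ Unit) ℚ} (ht : IsHalfIntegral t) (hat : a t ≠ 0) :
    0 < t (.inr ()) (.inr ()) := by
  rcases lt_trichotomy (t (.inr ()) (.inr ())) 0 with hneg | hzero | hpos
  · exact absurd (ha.2 t ht hneg) hat
  · obtain ⟨p, hp⟩ := ht.exists_blockIndex
    have hcoeff := (ha.1 0).eq_zero hcusp p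
    rw [hp, hzero] at hat
    exact absurd (by simpa using hcoeff) hat
  · exact hpos

/-- A coefficient family supported on positive definite indices, as for a cusp form. -/
def HasPosDefSupport (a : Matrix (Fin n ⊕ Unit) (Fin n ⊕ Unit) ℚ → ℂ) : Prop :=
  ∀ t, IsHalfIntegral t → a t ≠ 0 → (ratR t).PosDef

-- A primitive integral vector is the last column of some `u ∈ GL_g(ℤ)`, so the value of `t` at it
-- is the lower right entry of `uᵀ t u`.
lemma IsCoeffFamily.hasPosDefSupport (ha : IsCoeffFamily φ a) (hsym : IsNormSymmetric a)
    (hcusp : IsCuspidal φ) : HasPosDefSupport a := by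
  refine fun t ht hat => posDef_ratR ht.1 fun v hv => ?_
  obtain ⟨u, d, hu⟩ := exists_GL_col v (.inr ())
  have hd : d ≠ 0 := by
    rintro rfl
    exact hv (funext fun i => by simpa using hu i)
  have hat' : a ((intQ u.1)ᵀ * t * intQ u.1) ≠ 0 := by
    rwa [← norm_ne_zero_iff, hsym u t ht, norm_ne_zero_iff]
  have hcorner := ha.corner_pos_of_ne_zero hcusp (ht.conj u.1) hat'
  rw [intQuad_ratR_of_col t hu]
  exact mul_pos (by positivity) (by exact_mod_cast hcorner)

end Support

/-! ### The Fourier expansion at torsion points -/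

section Twist

variable {ι : Type*} [DecidableEq ι]

/-- The matrix `(1, x)ᵀ` of the substitution `z = τ x`. -/
def twistCols (x : ι → ℝ) : Matrix (ι ⊕ Unit) ι ℝ := fromRows 1 (of fun _ j => x j)

variable [Fintype ι]

/-- The index `(1, x) t (1, x)ᵀ` in the Fourier expansion at `z = τ x + y`. -/
noncomputable def twist (x : ι → ℝ) (t : Matrix (ι ⊕ Unit) (ι ⊕ Unit) ℚ) : Matrix ι ι ℝ :=
  (twistCols x)ᵀ * ratR t * twistCols x

lemma twist_posDef (x : ι → ℝ) {t : Matrix (ι ⊕ Unit) (ι ⊕ Unit) ℚ} (ht : (ratR t).PosDef) :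
    (twist x t).PosDef := by
  have hconj := ht.conjTranspose_mul_mul_same (B := twistCols x) fun v w h => by
    ext i
    simpa [twistCols, mulVec, dotProduct, one_apply] using congrFun h (.inl i)
  rwa [conjTranspose_eq_transpose_of_trivial] at hconj

variable {n : ℕ}

lemma twist_blockIndex_apply (x : Fin n → ℝ) (s : Matrix (Fin n) (Fin n) ℚ) (r : Fin n → ℤ)
    (m : ℚ) (i j : Fin n) : twist x (blockIndex s r m) i j =
      s i j + (x i * r j + r i * x j) / 2 + m * (x i * x j) := by
  simp [twist, twistCols, blockIndex, mul_apply, Fintype.sum_sum_type, one_apply, add_mul,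
    Finset.sum_add_distrib]
  ring

lemma trace_twist_mul (x : Fin n → ℝ) (s : Matrix (Fin n) (Fin n) ℚ) (r : Fin n → ℤ) (m : ℕ)
    {τ : Matrix (Fin n) (Fin n) ℂ} (hτ : τ.IsSymm) :
    (toComplex (twist x (blockIndex s r m)) * τ).trace =
      (s.map (fun q : ℚ => (q : ℂ)) * τ).trace + (fun i => (r i : ℂ)) ⬝ᵥ (τ *ᵥ realC x) +
        m * (realC x ⬝ᵥ (τ *ᵥ realC x)) := by
  set ρ : Fin n → ℂ := fun i => (r i : ℂ)
  have htwist : toComplex (twist x (blockIndex s r m)) = s.map (fun q : ℚ => (q : ℂ)) +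
      (1 / 2 : ℂ) • (vecMulVec (realC x) ρ + vecMulVec ρ (realC x)) +
        (m : ℂ) • vecMulVec (realC x) (realC x) := by
    ext i j
    simp only [toComplex_apply, twist_blockIndex_apply, Matrix.add_apply, Matrix.smul_apply,
      map_apply, vecMulVec_apply, smul_eq_mul, realC, ρ]
    push_cast
    ring
  have htrace (u v : Fin n → ℂ) : (vecMulVec u v * τ).trace = u ⬝ᵥ (τ *ᵥ v) := by
    rw [vecMulVec_mul, trace_vecMulVec, ← mulVec_transpose, hτ.eq]
  have hcomm : realC x ⬝ᵥ (τ *ᵥ ρ) = ρ ⬝ᵥ (τ *ᵥ realC x) := by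
    rw [dotProduct_mulVec, ← mulVec_transpose, hτ.eq, dotProduct_comm]
  simp only [htwist, Matrix.add_mul, Matrix.smul_mul, trace_add, trace_smul, htrace, hcomm,
    smul_eq_mul]
  ring

variable {φ : Matrix (Fin n) (Fin n) ℂ → (Fin n → ℂ) → ℂ} {m : ℕ}
  {a : Matrix (Fin n ⊕ Unit) (Fin n ⊕ Unit) ℚ → ℂ}

/-- The terms of the Fourier expansion at `z = τ x + y`, normalized by the factor
`e(m xᵀ τ x)`. -/
noncomputable def twistTerm (m : ℕ) (a : Matrix (Fin n ⊕ Unit) (Fin n ⊕ Unit) ℚ → ℂ)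
    (τ : Matrix (Fin n) (Fin n) ℂ) (x y : Fin n → ℝ) (p : FourierIndex n) : ℂ :=
  a (blockIndex p.1.1 p.2 m) *
    e ((toComplex (twist x (blockIndex p.1.1 p.2 m)) * τ).trace +
      (fun i => (p.2 i : ℂ)) ⬝ᵥ realC y)

lemma norm_twistTerm (τ : Matrix (Fin n) (Fin n) ℂ) (x y : Fin n → ℝ) (p : FourierIndex n) :
    ‖twistTerm m a τ x y p‖ = ‖a (blockIndex p.1.1 p.2 m)‖ *
      Real.exp (-(2 * Real.pi * (twist x (blockIndex p.1.1 p.2 m) * imMat τ).trace)) := by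
  have hreal : ((fun i => (p.2 i : ℂ)) ⬝ᵥ realC y).im = 0 := by
    simp [dotProduct, realC, Complex.im_sum]
  rw [twistTerm, norm_mul, norm_e, Complex.add_im, trace_toComplex_mul_im, hreal, add_zero]

lemma hasSum_twistTerm (hφ : HasFourierExpansion φ fun s r => a (blockIndex s r m))
    {τ : Matrix (Fin n) (Fin n) ℂ} (hτ : τ ∈ siegelUpperHalf (Fin n)) (x y : Fin n → ℝ) :
    HasSum (twistTerm m a τ x y)
      (φ τ (latticePoint τ x y) * e (m * (realC x ⬝ᵥ (τ *ᵥ realC x)))) := by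
  refine ((hφ τ hτ (latticePoint τ x y)).mul_right (e (m * (realC x ⬝ᵥ (τ *ᵥ realC x))))).congr_fun
    fun p => ?_
  rw [twistTerm, trace_twist_mul x _ _ _ hτ.1, mul_assoc, ← e_add, latticePoint, dotProduct_add]
  ring_nf

lemma jacNorm_eq_norm_tsum {κ : ℤ} (hφ : HasFourierExpansion φ fun s r => a (blockIndex s r m))
    {τ : Matrix (Fin n) (Fin n) ℂ} (hτ : τ ∈ siegelUpperHalf (Fin n)) (x y : Fin n → ℝ) :
    jacNorm κ m φ τ x y = ‖∑' p, twistTerm m a τ x y p‖ * (imMat τ).det ^ ((κ : ℝ) / 4) := by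
  rw [(hasSum_twistTerm hφ hτ x y).tsum_eq, norm_mul, norm_e, ← Complex.ofReal_natCast,
    Complex.im_ofReal_mul, im_dotProduct_mulVec, jacNorm]

/-- The torsion coordinates `l / N`. -/
noncomputable def divVec {ι : Type*} (N : ℕ) (l : ι → ℤ) : ι → ℝ := fun i => (l i : ℝ) / N

lemma exists_int_eq_trace_twist {N : ℕ} (hN : 0 < N) (l : Fin n → ℤ) (m : ℕ)
    (p : FourierIndex n) :
    ∃ k : ℤ, (k : ℝ) = N ^ 2 * (twist (divVec N l) (blockIndex p.1.1 p.2 m)).trace := by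
  choose s hs using p.1.2.2.1
  refine ⟨∑ i, (N ^ 2 * s i + N * (p.2 i * l i) + m * (l i * l i)), ?_⟩
  simp only [trace, diag_apply, twist_blockIndex_apply, divVec, hs, Finset.mul_sum]
  push_cast
  refine Finset.sum_congr rfl fun i _ => ?_
  field_simp
  ring

lemma pow_inv_le_det_twist {N : ℕ} (hN : 0 < N) (l : Fin n → ℤ) (m : ℕ) (p : FourierIndex n)
    (hp : (ratR (blockIndex p.1.1 p.2 m)).PosDef) :
    ((2 * (N : ℝ) ^ 2)⁻¹) ^ n ≤ (twist (divVec N l) (blockIndex p.1.1 p.2 m)).det := by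
  choose s hs using p.1.2.2.2
  let T : Matrix (Fin n) (Fin n) ℤ :=
    of fun i j => N ^ 2 * s i j + N * (l i * p.2 j + p.2 i * l j) + 2 * m * (l i * l j)
  have hT : intR T = (2 * (N : ℝ) ^ 2) • twist (divVec N l) (blockIndex p.1.1 p.2 m) := by
    ext i j
    have hsij : (s i j : ℝ) = 2 * ((p.1.1 i j : ℚ) : ℝ) := by
      exact_mod_cast congrArg (Rat.cast : ℚ → ℝ) (hs i j).symm
    simp only [map_apply, Matrix.smul_apply, smul_eq_mul, twist_blockIndex_apply, divVec, T,
      of_apply]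
    push_cast
    rw [hsij]
    field_simp
  have hdet : ((T.det : ℤ) : ℝ) =
      (2 * (N : ℝ) ^ 2) ^ n * (twist (divVec N l) (blockIndex p.1.1 p.2 m)).det := by
    rw [show ((T.det : ℤ) : ℝ) = (intR T).det from RingHom.map_det (Int.castRingHom ℝ) T, hT,
      det_smul, Fintype.card_fin]
  have hpos : (0 : ℝ) < (T.det : ℤ) := by
    rw [hdet]
    exact mul_pos (by positivity) (twist_posDef (divVec N l) hp).det_pos
  rw [inv_pow, inv_le_iff_one_le_mul₀' (by positivity), ← hdet]
  exact_mod_cast hpos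

end Twist

section DetRpow

variable {ι : Type*} [Fintype ι] [DecidableEq ι] {β c δ : ℝ} {S Y : Matrix ι ι ℝ}

lemma det_rpow_le_of_nonpos (hβ : β ≤ 0) (hc : 0 < c) (hY : (Y - (2 * c) • 1).PosSemidef) :
    Y.det ^ β ≤ (c ^ Fintype.card ι) ^ β := by
  have hbounds := det_sub_smul_one_bounds hc hY
  exact Real.rpow_le_rpow_of_nonpos (by positivity) (hbounds.1.trans hbounds.2.1) hβ

lemma exp_neg_trace_mul_det_rpow_le (hβ : 0 < β) (hδ : 0 < δ) (hS : S.PosDef) (hSδ : δ ≤ S.det)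
    (hY : Y.PosDef) :
    Real.exp (-(Real.pi * (S * Y).trace)) * Y.det ^ β ≤
      (((Real.pi / β) ^ Fintype.card ι * δ)⁻¹) ^ β := by
  have hη : 0 < Real.pi / β := div_pos Real.pi_pos hβ
  have hYdet := hY.det_pos
  have hdet : Y.det ≤
      ((Real.pi / β) ^ Fintype.card ι * δ)⁻¹ * Real.exp (Real.pi / β * (S * Y).trace) := by
    rw [← div_eq_inv_mul, le_div_iff₀ (by positivity)]
    calc Y.det * ((Real.pi / β) ^ Fintype.card ι * δ)
        = (Real.pi / β) ^ Fintype.card ι * (δ * Y.det) := by ring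
      _ ≤ (Real.pi / β) ^ Fintype.card ι * (S.det * Y.det) := by gcongr
      _ ≤ _ := pow_card_mul_det_mul_det_le_exp_trace hS.posSemidef hY.posSemidef hη
  have hrpow := Real.rpow_le_rpow hYdet.le hdet hβ.le
  rw [Real.mul_rpow (by positivity) (Real.exp_pos _).le, ← Real.exp_mul,
    mul_right_comm, div_mul_cancel₀ _ hβ.ne'] at hrpow
  rwa [Real.exp_neg, inv_mul_le_iff₀ (Real.exp_pos _), mul_comm (Real.exp _)]

lemma exists_exp_neg_trace_mul_det_rpow_le (β : ℝ) (hc : 0 < c) (hδ : 0 < δ) :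
    ∃ K : ℝ, 0 < K ∧ ∀ S Y : Matrix ι ι ℝ, S.PosDef → δ ≤ S.det → Y.PosDef →
      (Y - (2 * c) • 1).PosSemidef →
        Real.exp (-(Real.pi * (S * Y).trace)) * Y.det ^ β ≤ K := by
  rcases le_or_gt β 0 with hβ | hβ
  · refine ⟨(c ^ Fintype.card ι) ^ β, by positivity, fun S Y hS _ hY hYc => ?_⟩
    have htrace : 0 ≤ Real.pi * (S * Y).trace :=
      mul_nonneg Real.pi_pos.le (trace_mul_nonneg hS.posSemidef hY.posSemidef)
    exact (mul_le_of_le_one_left (Real.rpow_nonneg hY.det_pos.le _)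
      (Real.exp_le_one_iff.mpr (neg_nonpos.mpr htrace))).trans (det_rpow_le_of_nonpos hβ hc hYc)
  · exact ⟨(((Real.pi / β) ^ Fintype.card ι * δ)⁻¹) ^ β,
      by have := div_pos Real.pi_pos hβ; positivity,
      fun S Y hS hSδ hY _ => exp_neg_trace_mul_det_rpow_le hβ hδ hS hSδ hY⟩

end DetRpow

/-! ### Coefficients with small twisted index -/

section Conjugation

variable {ι : Type*} [Fintype ι]

lemma ratR_conj (t : Matrix ι ι ℚ) (u : Matrix ι ι ℤ) :
    ratR ((intQ u)ᵀ * t * intQ u) = (intR u)ᵀ * ratR t * intR u := by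
  ext i j
  simp [mul_apply]

lemma trace_conj_le {T : Matrix ι ι ℝ} (hT : T.PosSemidef) (u : Matrix ι ι ℝ) :
    (uᵀ * T * u).trace ≤ T.trace * ∑ j, u.col j ⬝ᵥ u.col j := by
  have hdiag (j : ι) : (uᵀ * T * u) j j = u.col j ⬝ᵥ (T *ᵥ u.col j) := by
    rw [Matrix.mul_assoc, mul_apply]
    rfl
  simp only [trace, diag, hdiag, Finset.mul_sum]
  exact Finset.sum_le_sum fun j _ => quadForm_le_trace_mul hT _

lemma conj_injective [DecidableEq ι] (u : GL ι ℤ) {t t' : Matrix ι ι ℚ}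
    (h : (intQ u.1)ᵀ * t * intQ u.1 = (intQ u.1)ᵀ * t' * intQ u.1) : t = t' := by
  have hinv : intQ u.1 * intQ u.2 = 1 := by
    rw [← intQ_mul, u.3]
    exact Matrix.map_one _ Int.cast_zero Int.cast_one
  have hinvT : (intQ u.2)ᵀ * (intQ u.1)ᵀ = 1 := by rw [← transpose_mul, hinv, transpose_one]
  have hcancel (s : Matrix ι ι ℚ) :
      (intQ u.2)ᵀ * ((intQ u.1)ᵀ * s * intQ u.1) * intQ u.2 = s := by
    rw [Matrix.mul_assoc (intQ u.1)ᵀ, ← Matrix.mul_assoc _ (intQ u.1)ᵀ, hinvT, Matrix.one_mul,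
      Matrix.mul_assoc, hinv, Matrix.mul_one]
  rw [← hcancel t, h, hcancel]

end Conjugation

section SmallCoefficients

variable {n : ℕ}

lemma isHalfIntegral_blockIndex_natCast (p : FourierIndex n) (m : ℕ) :
    IsHalfIntegral (blockIndex p.1.1 p.2 (m : ℚ)) := by
  simpa using isHalfIntegral_blockIndex p.1.2 p.2 (m : ℤ)

lemma IsHalfIntegral.exists_blockIndex_natCast {t : Matrix (Fin n ⊕ Unit) (Fin n ⊕ Unit) ℚ}
    (ht : IsHalfIntegral t) (hcorner : 0 ≤ t (.inr ()) (.inr ())) :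
    ∃ (k : ℕ) (q : FourierIndex n), t = blockIndex q.1.1 q.2 k := by
  obtain ⟨k, hk⟩ := ht.2.1 (.inr ())
  obtain ⟨q, hq⟩ := ht.exists_blockIndex
  rw [hk] at hcorner
  lift k to ℕ using by exact_mod_cast hcorner
  exact ⟨k, q, by rw [hq, hk, Int.cast_natCast]⟩

lemma diag_le_twist {s : Matrix (Fin n) (Fin n) ℚ} {r : Fin n → ℤ} {m : ℕ}
    (hT : (ratR (blockIndex s r m)).PosDef) (x : Fin n → ℝ) (i : Fin n) :
    (s i i : ℝ) ≤ 2 * twist x (blockIndex s r m) i i + 2 * m * x i ^ 2 := by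
  have hpos := (twist_posDef (fun j => 2 * x j) hT).diag_pos (i := i)
  rw [twist_blockIndex_apply] at hpos ⊢
  push_cast at hpos ⊢
  linarith [sq_nonneg (x i)]

lemma trace_ratR_blockIndex_le {s : Matrix (Fin n) (Fin n) ℚ} {r : Fin n → ℤ} {m : ℕ}
    (hT : (ratR (blockIndex s r m)).PosDef) (x : Fin n → ℝ) :
    (ratR (blockIndex s r m)).trace ≤
      2 * (twist x (blockIndex s r m)).trace + (2 * ∑ i, x i ^ 2 + 1) * m := by
  have htrace : (ratR (blockIndex s r m)).trace = ∑ i, (s i i : ℝ) + m := by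
    simp [trace, Fintype.sum_sum_type, blockIndex]
  have hdiag : ∑ i, (s i i : ℝ) ≤
      2 * (twist x (blockIndex s r m)).trace + 2 * m * ∑ i, x i ^ 2 := by
    rw [trace, Finset.mul_sum, Finset.mul_sum, ← Finset.sum_add_distrib]
    exact Finset.sum_le_sum fun i _ => diag_le_twist hT x i
  linarith

lemma trace_twist_zero_le {ι : Type*} [Fintype ι] [DecidableEq ι]
    {t : Matrix (ι ⊕ Unit) (ι ⊕ Unit) ℚ} (ht : (ratR t).PosSemidef) :
    (twist 0 t).trace ≤ (ratR t).trace := by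
  have hdiag (i : ι) : twist 0 t i i = ratR t (.inl i) (.inl i) := by
    simp [twist, twistCols, mul_apply, Fintype.sum_sum_type, one_apply]
  simp only [trace, diag_apply, Fintype.sum_sum_type, hdiag]
  exact le_add_of_nonneg_right (Finset.sum_nonneg fun _ _ => ht.diag_nonneg)

lemma intQuad_elim_single {N : ℕ} (hN : 0 < N) (s : Matrix (Fin n) (Fin n) ℚ) (r : Fin n → ℤ)
    (m : ℕ) (l : Fin n → ℤ) (i : Fin n) :
    intQuad (ratR (blockIndex s r m)) (Sum.elim (Pi.single i (N : ℤ)) fun _ => l i) =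
      N ^ 2 * twist (divVec N l) (blockIndex s r m) i i := by
  have hsingle (j : Fin n) :
      ((Pi.single i (N : ℤ) : Fin n → ℤ) j : ℝ) = if j = i then (N : ℝ) else 0 := by
    by_cases hj : j = i <;> simp [hj]
  rw [twist_blockIndex_apply]
  simp [intQuad, dotProduct, mulVec, Fintype.sum_sum_type, blockIndex, hsingle, divVec]
  field_simp
  ring

lemma conj_corner_le {N : ℕ} (hN : 0 < N) {l : Fin n → ℤ} {i : Fin n}
    {u : Matrix (Fin n ⊕ Unit) (Fin n ⊕ Unit) ℤ} {d : ℤ} (hd : d ≠ 0)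
    (hu : ∀ j, Sum.elim (Pi.single i (N : ℤ)) (fun _ => l i) j = d * u j (.inr ()))
    {p : FourierIndex n} {m : ℕ} (hT : (ratR (blockIndex p.1.1 p.2 m)).PosDef) :
    ((((intQ u)ᵀ * blockIndex p.1.1 p.2 m * intQ u) (.inr ()) (.inr ()) : ℚ) : ℝ) ≤
      N ^ 2 * (twist (divVec N l) (blockIndex p.1.1 p.2 m)).trace := by
  set t := blockIndex p.1.1 p.2 (m : ℚ)
  set k := ((((intQ u)ᵀ * t * intQ u) (.inr ()) (.inr ()) : ℚ) : ℝ)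
  have hvalue : d ^ 2 * k = N ^ 2 * twist (divVec N l) t i i := by
    rw [← intQuad_ratR_of_col t hu, intQuad_elim_single hN]
  have hdiag (j : Fin n) : 0 ≤ twist (divVec N l) t j j := (twist_posDef _ hT).diag_pos.le
  have hd_sq : (1 : ℝ) ≤ (d : ℝ) ^ 2 := by
    exact_mod_cast (Order.one_le_iff_pos.mpr (by positivity) : (1 : ℤ) ≤ d ^ 2)
  have hk : 0 ≤ k := by
    refine nonneg_of_mul_nonneg_right ?_ (zero_lt_one.trans_le hd_sq)
    rw [hvalue]
    exact mul_nonneg (by positivity) (hdiag i)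
  calc k ≤ d ^ 2 * k := le_mul_of_one_le_left hk hd_sq
    _ = N ^ 2 * twist (divVec N l) t i i := hvalue
    _ ≤ N ^ 2 * (twist (divVec N l) t).trace := by
      gcongr
      exact Finset.single_le_sum (f := fun j => twist (divVec N l) t j j) (fun j _ => hdiag j)
        (Finset.mem_univ i)

lemma trace_twist_zero_conj_le {p : FourierIndex n} {m : ℕ}
    (hT : (ratR (blockIndex p.1.1 p.2 m)).PosDef) (x : Fin n → ℝ)
    (u : Matrix (Fin n ⊕ Unit) (Fin n ⊕ Unit) ℤ) :
    (twist 0 ((intQ u)ᵀ * blockIndex p.1.1 p.2 m * intQ u)).trace ≤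
      (∑ j, (intR u).col j ⬝ᵥ (intR u).col j) * (2 * ∑ i, x i ^ 2 + 2) *
        ((twist x (blockIndex p.1.1 p.2 m)).trace + m) := by
  set t := blockIndex p.1.1 p.2 (m : ℚ)
  set U := ∑ j, (intR u).col j ⬝ᵥ (intR u).col j
  have hU : 0 ≤ U := Finset.sum_nonneg fun j _ => Finset.sum_nonneg fun i _ => mul_self_nonneg _
  have htwist : 0 ≤ (twist x t).trace := (twist_posDef x hT).posSemidef.trace_nonneg
  have hx : 0 ≤ ∑ i, x i ^ 2 := Finset.sum_nonneg fun i _ => sq_nonneg _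
  have hsemi : (ratR ((intQ u)ᵀ * t * intQ u)).PosSemidef := by
    rw [ratR_conj, ← conjTranspose_eq_transpose_of_trivial]
    exact hT.posSemidef.conjTranspose_mul_mul_same _
  calc (twist 0 ((intQ u)ᵀ * t * intQ u)).trace
      ≤ (ratR ((intQ u)ᵀ * t * intQ u)).trace := trace_twist_zero_le hsemi
    _ ≤ (ratR t).trace * U := by
      rw [ratR_conj]
      exact trace_conj_le hT.posSemidef _
    _ ≤ ((2 * ∑ i, x i ^ 2 + 2) * ((twist x t).trace + m)) * U := by
      gcongr
      refine (trace_ratR_blockIndex_le hT x).trans ?_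
      nlinarith [mul_nonneg hx htwist, (m.cast_nonneg : (0 : ℝ) ≤ m)]
    _ = _ := by ring

lemma summable_coeff_mul_exp {φ : Matrix (Fin n) (Fin n) ℂ → (Fin n → ℂ) → ℂ}
    {a : Matrix (Fin n ⊕ Unit) (Fin n ⊕ Unit) ℚ → ℂ} {m : ℕ}
    (hφ : HasFourierExpansion φ fun s r => a (blockIndex s r m)) (x : Fin n → ℝ) {δ : ℝ}
    (hδ : 0 < δ) :
    Summable fun p : FourierIndex n => ‖a (blockIndex p.1.1 p.2 m)‖ *
      Real.exp (-(2 * Real.pi * (δ * (twist x (blockIndex p.1.1 p.2 m)).trace))) := by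
  have hmem := toComplex_add_smul_one_mem (isSymm_zero (n := Fin n) (α := ℝ)) hδ
  refine (hasSum_twistTerm hφ hmem x 0).summable.norm.congr fun p => ?_
  rw [norm_twistTerm, imMat_toComplex_add_smul_one, Matrix.mul_smul, mul_one, trace_smul,
    smul_eq_mul]

lemma sum_comp_le_sum_tsum {P Q : Type*} {h : ℕ → Q → ℝ} (hsum : ∀ k, Summable (h k))
    (hnonneg : ∀ k q, 0 ≤ h k q) {F : Finset P} {k : P → ℕ} {q : P → Q}
    (hinj : Set.InjOn (fun p => (k p, q p)) F) {K : ℕ} (hK : ∀ p ∈ F, k p ≤ K) :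
    ∑ p ∈ F, h (k p) (q p) ≤ ∑ k ∈ Finset.range (K + 1), ∑' q, h k q := by
  classical
  have hsub : F.image (fun p => (k p, q p)) ⊆ Finset.range (K + 1) ×ˢ F.image q := by
    refine Finset.image_subset_iff.mpr fun p hp => Finset.mem_product.mpr ⟨?_, ?_⟩
    · exact Finset.mem_range_succ_iff.mpr (hK p hp)
    · exact Finset.mem_image_of_mem q hp
  calc ∑ p ∈ F, h (k p) (q p) = ∑ b ∈ F.image (fun p => (k p, q p)), h b.1 b.2 :=
        (Finset.sum_image (f := fun b : ℕ × Q => h b.1 b.2) hinj).symm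
    _ ≤ ∑ b ∈ Finset.range (K + 1) ×ˢ F.image q, h b.1 b.2 :=
        Finset.sum_le_sum_of_subset_of_nonneg hsub fun b _ _ => hnonneg _ _
    _ = ∑ k ∈ Finset.range (K + 1), ∑ q ∈ F.image q, h k q := Finset.sum_product _ _ _
    _ ≤ _ := Finset.sum_le_sum fun k _ => (hsum k).sum_le_tsum _ fun q _ => hnonneg k q

variable {φ : ℕ → Matrix (Fin n) (Fin n) ℂ → (Fin n → ℂ) → ℂ}
  {a : Matrix (Fin n ⊕ Unit) (Fin n ⊕ Unit) ℚ → ℂ}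

-- The last column of `u` is proportional to `(N e₀, l₀)`, at which `t` takes the value
-- `N² T₀₀` for the twisted index `T` of `t`.
lemma exists_GL_conj_eq_blockIndex (hn : 1 ≤ n) (ha : IsCoeffFamily φ a) (hsym : IsNormSymmetric a)
    (hcusp : IsCuspidal φ) {N : ℕ} (hN : 0 < N) (l : Fin n → ℤ) :
    ∃ (u : GL (Fin n ⊕ Unit) ℤ) (V : ℝ), 0 < V ∧ ∀ (m : ℕ) (p : FourierIndex n),
      a (blockIndex p.1.1 p.2 m) ≠ 0 → ∃ (k : ℕ) (q : FourierIndex n),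
        (intQ u.1)ᵀ * blockIndex p.1.1 p.2 m * intQ u.1 = blockIndex q.1.1 q.2 k ∧
        (k : ℝ) ≤ N ^ 2 * (twist (divVec N l) (blockIndex p.1.1 p.2 m)).trace ∧
        (twist 0 (blockIndex q.1.1 q.2 k)).trace ≤
          V * ((twist (divVec N l) (blockIndex p.1.1 p.2 m)).trace + m) := by
  let i₀ : Fin n := ⟨0, hn⟩
  obtain ⟨u, d, hu⟩ := exists_GL_col (Sum.elim (Pi.single i₀ (N : ℤ)) fun _ => l i₀) (.inr ())
  have hd : d ≠ 0 := by
    rintro rfl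
    simpa [hN.ne'] using hu (.inl i₀)
  set V := (∑ j, (intR u.1).col j ⬝ᵥ (intR u.1).col j) * (2 * ∑ i, divVec N l i ^ 2 + 2)
  have hV : 0 ≤ V := mul_nonneg
    (Finset.sum_nonneg fun j _ => Finset.sum_nonneg fun i _ => mul_self_nonneg _) (by positivity)
  refine ⟨u, V + 1, by positivity, fun m p hp => ?_⟩
  have hhalf := isHalfIntegral_blockIndex_natCast p m
  have hT := ha.hasPosDefSupport hsym hcusp _ hhalf hp
  have hp' : a ((intQ u.1)ᵀ * blockIndex p.1.1 p.2 m * intQ u.1) ≠ 0 := by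
    rwa [← norm_ne_zero_iff, hsym u _ hhalf, norm_ne_zero_iff]
  obtain ⟨k, q, hq⟩ := (hhalf.conj u.1).exists_blockIndex_natCast
    (ha.corner_pos_of_ne_zero hcusp (hhalf.conj u.1) hp').le
  refine ⟨k, q, hq, ?_, ?_⟩
  · have hcorner := conj_corner_le hN hd hu hT
    rwa [hq, show blockIndex q.1.1 q.2 (k : ℚ) (.inr ()) (.inr ()) = k from rfl,
      Rat.cast_natCast] at hcorner
  · have htrace := trace_twist_zero_conj_le hT (divVec N l) u.1
    rw [hq] at htrace
    have hnonneg : 0 ≤ (twist (divVec N l) (blockIndex p.1.1 p.2 m)).trace + m :=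
      add_nonneg (twist_posDef _ hT).posSemidef.trace_nonneg m.cast_nonneg
    linarith

lemma le_mul_exp_neg_mul_exp {c ε V T X : ℝ} (hc : 0 ≤ c) (hε : 0 ≤ ε) (hV : 0 < V)
    (hT : T ≤ V * X) :
    c ≤ c * Real.exp (-(2 * Real.pi * (ε / (2 * Real.pi * V) * T))) * Real.exp (ε * X) := by
  rw [mul_assoc, ← Real.exp_add]
  refine le_mul_of_one_le_right hc (Real.one_le_exp ?_)
  have hexponent : 2 * Real.pi * (ε / (2 * Real.pi * V) * T) = ε * (T / V) := by field_simp
  have hTV : T / V ≤ X := (div_le_iff₀' hV).mpr hT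
  rw [hexponent, neg_add_eq_sub, ← mul_sub]
  exact mul_nonneg hε (sub_nonneg.mpr hTV)

lemma exists_sum_small_coeff_le (hn : 1 ≤ n) (ha : IsCoeffFamily φ a) (hsym : IsNormSymmetric a)
    (hcusp : IsCuspidal φ) {N : ℕ} (hN : 0 < N) (l : Fin n → ℤ) (B : ℝ) {ε : ℝ} (hε : 0 < ε) :
    ∃ C : ℝ, ∀ (m : ℕ) (F : Finset (FourierIndex n)),
      (∀ p ∈ F, (twist (divVec N l) (blockIndex p.1.1 p.2 m)).trace ≤ B) →
        ∑ p ∈ F, ‖a (blockIndex p.1.1 p.2 m)‖ ≤ C * Real.exp (ε * m) := by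
  obtain ⟨u, V, hV, hred⟩ := exists_GL_conj_eq_blockIndex hn ha hsym hcusp hN l
  have : Nonempty (FourierIndex n) :=
    ⟨⟨0, isSymm_zero, fun _ => ⟨0, by simp⟩, fun _ _ => ⟨0, by simp⟩⟩, 0⟩
  set δ : ℝ := ε / (2 * Real.pi * V)
  let h (k : ℕ) (q : FourierIndex n) : ℝ := ‖a (blockIndex q.1.1 q.2 k)‖ *
    Real.exp (-(2 * Real.pi * (δ * (twist 0 (blockIndex q.1.1 q.2 k)).trace)))
  have hsum (k : ℕ) : Summable (h k) := summable_coeff_mul_exp (ha.1 k) 0 (by positivity)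
  have hnonneg (k : ℕ) (q : FourierIndex n) : 0 ≤ h k q := by positivity
  let K : ℕ := ⌊(N : ℝ) ^ 2 * B⌋₊
  refine ⟨(∑ k ∈ Finset.range (K + 1), ∑' q, h k q) * Real.exp (ε * B), fun m F hF => ?_⟩
  choose! k q hq hk htrace using hred m
  set F' := F.filter fun p => a (blockIndex p.1.1 p.2 m) ≠ 0
  have hF' {p : FourierIndex n} (hp : p ∈ F') := Finset.mem_filter.mp hp
  have hterm (p) (hp : p ∈ F') :
      ‖a (blockIndex p.1.1 p.2 m)‖ ≤ h (k p) (q p) * Real.exp (ε * (B + m)) := by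
    obtain ⟨hpF, hp0⟩ := hF' hp
    rw [← hsym u _ (isHalfIntegral_blockIndex_natCast p m), hq p hp0]
    refine le_mul_exp_neg_mul_exp (norm_nonneg _) hε.le hV ((htrace p hp0).trans ?_)
    gcongr
    exact hF p hpF
  have hinj : Set.InjOn (fun p => (k p, q p)) F' := by
    intro p hp p' hp' heq
    obtain ⟨hkeq : k p = k p', hqeq : q p = q p'⟩ := Prod.ext_iff.mp heq
    refine blockIndex_injective (m := m) (m' := m) (conj_injective u ?_)
    rw [hq p (hF' hp).2, hq p' (hF' hp').2, hkeq, hqeq]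
  have hK (p) (hp : p ∈ F') : k p ≤ K := Nat.le_floor <| (hk p (hF' hp).2).trans <| by
    gcongr
    exact hF p (hF' hp).1
  calc ∑ p ∈ F, ‖a (blockIndex p.1.1 p.2 m)‖
      = ∑ p ∈ F', ‖a (blockIndex p.1.1 p.2 m)‖ :=
        (Finset.sum_filter_of_ne fun p _ hp => norm_ne_zero_iff.mp hp).symm
    _ ≤ ∑ p ∈ F', h (k p) (q p) * Real.exp (ε * (B + m)) := Finset.sum_le_sum hterm
    _ = (∑ p ∈ F', h (k p) (q p)) * Real.exp (ε * (B + m)) := (Finset.sum_mul _ _ _).symm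
    _ ≤ (∑ k ∈ Finset.range (K + 1), ∑' q, h k q) * Real.exp (ε * (B + m)) := by
        gcongr
        exact sum_comp_le_sum_tsum hsum hnonneg hinj hK
    _ = _ := by rw [mul_add, Real.exp_add, mul_assoc]

end SmallCoefficients

/-! ### Bounds for the invariant norm -/

section FiberTail

variable {P : Type*} {c : P → ℂ} {ν : P → ℤ}

-- The terms are grouped by the value of `ν`, which leaves a geometric series.
lemma norm_tsum_tail_le (hc : Summable fun p => ‖c p‖) {F θ : ℝ}
    (hF : ∀ k : ℤ, ‖∑' p : {p // ν p = k}, c p‖ ≤ F) (hθ0 : 0 < θ) (hθ1 : θ < 1) (B : ℕ) :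
    ‖∑' p : {p // (B : ℤ) ≤ ν p}, c p * (θ : ℂ) ^ ν p‖ ≤ F * (θ ^ B / (1 - θ)) := by
  have hnorm (k : ℕ) : ‖(θ : ℂ) ^ (k : ℤ)‖ = θ ^ k := by
    rw [zpow_natCast, norm_pow, Complex.norm_of_nonneg hθ0.le]
  have hsummable : Summable fun p : {p // (B : ℤ) ≤ ν p} => c p * (θ : ℂ) ^ ν p := by
    refine .of_norm_bounded (hc.subtype {p | (B : ℤ) ≤ ν p}) fun ⟨p, hp⟩ => ?_
    obtain ⟨k, hk⟩ := Int.eq_ofNat_of_zero_le (B.cast_nonneg.trans hp)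
    rw [hk, norm_mul]
    exact mul_le_of_le_one_right (norm_nonneg _) (hnorm k ▸ pow_le_one₀ hθ0.le hθ1.le)
  let ρ (p : {p // (B : ℤ) ≤ ν p}) : ℕ := (ν p - B).toNat
  let fiberEquiv (j : ℕ) : {p // ν p = (B + j : ℕ)} ≃ ρ ⁻¹' {j} :=
    { toFun p := ⟨⟨p.1, by have := p.2; omega⟩, by
        simp only [Set.mem_preimage, Set.mem_singleton_iff, ρ, p.2]; omega⟩
      invFun p := ⟨p.1.1, by
        have hp : (ν p.1.1 - B).toNat = j := p.2
        have := p.1.2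
        omega⟩ }
  have hfiber (j : ℕ) : ‖∑' p : ρ ⁻¹' {j}, c p.1 * (θ : ℂ) ^ ν p.1‖ ≤ F * θ ^ B * θ ^ j := by
    have hterm (p : {p // ν p = (B + j : ℕ)}) :
        c p * (θ : ℂ) ^ ν p = c p * (θ : ℂ) ^ ((B + j : ℕ) : ℤ) := by rw [p.2]
    rw [← (fiberEquiv j).tsum_eq fun p : ρ ⁻¹' {j} => c p.1 * (θ : ℂ) ^ ν p.1,
      show ∑' p, c (fiberEquiv j p).1 * (θ : ℂ) ^ ν (fiberEquiv j p).1 =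
        ∑' p : {p // ν p = (B + j : ℕ)}, c p * (θ : ℂ) ^ ((B + j : ℕ) : ℤ) from tsum_congr hterm,
      tsum_mul_right, norm_mul, hnorm, mul_assoc, ← pow_add]
    exact mul_le_mul_of_nonneg_right (hF _) (by positivity)
  have hgeom := (hasSum_geometric_of_lt_one hθ0.le hθ1).mul_left (F * θ ^ B)
  rw [← (hsummable.hasSum.tsum_fiberwise ρ).tsum_eq, ← mul_div_assoc, div_eq_mul_inv]
  exact tsum_of_norm_bounded hgeom hfiber

lemma norm_tsum_int_fiber_le [Countable P] (hc : Summable fun p => ‖c p‖) {F : ℝ}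
    (hF : ∀ t : ℝ, ‖∑' p, c p * e (ν p * t)‖ ≤ F) (k : ℤ) :
    ‖∑' p : {p // ν p = k}, c p‖ ≤ F := by
  have hconst (p : P) : (fun _ : Unit => ν p) = (fun _ => k) ↔ ν p = k :=
    ⟨fun h => congrFun h (), fun h => by rw [h]⟩
  have hfiber := norm_tsum_fiber_le (D := Unit) hc (fun p _ => ν p)
    (fun t => by simpa using hF (t ())) fun _ => k
  have hreindex : ∑' p : {p // (fun _ : Unit => ν p) = fun _ => k}, c p =
      ∑' p : {p // ν p = k}, c p :=
    (Equiv.subtypeEquivRight hconst).tsum_eq fun p : {p // ν p = k} => c p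
  rwa [hreindex] at hfiber

end FiberTail

lemma rpow_le_rpow_abs_mul_rpow {x y R β : ℝ} (hy : 0 < y) (hyx : y ≤ x) (hx : x ≤ R * y) :
    x ^ β ≤ R ^ |β| * y ^ β := by
  have hratio : 1 ≤ x / y := (one_le_div hy).mpr hyx
  have hx0 : 0 ≤ x := hy.le.trans hyx
  rw [← div_le_iff₀ (by positivity), ← Real.div_rpow hx0 hy.le]
  calc (x / y) ^ β ≤ (x / y) ^ |β| := Real.rpow_le_rpow_of_exponent_le hratio (le_abs_self β)
    _ ≤ R ^ |β| := by
      gcongr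
      exact (div_le_iff₀ hy).mpr hx

section Shift

variable {ι : Type*} [DecidableEq ι]

lemma imMat_add_smul_one (τ : Matrix ι ι ℂ) (w : ℂ) :
    imMat (τ + w • 1) = imMat τ + w.im • 1 := by
  ext i j
  by_cases hij : i = j <;> simp [imMat, one_apply, hij]

lemma posDef_sub_smul_one {Y : Matrix ι ι ℝ} {c : ℝ} (hc : 0 < c)
    (hY : (Y - (2 * c) • 1).PosSemidef) : (Y - c • 1).PosDef := by
  have hsplit : Y - c • 1 = (Y - (2 * c) • 1) + c • 1 := by
    rw [two_mul, add_smul]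
    abel
  exact hsplit ▸ PosDef.posSemidef_add hY (PosDef.one.smul hc)

lemma add_ofReal_smul_one_mem [Fintype ι] {τ : Matrix ι ι ℂ} (hτ : τ ∈ siegelUpperHalf ι)
    (x : ℝ) : τ + (x : ℂ) • 1 ∈ siegelUpperHalf ι :=
  ⟨hτ.1.add (isSymm_one.smul _), by
    rw [imMat_add_smul_one, Complex.ofReal_im, zero_smul, add_zero]
    exact hτ.2⟩

end Shift

section Growth

variable {n : ℕ} {κ : ℤ} {m : ℕ} {φ : Matrix (Fin n) (Fin n) ℂ → (Fin n → ℂ) → ℂ}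
  {a : Matrix (Fin n ⊕ Unit) (Fin n ⊕ Unit) ℚ → ℂ} {c : ℝ}

lemma twistTerm_add_smul_one (τ : Matrix (Fin n) (Fin n) ℂ) (w : ℂ) (x y : Fin n → ℝ)
    (p : FourierIndex n) : twistTerm m a (τ + w • 1) x y p =
      twistTerm m a τ x y p * e ((twist x (blockIndex p.1.1 p.2 m)).trace * w) := by
  have htrace : (toComplex (twist x (blockIndex p.1.1 p.2 m))).trace =
      ((twist x (blockIndex p.1.1 p.2 m)).trace : ℂ) := by
    simp [trace, toComplex_apply]
  rw [twistTerm, twistTerm, Matrix.mul_add, trace_add, Matrix.mul_smul, mul_one, trace_smul,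
    htrace, smul_eq_mul, mul_assoc, ← e_add]
  ring_nf

lemma exists_norm_twistTerm_mul_le (hsupp : HasPosDefSupport a) (κ : ℤ) {N : ℕ} (hN : 0 < N)
    (hc : 0 < c) :
    ∃ K : ℝ, 0 < K ∧ ∀ (m : ℕ) (l : Fin n → ℤ), ∀ τ ∈ siegelUpperHalf (Fin n),
      (imMat τ - (2 * c) • 1).PosSemidef → ∀ (y : Fin n → ℝ) (p : FourierIndex n),
        ‖twistTerm m a τ (divVec N l) y p‖ * (imMat τ).det ^ ((κ : ℝ) / 4) ≤
          K * (‖a (blockIndex p.1.1 p.2 m)‖ * Real.exp (-(2 * Real.pi *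
            (c * (twist (divVec N l) (blockIndex p.1.1 p.2 m)).trace)))) := by
  obtain ⟨K, hK, hexp⟩ := exists_exp_neg_trace_mul_det_rpow_le (ι := Fin n) ((κ : ℝ) / 4) hc
    (show 0 < ((2 * (N : ℝ) ^ 2)⁻¹) ^ n by positivity)
  refine ⟨K, hK, fun m l τ hτ hY y p => ?_⟩
  by_cases hp : a (blockIndex p.1.1 p.2 m) = 0
  · simp [norm_twistTerm, hp]
  have hT := hsupp _ (isHalfIntegral_blockIndex_natCast p m) hp
  rw [norm_twistTerm]
  set T := twist (divVec N l) (blockIndex p.1.1 p.2 (m : ℚ))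
  have hTpos : T.PosDef := twist_posDef _ hT
  have htrace : 2 * c * T.trace ≤ (T * imMat τ).trace := by
    have hdiff := trace_mul_nonneg hTpos.posSemidef hY
    rw [Matrix.mul_sub, trace_sub, Matrix.mul_smul, mul_one, trace_smul, smul_eq_mul] at hdiff
    linarith
  have hsplit : Real.exp (-(2 * Real.pi * (T * imMat τ).trace)) ≤
      Real.exp (-(Real.pi * (T * imMat τ).trace)) * Real.exp (-(2 * Real.pi * (c * T.trace))) := by
    rw [← Real.exp_add, Real.exp_le_exp]
    nlinarith [Real.pi_pos]
  have hdet : 0 ≤ (imMat τ).det ^ ((κ : ℝ) / 4) := Real.rpow_nonneg hτ.2.det_pos.le _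
  calc _ ≤ ‖a (blockIndex p.1.1 p.2 m)‖ * (Real.exp (-(Real.pi * (T * imMat τ).trace)) *
        Real.exp (-(2 * Real.pi * (c * T.trace)))) * (imMat τ).det ^ ((κ : ℝ) / 4) := by gcongr
    _ = (Real.exp (-(Real.pi * (T * imMat τ).trace)) * (imMat τ).det ^ ((κ : ℝ) / 4)) *
        (‖a (blockIndex p.1.1 p.2 m)‖ * Real.exp (-(2 * Real.pi * (c * T.trace)))) := by ring
    _ ≤ _ := by
      gcongr
      exact hexp T (imMat τ) hTpos (pow_inv_le_det_twist hN l m p hT) hτ.2 hY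

lemma exists_norm_twistTerm_mul_le_coeff (hsupp : HasPosDefSupport a) (κ : ℤ) {N : ℕ}
    (hN : 0 < N) (hc : 0 < c) :
    ∃ K : ℝ, 0 < K ∧ ∀ (m : ℕ) (l : Fin n → ℤ), ∀ τ ∈ siegelUpperHalf (Fin n),
      (imMat τ - (2 * c) • 1).PosSemidef → ∀ (y : Fin n → ℝ) (p : FourierIndex n),
        ‖twistTerm m a τ (divVec N l) y p‖ * (imMat τ).det ^ ((κ : ℝ) / 4) ≤
          K * ‖a (blockIndex p.1.1 p.2 m)‖ := by
  obtain ⟨K, hK, hterm⟩ := exists_norm_twistTerm_mul_le hsupp κ hN hc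
  refine ⟨K, hK, fun m l τ hτ hY y p => (hterm m l τ hτ hY y p).trans ?_⟩
  by_cases hp : a (blockIndex p.1.1 p.2 m) = 0
  · simp [hp]
  have hT := hsupp _ (isHalfIntegral_blockIndex_natCast p m) hp
  have htrace := (twist_posDef (divVec N l) hT).posSemidef.trace_nonneg
  gcongr
  refine mul_le_of_le_one_right (norm_nonneg _) (Real.exp_le_one_iff.mpr ?_)
  have := Real.pi_pos
  exact neg_nonpos.mpr (by positivity)

lemma exists_jacNorm_le (hφ : HasFourierExpansion φ fun s r => a (blockIndex s r m))
    (hsupp : HasPosDefSupport a) (κ : ℤ) {N : ℕ} (hN : 0 < N) (hc : 0 < c) (l : Fin n → ℤ) :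
    ∃ M : ℝ, ∀ τ ∈ siegelUpperHalf (Fin n), (imMat τ - (2 * c) • 1).PosSemidef →
      ∀ y : Fin n → ℝ, jacNorm κ m φ τ (divVec N l) y ≤ M := by
  obtain ⟨K, -, hterm⟩ := exists_norm_twistTerm_mul_le hsupp κ hN hc
  refine ⟨K * ∑' p : FourierIndex n, ‖a (blockIndex p.1.1 p.2 m)‖ * Real.exp (-(2 * Real.pi *
    (c * (twist (divVec N l) (blockIndex p.1.1 p.2 m)).trace))), fun τ hτ hY y => ?_⟩
  have hsum := (hasSum_twistTerm hφ hτ (divVec N l) y).summable.norm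
  have hdet : 0 ≤ (imMat τ).det ^ ((κ : ℝ) / 4) := Real.rpow_nonneg hτ.2.det_pos.le _
  rw [jacNorm_eq_norm_tsum hφ hτ, ← tsum_mul_left]
  calc _ ≤ (∑' p, ‖twistTerm m a τ (divVec N l) y p‖) * (imMat τ).det ^ ((κ : ℝ) / 4) := by
        gcongr
        exact norm_tsum_le_tsum_norm hsum
    _ = ∑' p, ‖twistTerm m a τ (divVec N l) y p‖ * (imMat τ).det ^ ((κ : ℝ) / 4) :=
        tsum_mul_right.symm
    _ ≤ _ := (hsum.mul_right _).tsum_le_tsum (fun p => hterm m l τ hτ hY y p)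
        ((summable_coeff_mul_exp hφ (divVec N l) hc).mul_left K)

-- The fiber sums are Fourier coefficients of `t ↦ φ(τ + d t, x (τ + d t) + y)`.
lemma norm_tsum_twistTerm_fiber_mul_le
    (hφ : HasFourierExpansion φ fun s r => a (blockIndex s r m)) {x y : Fin n → ℝ} {d : ℝ}
    {ν : FourierIndex n → ℤ}
    (hν : ∀ p, (ν p : ℝ) = d * (twist x (blockIndex p.1.1 p.2 m)).trace) {M : ℝ}
    (hM : ∀ τ ∈ siegelUpperHalf (Fin n), jacNorm κ m φ τ x y ≤ M)
    {τ : Matrix (Fin n) (Fin n) ℂ} (hτ : τ ∈ siegelUpperHalf (Fin n)) (k : ℤ) :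
    ‖∑' p : {p // ν p = k}, twistTerm m a τ x y p‖ * (imMat τ).det ^ ((κ : ℝ) / 4) ≤ M := by
  have hdet : 0 < (imMat τ).det ^ ((κ : ℝ) / 4) := Real.rpow_pos_of_pos hτ.2.det_pos _
  rw [← le_div_iff₀ hdet]
  refine norm_tsum_int_fiber_le (hasSum_twistTerm hφ hτ x y).summable.norm (fun t => ?_) k
  have hshift (p : FourierIndex n) : twistTerm m a τ x y p * e (ν p * t) =
      twistTerm m a (τ + ((d * t : ℝ) : ℂ) • 1) x y p := by
    have hνp : (ν p : ℂ) = d * ((twist x (blockIndex p.1.1 p.2 m)).trace : ℂ) := by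
      exact_mod_cast congrArg Complex.ofReal (hν p)
    rw [twistTerm_add_smul_one, hνp, Complex.ofReal_mul]
    ring_nf
  have hmem := add_ofReal_smul_one_mem hτ (d * t)
  have hbound := hM _ hmem
  rw [jacNorm_eq_norm_tsum hφ hmem, imMat_add_smul_one, Complex.ofReal_im, zero_smul,
    add_zero] at hbound
  simpa only [hshift, le_div_iff₀ hdet] using hbound

-- Moving `τ` up by `ic` from a point of the upper half space multiplies the terms of the
-- expansion by `θ ^ ν`.
lemma norm_tsum_twistTerm_tail_mul_le
    (hφ : HasFourierExpansion φ fun s r => a (blockIndex s r m)) {x y : Fin n → ℝ} {d : ℝ}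
    (hd : 0 < d) {ν : FourierIndex n → ℤ}
    (hν : ∀ p, (ν p : ℝ) = d * (twist x (blockIndex p.1.1 p.2 m)).trace) {M : ℝ}
    (hM : ∀ τ ∈ siegelUpperHalf (Fin n), jacNorm κ m φ τ x y ≤ M)
    {τ : Matrix (Fin n) (Fin n) ℂ} (hτ : τ ∈ siegelUpperHalf (Fin n)) (hc : 0 < c)
    (hY : (imMat τ - (2 * c) • 1).PosSemidef) {θ : ℝ}
    (hθ : θ = Real.exp (-(2 * Real.pi * (c / d)))) (B : ℕ) :
    ‖∑' p : {p // (B : ℤ) ≤ ν p}, twistTerm m a τ x y p‖ * (imMat τ).det ^ ((κ : ℝ) / 4) ≤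
      M * (((2 : ℝ) ^ n) ^ |(κ : ℝ) / 4| * (θ ^ B / (1 - θ))) := by
  set τ₀ := τ + (-(c * Complex.I)) • 1 with hτ₀_def
  have him : imMat τ₀ = imMat τ - c • 1 := by
    rw [hτ₀_def, imMat_add_smul_one, sub_eq_add_neg]
    simp
  have hτ₀ : τ₀ ∈ siegelUpperHalf (Fin n) :=
    ⟨hτ.1.add (isSymm_one.smul _), him ▸ posDef_sub_smul_one hc hY⟩
  have hterm (p : FourierIndex n) :
      twistTerm m a τ x y p = twistTerm m a τ₀ x y p * (θ : ℂ) ^ ν p := by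
    have hνp : (ν p : ℂ) = d * ((twist x (blockIndex p.1.1 p.2 m)).trace : ℂ) := by
      exact_mod_cast congrArg Complex.ofReal (hν p)
    have hdC : (d : ℂ) ≠ 0 := Complex.ofReal_ne_zero.mpr hd.ne'
    rw [show τ = τ₀ + (c * Complex.I) • 1 by simp [hτ₀_def], twistTerm_add_smul_one, hθ,
      Complex.ofReal_exp, ← Complex.exp_int_mul, hνp, e]
    congr 2
    push_cast
    field_simp
    rw [Complex.I_sq]
    ring
  set D := (imMat τ).det ^ ((κ : ℝ) / 4)
  set D₀ := (imMat τ₀).det ^ ((κ : ℝ) / 4)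
  set R : ℝ := ((2 : ℝ) ^ n) ^ |(κ : ℝ) / 4|
  have hD₀ : 0 < D₀ := Real.rpow_pos_of_pos hτ₀.2.det_pos _
  have hD : D ≤ R * D₀ := by
    obtain ⟨-, hle, hge⟩ := det_sub_smul_one_bounds hc hY
    rw [← him] at hle hge
    rw [Fintype.card_fin] at hge
    exact rpow_le_rpow_abs_mul_rpow hτ₀.2.det_pos hle hge
  have hθ0 : 0 < θ := hθ ▸ Real.exp_pos _
  have hθ1 : θ < 1 := by
    rw [hθ, Real.exp_lt_one_iff]
    exact neg_lt_zero.mpr (by positivity)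
  have htail := norm_tsum_tail_le (hasSum_twistTerm hφ hτ₀ x y).summable.norm
    (fun k => (le_div_iff₀ hD₀).mpr (norm_tsum_twistTerm_fiber_mul_le hφ hν hM hτ₀ k)) hθ0 hθ1 B
  simp only [← hterm] at htail
  calc _ ≤ M / D₀ * (θ ^ B / (1 - θ)) * (R * D₀) := mul_le_mul htail hD
        (Real.rpow_nonneg hτ.2.det_pos.le _) ((norm_nonneg _).trans htail)
    _ = _ := by field_simp

lemma norm_tsum_subtype_mul_le {P : Type*} {f : P → ℂ} (hf : Summable f) {b : P → ℝ} {D K Λ : ℝ}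
    (hD : 0 ≤ D) (hK : 0 ≤ K) (hle : ∀ p, ‖f p‖ * D ≤ K * b p) {s : Set P}
    (hΛ : ∀ F : Finset P, (∀ p ∈ F, p ∈ s) → ∑ p ∈ F, b p ≤ Λ) :
    ‖∑' p : s, f p‖ * D ≤ K * Λ := by
  have hsum : Summable fun p : s => ‖f p‖ := (hf.subtype s).norm
  calc ‖∑' p : s, f p‖ * D ≤ (∑' p : s, ‖f p‖) * D := by
        gcongr
        exact norm_tsum_le_tsum_norm hsum
    _ = ∑' p : s, ‖f p‖ * D := tsum_mul_right.symm
    _ ≤ K * Λ := (hsum.mul_right D).tsum_le_of_sum_le fun F => by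
        calc ∑ p ∈ F, ‖f p‖ * D ≤ ∑ p ∈ F, K * b p := Finset.sum_le_sum fun p _ => hle p
          _ = K * ∑ p ∈ F.map (.subtype _), b p := by rw [Finset.sum_map, Finset.mul_sum]; rfl
          _ ≤ K * Λ := by
            gcongr
            exact hΛ _ fun p hp => Finset.property_of_mem_map_subtype F hp

lemma exists_jacNorm_le_half (hsupp : HasPosDefSupport a) (κ : ℤ) {N : ℕ} (hN : 0 < N)
    (hc : 0 < c) :
    ∃ K B : ℝ, ∀ (m : ℕ) (φ : Matrix (Fin n) (Fin n) ℂ → (Fin n → ℂ) → ℂ),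
      (HasFourierExpansion φ fun s r => a (blockIndex s r m)) →
      ∀ (l : Fin n → ℤ) (y : Fin n → ℝ) (M Λ : ℝ),
      (∀ τ ∈ siegelUpperHalf (Fin n), jacNorm κ m φ τ (divVec N l) y ≤ M) →
      (∀ F : Finset (FourierIndex n),
        (∀ p ∈ F, (twist (divVec N l) (blockIndex p.1.1 p.2 m)).trace ≤ B) →
          ∑ p ∈ F, ‖a (blockIndex p.1.1 p.2 m)‖ ≤ Λ) →
      ∀ τ ∈ siegelUpperHalf (Fin n), (imMat τ - (2 * c) • 1).PosSemidef →
        jacNorm κ m φ τ (divVec N l) y ≤ M / 2 + K * Λ := by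
  have hN2 : (0 : ℝ) < N ^ 2 := by positivity
  obtain ⟨K, hK, hcoeff⟩ := exists_norm_twistTerm_mul_le_coeff hsupp κ hN hc
  obtain ⟨θ, hθ⟩ : ∃ θ : ℝ, θ = Real.exp (-(2 * Real.pi * (c / N ^ 2))) := ⟨_, rfl⟩
  have hθ1 : 0 < 1 - θ := by
    rw [sub_pos, hθ, Real.exp_lt_one_iff]
    exact neg_lt_zero.mpr (by positivity)
  set R : ℝ := ((2 : ℝ) ^ n) ^ |(κ : ℝ) / 4|
  obtain ⟨B, hB⟩ := exists_pow_lt_of_lt_one (show 0 < (1 - θ) / (2 * R) by positivity)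
    (sub_pos.mp hθ1)
  have hhalf : R * (θ ^ B / (1 - θ)) ≤ 1 / 2 := by
    rw [lt_div_iff₀ (by positivity)] at hB
    rw [← mul_div_assoc, div_le_iff₀ hθ1]
    linarith
  refine ⟨K, B / N ^ 2, fun m φ hφ l y M Λ hM hΛ τ hτ hY => ?_⟩
  choose ν hν using exists_int_eq_trace_twist hN l m
  have hsum := (hasSum_twistTerm hφ hτ (divVec N l) y).summable
  have hdet : 0 ≤ (imMat τ).det ^ ((κ : ℝ) / 4) := Real.rpow_nonneg hτ.2.det_pos.le _
  have hM0 : 0 ≤ M := (jacNorm_eq_norm_tsum hφ hτ (divVec N l) y ▸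
    mul_nonneg (norm_nonneg _) hdet).trans (hM τ hτ)
  have htail := norm_tsum_twistTerm_tail_mul_le hφ hN2 hν hM hτ hc hY hθ B
  have hlow := norm_tsum_subtype_mul_le hsum hdet hK.le (hcoeff m l τ hτ hY y)
    (s := {p | (B : ℤ) ≤ ν p}ᶜ) fun F hF => hΛ F fun p hp => by
      rw [le_div_iff₀' hN2, ← hν p]
      exact_mod_cast (not_le.mp (show ¬(B : ℤ) ≤ ν p from hF p hp)).le
  rw [jacNorm_eq_norm_tsum hφ hτ, ← hsum.tsum_subtype_add_tsum_subtype_compl {p | (B : ℤ) ≤ ν p}]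
  calc _ ≤ _ := mul_le_mul_of_nonneg_right (norm_add_le _ _) hdet
    _ ≤ M * (R * (θ ^ B / (1 - θ))) + K * Λ := by
      rw [add_mul]
      exact add_le_add htail hlow
    _ ≤ M * (1 / 2) + K * Λ := by gcongr
    _ = M / 2 + K * Λ := by ring

end Growth

/-! ### Reduction to finitely many torsion points -/

section TorsionCoordinates

variable {ι : Type*}

lemma divVec_emod {N : ℕ} (hN : 0 < N) (l : ι → ℤ) :
    divVec N l = divVec N (fun i => l i % N) + fun i => ((l i / N : ℤ) : ℝ) := by
  have hN0 : (N : ℝ) ≠ 0 := Nat.cast_ne_zero.mpr hN.ne'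
  funext i
  have hdivision : (l i : ℝ) = (l i % N : ℤ) + N * (l i / N : ℤ) := by
    exact_mod_cast (Int.emod_add_mul_ediv (l i) N).symm
  simp only [divVec, Pi.add_apply]
  rw [hdivision]
  field_simp

lemma divVec_add (N : ℕ) (l μ : ι → ℤ) : divVec N (l + μ) = divVec N l + divVec N μ := by
  ext i
  simp [divVec, add_div]

lemma intR_transpose_mulVec_divVec [Fintype ι] (A : Matrix ι ι ℤ) (N : ℕ) (l : ι → ℤ) :
    (intR A)ᵀ *ᵥ divVec N l = divVec N (Aᵀ *ᵥ l) := by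
  ext i
  simp [mulVec, dotProduct, divVec, Finset.sum_div, mul_div_assoc]

end TorsionCoordinates

lemma exists_symplectic_transpose_mulVec_eq {ι : Type*} [Fintype ι] [DecidableEq ι]
    {γ : Matrix (ι ⊕ ι) (ι ⊕ ι) ℤ} (hγ : γ ∈ symplecticGroup ι ℤ) (l μ : ι → ℤ) :
    ∃ x y : ι → ℤ, γ.toBlocks₁₁ᵀ *ᵥ x + γ.toBlocks₂₁ᵀ *ᵥ y = l ∧
      γ.toBlocks₁₂ᵀ *ᵥ x + γ.toBlocks₂₂ᵀ *ᵥ y = μ := by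
  have hdet : IsUnit γᵀ.det := by
    rw [det_transpose]
    exact SymplecticGroup.symplectic_det hγ
  obtain ⟨v, hv⟩ := mulVec_surjective_iff_isUnit.mpr ((isUnit_iff_isUnit_det _).mpr hdet)
    (Sum.elim l μ)
  refine ⟨v ∘ .inl, v ∘ .inr, ?_, ?_⟩ <;> ext i
  · simpa [mulVec, dotProduct, toBlocks₁₁, toBlocks₂₁] using congrFun hv (.inl i)
  · simpa [mulVec, dotProduct, toBlocks₁₂, toBlocks₂₂] using congrFun hv (.inr i)

lemma exists_fin_eq_emod {N : ℕ} (hN : 0 < N) (k : ℤ) : ∃ r : Fin N, ((r : ℕ) : ℤ) = k % N := by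
  have hlt := Int.emod_lt_of_pos k (Nat.cast_pos.mpr hN : (0 : ℤ) < N)
  have hnonneg := Int.emod_nonneg k (Nat.cast_ne_zero.mpr hN.ne' : (N : ℤ) ≠ 0)
  exact ⟨⟨(k % N).toNat, by omega⟩, by simp [hnonneg]⟩

section Reduction

variable {n : ℕ} {κ : ℤ}

lemma jacNorm_le_of_forall_reduced {c : ℝ}
    (hred : ∀ τ ∈ siegelUpperHalf (Fin n), ∃ γ ∈ symplecticGroup (Fin n) ℤ,
      (imMat (smulSiegel γ τ) - c • 1).PosSemidef)
    {m : ℕ} {ψ : Matrix (Fin n) (Fin n) ℂ → (Fin n → ℂ) → ℂ} (hψ : IsJacobiForm n κ m ψ)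
    {N : ℕ} (hN : 0 < N) {G : ℝ}
    (hG : ∀ τ ∈ siegelUpperHalf (Fin n), (imMat τ - c • 1).PosSemidef →
      ∀ l μ : Fin n → Fin N,
        jacNorm κ m ψ τ (divVec N fun i => (l i : ℤ)) (divVec N fun i => (μ i : ℤ)) ≤ G)
    {τ : Matrix (Fin n) (Fin n) ℂ} (hτ : τ ∈ siegelUpperHalf (Fin n)) (l μ : Fin n → ℤ) :
    jacNorm κ m ψ τ (divVec N l) (divVec N μ) ≤ G := by
  obtain ⟨γ, hγ, hY⟩ := hred τ hτ
  obtain ⟨x, y, hl, hμ⟩ := exists_symplectic_transpose_mulVec_eq hγ l μ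
  have hmove : jacNorm κ m ψ (smulSiegel γ τ) (divVec N x) (divVec N y) =
      jacNorm κ m ψ τ (divVec N l) (divVec N μ) := by
    rw [jacNorm_smulSiegel hψ hγ hτ]
    simp only [intR_transpose_mulVec_divVec, ← divVec_add, hl, hμ]
  choose r hr using exists_fin_eq_emod hN
  have hreduced := hG _ (smulSiegel_mem hγ hτ) hY (fun i => r (x i)) fun i => r (y i)
  simp only [hr] at hreduced
  rwa [← hmove, divVec_emod hN x, divVec_emod hN y, jacNorm_add_int hψ (smulSiegel_mem hγ hτ)]

-- The supremum `M` of all torsion values satisfies `M ≤ M / 2 + K C exp (ε m)`.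
theorem exists_jacNorm_le_exp {φ : ℕ → Matrix (Fin n) (Fin n) ℂ → (Fin n → ℂ) → ℂ}
    {a : Matrix (Fin n ⊕ Unit) (Fin n ⊕ Unit) ℚ → ℂ} (hn : 1 ≤ n)
    (hφ : ∀ m, IsJacobiForm n κ m (φ m)) (ha : IsCoeffFamily φ a) (hsym : IsNormSymmetric a)
    (hcusp : IsCuspidal φ) {N : ℕ} (hN : 0 < N) {ε : ℝ} (hε : 0 < ε) :
    ∃ C : ℝ, ∀ m : ℕ, ∀ τ ∈ siegelUpperHalf (Fin n), ∀ l μ : Fin n → ℤ,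
      jacNorm κ m (φ m) τ (divVec N l) (divVec N μ) ≤ C * Real.exp (ε * m) := by
  have hsupp := ha.hasPosDefSupport hsym hcusp
  obtain ⟨c', hc', hred⟩ := exists_smulSiegel_imMat_ge hn
  obtain ⟨c, hc, rfl⟩ : ∃ c : ℝ, 0 < c ∧ 2 * c = c' := ⟨c' / 2, by positivity, by ring⟩
  obtain ⟨K, B, hhalf⟩ := exists_jacNorm_le_half hsupp κ hN hc
  choose C hC using fun l : Fin n → ℤ => exists_sum_small_coeff_le hn ha hsym hcusp hN l B hε
  obtain ⟨C', hC'⟩ := Finite.exists_le fun l : Fin n → Fin N => C fun i => (l i : ℤ)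
  refine ⟨2 * (K * C'), fun m τ hτ l μ => ?_⟩
  set V : Set ℝ := {v | ∃ τ ∈ siegelUpperHalf (Fin n), ∃ l μ : Fin n → ℤ,
    v = jacNorm κ m (φ m) τ (divVec N l) (divVec N μ)}
  have hbdd : BddAbove V := by
    choose M hM using exists_jacNorm_le (ha.1 m) hsupp κ hN hc
    obtain ⟨M', hM'⟩ := Finite.exists_le fun l : Fin n → Fin N => M fun i => (l i : ℤ)
    refine ⟨M', ?_⟩
    rintro _ ⟨τ, hτ, l, μ, rfl⟩
    exact jacNorm_le_of_forall_reduced hred (hφ m) hN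
      (fun τ hτ hY l _ => (hM _ τ hτ hY _).trans (hM' l)) hτ l μ
  have hle {τ} (hτ : τ ∈ siegelUpperHalf (Fin n)) (l μ : Fin n → ℤ) :
      jacNorm κ m (φ m) τ (divVec N l) (divVec N μ) ≤ sSup V :=
    le_csSup hbdd ⟨τ, hτ, l, μ, rfl⟩
  have hsup : sSup V ≤ sSup V / 2 + K * (C' * Real.exp (ε * m)) := by
    refine csSup_le ⟨_, τ, hτ, l, μ, rfl⟩ ?_
    rintro _ ⟨τ, hτ, l, μ, rfl⟩
    refine jacNorm_le_of_forall_reduced hred (hφ m) hN (fun τ hτ hY l μ => ?_) hτ l μ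
    refine hhalf m _ (ha.1 m) _ _ _ _ (fun τ hτ => hle hτ _ _) (fun F hF => ?_) τ hτ hY
    exact (hC _ m F hF).trans (mul_le_mul_of_nonneg_right (hC' l) (Real.exp_pos _).le)
  refine (hle hτ l μ).trans ?_
  linarith

end Reduction

/-! ### Convergence at torsion points -/

lemma summable_norm_mul_pow_of_growth {b : ℕ → ℂ} {A : ℝ}
    (hb : ∀ ε : ℝ, 0 < ε → ∃ C : ℝ, ∀ m : ℕ, ‖b m‖ ≤ C * Real.exp (A + ε) ^ m) {r : ℝ}
    (hr0 : 0 ≤ r) (hr : r < Real.exp (-A)) : Summable fun m : ℕ => ‖b m‖ * r ^ m := by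
  obtain ⟨ρ, hrρ, hρ⟩ := exists_between hr
  have hρ0 : 0 < ρ := hr0.trans_lt hrρ
  have hε : 0 < -A - Real.log ρ := by
    have := (Real.log_lt_iff_lt_exp hρ0).mpr hρ
    linarith
  obtain ⟨C, hC⟩ := hb _ hε
  have hrate : Real.exp (A + (-A - Real.log ρ)) = ρ⁻¹ := by
    rw [show A + (-A - Real.log ρ) = -Real.log ρ by ring, Real.exp_neg, Real.exp_log hρ0]
  simp only [hrate] at hC
  have hratio : r / ρ < 1 := (div_lt_one hρ0).mpr hrρ
  refine .of_nonneg_of_le (fun m => by positivity) (fun m => ?_)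
    ((summable_geometric_of_lt_one (by positivity) hratio).mul_left C)
  calc ‖b m‖ * r ^ m ≤ C * ρ⁻¹ ^ m * r ^ m := by
        gcongr
        exact hC m
    _ = C * (r / ρ) ^ m := by rw [mul_assoc, ← mul_pow, div_eq_inv_mul]

lemma differentiableOn_tsum_mul_pow {b : ℕ → ℂ} {R : ℝ}
    (hb : ∀ r : ℝ, 0 ≤ r → r < R → Summable fun m : ℕ => ‖b m‖ * r ^ m) :
    DifferentiableOn ℂ (fun q : ℂ => ∑' m : ℕ, b m * q ^ m) {q : ℂ | ‖q‖ < R} := by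
  intro q hq
  obtain ⟨r, hqr, hr⟩ := exists_between (show ‖q‖ < R from hq)
  have hopen : IsOpen {q : ℂ | ‖q‖ < r} := isOpen_lt continuous_norm continuous_const
  have hterm (m : ℕ) (w : ℂ) (hw : w ∈ {q : ℂ | ‖q‖ < r}) : ‖b m * w ^ m‖ ≤ ‖b m‖ * r ^ m := by
    rw [norm_mul, norm_pow]
    gcongr
    exact le_of_lt hw
  exact ((Complex.differentiableOn_tsum_of_summable_norm
    (hb r ((norm_nonneg q).trans hqr.le) hr) (fun m => by fun_prop) hopen
    hterm).differentiableAt (hopen.mem_nhds hqr)).differentiableWithinAt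

section TorsionPoint

variable {n : ℕ}

lemma torsionC_latticePoint {τ : Matrix (Fin n) (Fin n) ℂ} (hτ : τ ∈ siegelUpperHalf (Fin n))
    (x y : Fin n → ℝ) : torsionC τ (latticePoint τ x y) = x ⬝ᵥ (imMat τ *ᵥ x) := by
  have him : (fun i => (latticePoint τ x y i).im) = imMat τ *ᵥ x := by
    ext i
    simp [latticePoint, realC, mulVec, dotProduct, imMat, Complex.im_sum]
  rw [torsionC, him, mulVec_mulVec, nonsing_inv_mul _ hτ.2.det_pos.ne'.isUnit, one_mulVec,
    dotProduct_comm]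

lemma jacNorm_eq_norm_mul_exp_torsionC {κ : ℤ} {m : ℕ}
    {ψ : Matrix (Fin n) (Fin n) ℂ → (Fin n → ℂ) → ℂ} {τ : Matrix (Fin n) (Fin n) ℂ}
    (hτ : τ ∈ siegelUpperHalf (Fin n)) (x y : Fin n → ℝ) :
    jacNorm κ m ψ τ x y = ‖ψ τ (latticePoint τ x y)‖ *
      Real.exp (-(2 * Real.pi * (m * torsionC τ (latticePoint τ x y)))) *
        (imMat τ).det ^ ((κ : ℝ) / 4) := by
  rw [torsionC_latticePoint hτ, jacNorm]

lemma exists_norm_le_of_isTorsionPoint {κ : ℤ}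
    {φ : ℕ → Matrix (Fin n) (Fin n) ℂ → (Fin n → ℂ) → ℂ} (hn : 1 ≤ n)
    (hf : IsSymmetricFJ n κ φ) (hcusp : IsCuspidal φ) {N : ℕ} (hN : 0 < N)
    {τ : Matrix (Fin n) (Fin n) ℂ} {z : Fin n → ℂ} (hz : IsTorsionPoint N τ z) {ε : ℝ}
    (hε : 0 < ε) :
    ∃ C : ℝ, ∀ m : ℕ, ‖φ m τ z‖ ≤ C * Real.exp (2 * Real.pi * torsionC τ z + ε) ^ m := by
  obtain ⟨a, ha, hsym⟩ := hf.exists_coeff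
  obtain ⟨C, hC⟩ := exists_jacNorm_le_exp hn hf.jacobi ha hsym hcusp hN hε
  obtain ⟨hτ, l, μ, hlμ⟩ := hz
  have hpoint : latticePoint τ (divVec N l) (divVec N μ) = z := by
    rw [hlμ, latticePoint]
    congr 2 <;> (ext i; simp [realC, divVec])
  have hD : 0 < (imMat τ).det ^ ((κ : ℝ) / 4) := Real.rpow_pos_of_pos hτ.2.det_pos _
  refine ⟨C / (imMat τ).det ^ ((κ : ℝ) / 4), fun m => ?_⟩
  have hbound := hC m τ hτ l μ
  rw [jacNorm_eq_norm_mul_exp_torsionC hτ, hpoint, ← le_div_iff₀ hD, Real.exp_neg,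
    ← div_eq_mul_inv, div_le_iff₀ (Real.exp_pos _)] at hbound
  calc ‖φ m τ z‖ ≤ C * Real.exp (ε * m) / (imMat τ).det ^ ((κ : ℝ) / 4) *
        Real.exp (2 * Real.pi * (m * torsionC τ z)) := hbound
    _ = _ := by
      rw [← Real.exp_nat_mul, show (m : ℝ) * (2 * Real.pi * torsionC τ z + ε) =
        ε * m + 2 * Real.pi * (m * torsionC τ z) by ring, Real.exp_add]
      ring

-- Positivity of `Im τ` on the vector `(-Y⁻¹ v, 1)`, where `Y = Im τ₁` and `v = Im z`.
lemma torsionC_lt_im {τ : Matrix (Fin n ⊕ Unit) (Fin n ⊕ Unit) ℂ}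
    (hτ : τ ∈ siegelUpperHalf (Fin n ⊕ Unit)) :
    torsionC τ.toBlocks₁₁ (fun i => τ (Sum.inl i) (Sum.inr ())) <
      (τ (Sum.inr ()) (Sum.inr ())).im := by
  set v : Fin n → ℝ := fun i => (τ (Sum.inl i) (Sum.inr ())).im with hv
  set Y : Matrix (Fin n) (Fin n) ℝ := imMat τ.toBlocks₁₁ with hY
  have hYpos : Y.PosDef := hτ.2.submatrix Sum.inl_injective
  set w : Fin n → ℝ := Y⁻¹ *ᵥ v with hw
  have hYw : Y *ᵥ w = v := by
    rw [hw, mulVec_mulVec, mul_nonsing_inv _ hYpos.det_pos.ne'.isUnit, one_mulVec]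
  have hne : Sum.elim (-w) (fun _ : Unit => (1 : ℝ)) ≠ 0 := fun h => by
    simpa using congrFun h (.inr ())
  have hpos := hτ.2.dotProduct_mulVec_pos hne
  have hmul : imMat τ *ᵥ Sum.elim (-w) (fun _ : Unit => (1 : ℝ)) =
      Sum.elim (-(Y *ᵥ w) + v) fun _ => -(v ⬝ᵥ w) + (τ (Sum.inr ()) (Sum.inr ())).im := by
    ext (i | i)
    · simp [mulVec, dotProduct, imMat, hY, hv, toBlocks₁₁]
    · have hsymm (j : Fin n) : τ (.inr ()) (.inl j) = τ (.inl j) (.inr ()) := hτ.1.apply _ _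
      simp [mulVec, dotProduct, imMat, hv, hsymm]
  rw [hmul, hYw] at hpos
  simp only [neg_add_cancel, star_trivial, dotProduct, Fintype.sum_sum_type, Sum.elim_inl,
    Sum.elim_inr] at hpos
  rw [show torsionC τ.toBlocks₁₁ (fun i => τ (Sum.inl i) (Sum.inr ())) = v ⬝ᵥ w from rfl]
  simpa [dotProduct] using hpos

end TorsionPoint

end FJ

theorem mainTheorem3 (n : ℕ) (hn : 1 ≤ n) (κ : ℤ)
    (φ : ℕ → Matrix (Fin n) (Fin n) ℂ → (Fin n → ℂ) → ℂ)
    (hf : FJ.IsSymmetricFJ n κ φ) (hcusp : FJ.IsCuspidal φ) :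
    (∀ (N : ℕ), 0 < N → ∀ (τ₁ : Matrix (Fin n) (Fin n) ℂ) (z : Fin n → ℂ),
      FJ.IsTorsionPoint N τ₁ z →
        (∀ q : ℂ, ‖q‖ < Real.exp (-(2 * Real.pi * FJ.torsionC τ₁ z)) →
          Summable (fun m : ℕ => ‖φ m τ₁ z * q ^ m‖)) ∧
        DifferentiableOn ℂ (fun q : ℂ => ∑' m : ℕ, φ m τ₁ z * q ^ m)
          {q : ℂ | ‖q‖ < Real.exp (-(2 * Real.pi * FJ.torsionC τ₁ z))}) ∧
    (∀ τ ∈ FJ.siegelUpperHalf (Fin n ⊕ Unit),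
      (∃ N : ℕ, 0 < N ∧
        FJ.IsTorsionPoint N τ.toBlocks₁₁ (fun i => τ (Sum.inl i) (Sum.inr ()))) →
      Summable (fun m : ℕ =>
        ‖φ m τ.toBlocks₁₁ (fun i => τ (Sum.inl i) (Sum.inr ())) *
          FJ.e (τ (Sum.inr ()) (Sum.inr ())) ^ m‖)) := by
  have hsum {N : ℕ} (hN : 0 < N) {τ₁ : Matrix (Fin n) (Fin n) ℂ} {z : Fin n → ℂ}
      (hz : FJ.IsTorsionPoint N τ₁ z) (r : ℝ) (hr0 : 0 ≤ r)
      (hr : r < Real.exp (-(2 * Real.pi * FJ.torsionC τ₁ z))) :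
      Summable fun m : ℕ => ‖φ m τ₁ z‖ * r ^ m :=
    FJ.summable_norm_mul_pow_of_growth
      (fun _ hε => FJ.exists_norm_le_of_isTorsionPoint hn hf hcusp hN hz hε) hr0 hr
  refine ⟨fun N hN τ₁ z hz => ⟨fun q hq => ?_, ?_⟩, ?_⟩
  · simpa only [norm_mul, norm_pow] using hsum hN hz ‖q‖ (norm_nonneg q) hq
  · exact FJ.differentiableOn_tsum_mul_pow (hsum hN hz)
  · rintro τ hτ ⟨N, hN, hz⟩
    simp only [norm_mul, norm_pow]
    refine hsum hN hz _ (norm_nonneg _) ?_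
    rw [FJ.norm_e, Real.exp_lt_exp, neg_lt_neg_iff]
    exact mul_lt_mul_of_pos_left (FJ.torsionC_lt_im hτ) (by positivity)
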